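/- Let $\mathbb T^3=(\mathbb R/2\pi\mathbb Z)^3$ and write $u=\sum_{k\in\mathbb Z^3}\hat u_k e^{ik\cdot x}$ for a vector field $u\in L^2$. For $r\ge 1$ let $\mathcal H^r$ be the space of real-valued, mean-free, divergence-free fields ($\hat u_{-k}=\overline{\hat u_k}$, $\hat u_0=0$, $k\cdot\hat u_k=0$) with $\|u\|_{H^r}^2=\sum_k(1+|k|^2)^r|\hat u_k|^2<\infty$, and for $s\ge1$, $\tau>0$ let $\mathcal G^s_{r,\tau}$ be the space of $u\in\mathcal H^r$ with $\|u\|_{\mathcal G^s_{r,\tau}}^2=\sum_k|k|^{2r}e^{2\tau|k|^{1/s}}|\hat u_k|^2<\infty$. Let $\mathbb P$ be the Leray projector onto divergence-free fields and $A=-\mathbb P\Delta$. Consider the projected Navier–Stokes system, for $\nu>0$, $$\text{(PNS)}\qquad \tfrac{d}{dt}u^\nu+\nu Au^\nu+\mathbb P(u^\nu\cdot\nabla u^\nu)=0,\qquad u^\nu|_{t=0}=\mathbb Pa,$$ and the projected Euler system (PE), which is the same with $\nu=0$. A solution on $[0,T]$ is a function $u:[0,T]\to L^2$ such that $\nu Au+\mathbb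 P(u\cdot\nabla u)$ is integrable in time with values in $L^2$ and $u(t)=\mathbb Pa-\int_0^t\big(\nu Au+\mathbb P(u\cdot\nabla u)\big)(t')\,dt'$ for all $t\in[0,T]$. We write $u\in L^\infty([0,T];\mathcal G^s_{r,\tau(\cdot)})$ if $u$ is measurable, $u(t)\in\mathcal G^s_{r,\tau(t)}$ for almost every $t\in[0,T]$, and $\|u(t)\|_{\mathcal G^s_{r,\tau(t)}}$ is essentially bounded on $[0,T]$. For a datum $a$, let $T_*=T_*(r,a)\in[0,\infty]$ be the maximal time of the $\mathcal H^r$ solutions, uniformly in the viscosity: the supremum of the $T>0$ such that for every $\nu\ge0$ there is a solution on $[0,T]$ in $L^\infty([0,T];\mathcal H^r)$, with a bound there independent of $\nu$. **Theorem 3.3.** Let $r>9/2$. There is a constant $C>0$ depending only on $r$ such that the following holds for all $s\ge1$, $\tau_0>0$ and $a\in\mathcal G^s_{r,\tau_0}$. One has $T_*\ge \dfrac{1}{C\|a\|_{H^r}}$ (with $1/0=\infty$). Moreover, for every $0<T<T_*$ there are constants $C_1,C_2>0$, depending on $r,s,\tau_0,a,T$ but not on $\nu$, such that with $$\tau(t)=\frac{1}{e^{C_1t}\frac1{\tau_0}+\frac{C_2}{C_1}\left(e^{C_1t}-1\right)},\qquad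 0\le t\le T,$$ for every $\nu>0$ there is a unique solution $u^\nu$ of (PNS) on $[0,T]$ with $u^\nu\in L^\infty([0,T];\mathcal G^s_{r,\tau(\cdot)})$, and there is a unique solution $u$ of (PE) on $[0,T]$ with $u\in L^\infty([0,T];\mathcal G^s_{r,\tau(\cdot)})$. -/

import Mathlib

open MeasureTheory Set
open scoped ENNReal

noncomputable section

namespace GevreyNS

/-! ### Fourier series on the three-dimensional torus

A point `x` of the `2π`-periodic torus is written `x = 2π y` with `y` in the unit torus, so that
`e^{i k·x}` is the monomial `UnitAddTorus.mFourier k` evaluated at `y`. All differential operators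
below are derivatives in `x`. The measure is the normalised Lebesgue measure, so that the squared
`L²` norm is the sum of the squared absolute values of the Fourier coefficients. -/

/-- The torus. -/
abbrev Torus : Type := UnitAddTorus (Fin 3)

/-- The lattice of frequencies. -/
abbrev Freq : Type := Fin 3 → ℤ

/-- The normalised Lebesgue measure on the torus. -/
abbrev torusMeasure : Measure Torus := Measure.pi fun _ => AddCircle.haarAddCircle

/-- Square integrable scalar functions on the torus. -/
abbrev ScalarL2 : Type := Lp ℂ 2 torusMeasure

/-- Square integrable vector fields on the torus, given by their three components. -/
abbrev FieldL2 : Type := Fin 3 → ScalarL2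

/-- The Fourier coefficient `∫ e^{-i k·x} f(x) dx` (normalised measure). -/
def coeff (f : Torus → ℂ) (k : Freq) : ℂ := UnitAddTorus.mFourierCoeff f k

/-- The square integrable function with the prescribed square summable Fourier coefficients
(and `0` if the coefficients are not square summable). -/
def ofCoeff (c : Freq → ℂ) : ScalarL2 :=
  open scoped Classical in
  if h : Memℓp c 2 then (UnitAddTorus.mFourierBasis (d := Fin 3)).repr.symm ⟨c, h⟩ else 0

theorem coeff_ofCoeff {c : Freq → ℂ} (h : Memℓp c 2) (k : Freq) : coeff (ofCoeff c) k = c k := by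
  have h1 := UnitAddTorus.mFourierBasis_repr (d := Fin 3)
    ((UnitAddTorus.mFourierBasis (d := Fin 3)).repr.symm ⟨c, h⟩) k
  rw [LinearIsometryEquiv.apply_symm_apply] at h1
  unfold coeff ofCoeff
  rw [dif_pos h]
  exact h1.symm

/-- The vector Fourier coefficient of a vector field. -/
def fieldCoeff (v : Fin 3 → Torus → ℂ) (k : Freq) : Fin 3 → ℂ := fun i => coeff (v i) k

/-- The vector Fourier coefficient of a square integrable vector field. -/
def hat (u : FieldL2) (k : Freq) : Fin 3 → ℂ := fieldCoeff (fun i => (u i : Torus → ℂ)) k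

/-- `|k|²` for a frequency `k`. -/
def freqSq (k : Freq) : ℝ := ∑ i, (k i : ℝ) ^ 2

/-- The Euclidean length `|k|` of a frequency `k`. -/
def freqAbs (k : Freq) : ℝ := Real.sqrt (freqSq k)

/-- The bilinear product `k · c` of a frequency and a complex vector. -/
def freqDot (k : Freq) (c : Fin 3 → ℂ) : ℂ := ∑ i, (k i : ℂ) * c i

/-- `|c|²` for a complex vector `c`. -/
def vecSq (c : Fin 3 → ℂ) : ℝ := ∑ i, ‖c i‖ ^ 2

/-! ### Sobolev and Gevrey spaces of solenoidal fields -/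

/-- Real-valued, mean-free and divergence-free fields. -/
def IsSolenoidal (u : FieldL2) : Prop :=
  (∀ k i, hat u k i = starRingEnd ℂ (hat u (-k) i)) ∧ hat u 0 = 0 ∧
    ∀ k, freqDot k (hat u k) = 0

/-- Membership in the Sobolev space `H^r` of solenoidal fields. -/
def InSobolev (r : ℝ) (u : FieldL2) : Prop :=
  IsSolenoidal u ∧ Summable fun k : Freq => (1 + freqSq k) ^ r * vecSq (hat u k)

/-- The norm of `H^r`. -/
def sobolevNorm (r : ℝ) (u : FieldL2) : ℝ :=
  Real.sqrt (∑' k : Freq, (1 + freqSq k) ^ r * vecSq (hat u k))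

/-- The term of frequency `k` in the squared Gevrey norm. -/
def gevreyTerm (s r τ : ℝ) (u : FieldL2) (k : Freq) : ℝ :=
  freqAbs k ^ (2 * r) * Real.exp (2 * τ * freqAbs k ^ (1 / s)) * vecSq (hat u k)

/-- Membership in the Gevrey space `G^s_{r,τ}` of solenoidal fields. -/
def InGevrey (s r τ : ℝ) (u : FieldL2) : Prop :=
  InSobolev r u ∧ Summable (gevreyTerm s r τ u)

/-- The norm of `G^s_{r,τ}`. -/
def gevreyNorm (s r τ : ℝ) (u : FieldL2) : ℝ := Real.sqrt (∑' k : Freq, gevreyTerm s r τ u k)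

/-! ### The operators of the equations -/

/-- The weak partial derivative in the `j`-th coordinate (for functions in `H^1`). -/
def pderiv (j : Fin 3) (f : ScalarL2) : ScalarL2 :=
  ofCoeff fun k => Complex.I * (k j : ℂ) * coeff f k

/-- The Laplacian (for functions in `H^2`). -/
def laplacian (f : ScalarL2) : ScalarL2 := ofCoeff fun k => -(freqSq k : ℂ) * coeff f k

/-- The convection term `(u · ∇) u`, a pointwise product. -/
def convection (u : FieldL2) : Fin 3 → Torus → ℂ :=
  fun i x => ∑ j, u j x * pderiv j (u i) x

/-- The Leray projector onto divergence-free fields: at each frequency `k ≠ 0` it removes from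
the Fourier coefficient its component along `k`, and it keeps the mean (at `k = 0` the
subtracted term is `0`). -/
def leray (v : Fin 3 → Torus → ℂ) : FieldL2 :=
  fun i => ofCoeff fun k =>
    fieldCoeff v k i - (k i : ℂ) * freqDot k (fieldCoeff v k) / (freqSq k : ℂ)

/-- The Stokes operator `A = -P Δ`. -/
def stokes (u : FieldL2) : FieldL2 := -leray fun i => (laplacian (u i) : Torus → ℂ)

/-- `ν A u + P (u · ∇ u)`. -/
def drift (ν : ℝ) (u : FieldL2) : FieldL2 := (ν : ℂ) • stokes u + leray (convection u)

/-- `u` solves `du/dt + ν A u + P (u · ∇ u) = 0`, `u(0) = P a` on `[0, T]`, as an equation between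
functions of time with values in `L²`: `u` is a primitive (Bochner integral) of the integrable
function `-(ν A u + P (u · ∇ u))`. For `ν > 0` this is the projected Navier–Stokes system,
for `ν = 0` the projected Euler system. -/
def IsSolution (ν T : ℝ) (a : FieldL2) (u : ℝ → FieldL2) : Prop :=
  IntervalIntegrable (fun t => drift ν (u t)) volume 0 T ∧
    ∀ t ∈ Icc 0 T, u t = leray (fun i => (a i : Torus → ℂ)) - ∫ t' in (0 : ℝ)..t, drift ν (u t')

/-! ### Functions of time -/

/-- `u ∈ L^∞([0,T]; H^r)` with norm at most `M`. -/
def LinftySobolevLe (r T M : ℝ) (u : ℝ → FieldL2) : Prop :=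
  AEStronglyMeasurable u (volume.restrict (Icc 0 T)) ∧
    ∀ᵐ t ∂volume.restrict (Icc (0 : ℝ) T), InSobolev r (u t) ∧ sobolevNorm r (u t) ≤ M

/-- `u ∈ L^∞([0,T]; G^s_{r,τ(·)})`. -/
def InLinftyGevrey (s r : ℝ) (τ : ℝ → ℝ) (T : ℝ) (u : ℝ → FieldL2) : Prop :=
  AEStronglyMeasurable u (volume.restrict (Icc 0 T)) ∧
    ∃ M : ℝ, ∀ᵐ t ∂volume.restrict (Icc (0 : ℝ) T),
      InGevrey s r (τ t) (u t) ∧ gevreyNorm s r (τ t) (u t) ≤ M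

/-- There is exactly one solution on `[0, T]` with initial datum `a` in
`L^∞([0,T]; G^s_{r,τ(·)})`. -/
def ExistsUniqueGevreySolution (ν s r : ℝ) (τ : ℝ → ℝ) (T : ℝ) (a : FieldL2) : Prop :=
  ∃ u : ℝ → FieldL2, (InLinftyGevrey s r τ T u ∧ IsSolution ν T a u) ∧
    ∀ w : ℝ → FieldL2, InLinftyGevrey s r τ T w → IsSolution ν T a w → EqOn w u (Icc 0 T)

/-- The maximal time `T_*` of the `H^r` solutions with initial datum `a`, uniformly in the
viscosity: the supremum of the `T > 0` such that for all `ν ≥ 0` an `H^r` solution exists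
on `[0, T]`, with an `H^r` bound on `[0, T]` independent of `ν`. It may be infinite. -/
def maximalTime (r : ℝ) (a : FieldL2) : ℝ≥0∞ :=
  sSup {S : ℝ≥0∞ | ∃ T : ℝ, 0 < T ∧ S = ENNReal.ofReal T ∧
    ∃ M : ℝ, ∀ ν : ℝ, 0 ≤ ν → ∃ u : ℝ → FieldL2, LinftySobolevLe r T M u ∧ IsSolution ν T a u}

/-- The radius `τ(t) = 1 / (e^{C₁ t} / τ₀ + (C₂ / C₁) (e^{C₁ t} - 1))`. -/
def gevreyRadius (τ₀ C₁ C₂ t : ℝ) : ℝ :=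
  1 / (Real.exp (C₁ * t) * (1 / τ₀) + C₂ / C₁ * (Real.exp (C₁ * t) - 1))

end GevreyNS

end

/-!
The equations are studied through their Fourier coefficients. At the frequency `k` they read
`d/dt u_k = -ν |k|² u_k - P_k ∑_l i (l · u_{k-l}) u_l`, and a solution in `L^∞ H^r` is the same thing
as a continuous solution of this system with an `H^r` bound at every time
(`solvesModes_of_isSolution`, `drift_spec`, `exists_isSolution`). Everything else concerns
coefficient sequences and their Galerkin approximations, which solve the system truncated to a finite
set of frequencies and are global because their kinetic energy does not increase (`exists_galerkin`).

*The trilinear estimate.* Put `w(k) = |k|^r e^{τ |k|^{1/s}}` and let `λ = ∑ |k| |u_k|`, a bound for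
the Lipschitz norm of `u`. As `u` is divergence-free, the transport part of `⟪(u · ∇) u, w² u⟫`
cancels (`re_adv_antisymm`), and only differences `w(k) - w(l)` of the weight remain. Such a
difference gains one derivative, and splits into a part without the factor `τ` and a part with
it (`weight_sub_mul_le`). Young's inequality for convolutions then gives (`trilinear_le`)
`-⟪(u · ∇) u, w² u⟫ ≤ C λ ‖w u‖² + C τ ‖w u‖ ‖|k|^{1/(2s)} w u‖²`.
The first term does not see the Gevrey norm except quadratically, and the second one has a factor
`τ`. Here `r > 9/2` enters, as the condition for the convergence of `∑ |k|^{3/2 - r}`. The viscous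
term has a good sign, and so all bounds are uniform in `ν ≥ 0`.

*Existence time.* For `τ = 0` the estimate is `d/dt ‖u‖² ≤ C ‖u‖³` in `H^r`, so that the `H^r` norm
at most doubles up to a time of order `1 / ‖a‖` (`IsGalerkin.sobolevBound`).

*Stability.* If `v` is a solution bounded in `H^r` and `u` is its Galerkin approximation, then
`v - u` is small in `L²`, uniformly in time, with no assumption on `u` beyond the conservation of
energy: in the equation for the difference the transport by `u` disappears, and the other terms carry
derivatives of `v` only (`sum_norm_sub_sq_le`). This shows that the Galerkin approximations are Cauchy
(`exists_local_solution`), that solutions in `H^r` are unique (`eq_of_solvesModes`), and that the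
approximations converge to a given solution on its whole interval of existence.

*Propagation of Gevrey regularity.* For `τ` depending on time, the weighted energy balance contains
`τ' ‖|k|^{1/(2s)} w u‖²`. The radius of the theorem satisfies `τ' = -C₁ τ - C₂ τ²`, so if `C₁` is
large compared to an a priori bound `G` of `‖w u‖`, this term absorbs the second term of the trilinear
estimate. What is left is `d/dt ‖w u‖² ≤ C λ ‖w u‖²`, which is linear. For the Galerkin approximations
of an `H^r` solution `v`, `λ` is at most `C ‖v‖_{H^r} + 1` as long as `‖w u‖ ≤ G`: the low frequencies
of `u` are close to those of `v` by stability, and the high ones are small by the bound `G`. The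
bound `G` determined by the linear inequality is therefore never exceeded
(`wEnergy_le_gevreyBound`), and it passes to the limit (`wEnergy_le_of_solvesModes`).
-/

noncomputable section

namespace GevreyNS

open scoped InnerProductSpace

/-! ### Algebra of vector Fourier coefficients -/

/-- Vector Fourier amplitudes, with the Hermitian norm of `ℂ³`. -/
abbrev Vec : Type := EuclideanSpace ℂ (Fin 3)

/-- Sequences of vector Fourier coefficients. -/
abbrev Coeffs : Type := Freq → Vec

/-- A frequency as a vector of `ℂ³`. -/
def kvec (k : Freq) : Vec := WithLp.toLp 2 fun i => (k i : ℂ)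

lemma inner_kvec (k : Freq) (x : Vec) : ⟪kvec k, x⟫_ℂ = freqDot k x.ofLp := by
  simp [kvec, freqDot, PiLp.inner_apply, mul_comm]

lemma norm_sq_eq_vecSq (x : Vec) : ‖x‖ ^ 2 = vecSq x.ofLp := by
  simp [vecSq, EuclideanSpace.norm_sq_eq]

lemma norm_kvec_sq (k : Freq) : ‖kvec k‖ ^ 2 = freqSq k := by
  simp [kvec, freqSq, EuclideanSpace.norm_sq_eq]

lemma norm_kvec (k : Freq) : ‖kvec k‖ = freqAbs k := by
  rw [freqAbs, ← norm_kvec_sq, Real.sqrt_sq (norm_nonneg _)]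

lemma freqSq_eq (k : Freq) : freqSq k = freqAbs k ^ 2 := by
  rw [← norm_kvec_sq, norm_kvec]

lemma kvec_neg (k : Freq) : kvec (-k) = -kvec k := by
  ext i; simp [kvec]

lemma kvec_sub (k l : Freq) : kvec (k - l) = kvec k - kvec l := by
  ext i; simp [kvec]

@[simp] lemma kvec_zero : kvec 0 = 0 := by
  ext i; simp [kvec]

lemma freqAbs_nonneg (k : Freq) : 0 ≤ freqAbs k := Real.sqrt_nonneg _

@[simp] lemma freqAbs_zero : freqAbs 0 = 0 := by rw [← norm_kvec]; simp

lemma freqAbs_neg (k : Freq) : freqAbs (-k) = freqAbs k := by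
  rw [← norm_kvec, kvec_neg, norm_neg, norm_kvec]

lemma freqAbs_le_add_sub (k l : Freq) : freqAbs k ≤ freqAbs l + freqAbs (k - l) := by
  simp only [← norm_kvec, kvec_sub]
  simpa using norm_add_le (kvec l) (kvec k - kvec l)

lemma freqAbs_sub_comm (k l : Freq) : freqAbs (k - l) = freqAbs (l - k) := by
  rw [← freqAbs_neg, neg_sub]

lemma one_le_freqAbs {k : Freq} (hk : k ≠ 0) : 1 ≤ freqAbs k := by
  obtain ⟨i, hi⟩ := Function.ne_iff.mp hk
  rw [freqAbs, Real.one_le_sqrt]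
  have h1 : (1 : ℝ) ≤ (k i : ℝ) ^ 2 := by
    have : (1 : ℤ) ≤ (k i) ^ 2 := by
      have := sq_nonneg (k i)
      have h : (k i) ^ 2 ≠ 0 := pow_ne_zero 2 hi
      omega
    exact_mod_cast this
  exact h1.trans (Finset.single_le_sum (f := fun i => (k i : ℝ) ^ 2)
    (fun j _ => sq_nonneg _) (Finset.mem_univ i))

/-- The Leray projection at a single frequency. -/
def proj (k : Freq) : Vec →L[ℂ] Vec :=
  ContinuousLinearMap.id ℂ Vec -
    (innerSL ℂ (kvec k)).smulRight (((freqSq k : ℂ)⁻¹) • kvec k)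

lemma proj_apply (k : Freq) (x : Vec) :
    proj k x = x - (⟪kvec k, x⟫_ℂ / (freqSq k : ℂ)) • kvec k := by
  simp [proj, div_eq_mul_inv, smul_smul]

lemma inner_kvec_self (k : Freq) : ⟪kvec k, kvec k⟫_ℂ = (freqSq k : ℂ) := by
  rw [inner_self_eq_norm_sq_to_K, ← norm_kvec_sq]; simp

lemma inner_kvec_proj (k : Freq) (x : Vec) : ⟪kvec k, proj k x⟫_ℂ = 0 := by
  rw [proj_apply, inner_sub_right, inner_smul_right, inner_kvec_self]
  by_cases hk : k = 0
  · simp [hk]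
  · have h0 : freqAbs k ≠ 0 := (zero_lt_one.trans_le (one_le_freqAbs hk)).ne'
    have h : (freqSq k : ℂ) ≠ 0 := by
      rw [freqSq_eq]; exact_mod_cast pow_ne_zero 2 h0
    rw [div_mul_cancel₀ _ h, sub_self]

lemma inner_proj {k : Freq} {z : Vec} (hz : ⟪kvec k, z⟫_ℂ = 0) (x : Vec) :
    ⟪z, proj k x⟫_ℂ = ⟪z, x⟫_ℂ := by
  have h : ⟪z, kvec k⟫_ℂ = 0 := inner_eq_zero_symm.mp hz
  rw [proj_apply, inner_sub_right, inner_smul_right, h]; simp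

lemma proj_eq_self {k : Freq} {z : Vec} (hz : ⟪kvec k, z⟫_ℂ = 0) : proj k z = z := by
  rw [proj_apply, hz]; simp

lemma norm_proj_le (k : Freq) (x : Vec) : ‖proj k x‖ ≤ ‖x‖ := by
  have h1 : ⟪proj k x, proj k x⟫_ℂ = ⟪proj k x, x⟫_ℂ := inner_proj (inner_kvec_proj k x) x
  have h2 : ‖proj k x‖ ^ 2 ≤ ‖proj k x‖ * ‖x‖ := by
    have h3 := norm_inner_le_norm (𝕜 := ℂ) (proj k x) x
    rw [← h1, inner_self_eq_norm_sq_to_K] at h3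
    simpa using h3
  rcases (norm_nonneg (proj k x)).eq_or_lt with h0 | h0
  · rw [← h0]; exact norm_nonneg _
  · nlinarith

/-- Componentwise complex conjugation. -/
def cj : Vec ≃ₗᵢ[ℝ] Vec := LinearIsometryEquiv.piLpCongrRight 2 fun _ => Complex.conjLIE

@[simp] lemma cj_apply (x : Vec) (i : Fin 3) : cj x i = starRingEnd ℂ (x i) := by
  simp [cj]

lemma cj_smul (c : ℂ) (x : Vec) : cj (c • x) = starRingEnd ℂ c • cj x := by
  ext i; simp

lemma cj_kvec (k : Freq) : cj (kvec k) = kvec k := by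
  ext i; simp [kvec]

lemma inner_cj (x y : Vec) : ⟪cj x, cj y⟫_ℂ = starRingEnd ℂ ⟪x, y⟫_ℂ := by
  simp [PiLp.inner_apply]

lemma inner_kvec_cj (k : Freq) (x : Vec) : ⟪kvec k, cj x⟫_ℂ = starRingEnd ℂ ⟪kvec k, x⟫_ℂ := by
  rw [← inner_cj, cj_kvec]

lemma freqSq_neg (k : Freq) : freqSq (-k) = freqSq k := by simp [freqSq]

lemma cj_proj (k : Freq) (x : Vec) : cj (proj (-k) x) = proj k (cj x) := by
  rw [proj_apply, proj_apply, map_sub, cj_smul, inner_kvec_cj, kvec_neg,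
    map_neg, cj_kvec, freqSq_neg, inner_neg_left]
  simp [neg_div]

/-- Coefficient sequences of real-valued, mean-free, divergence-free fields. -/
structure Solenoidal (u : Coeffs) : Prop where
  real : ∀ k, u k = cj (u (-k))
  zero : u 0 = 0
  div : ∀ k, ⟪kvec k, u k⟫_ℂ = 0

/-- The Fourier coefficients of `(u · ∇) v`. -/
def adv (u v : Coeffs) (k : Freq) : Vec :=
  ∑' l, (Complex.I * ⟪kvec l, u (k - l)⟫_ℂ) • v l

/-- The right-hand side `-ν A u - P (u · ∇ u)` of the equations at the frequency `k`. -/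
def rhs (ν : ℝ) (u : Coeffs) (k : Freq) : Vec :=
  -((ν * freqSq k : ℝ) • u k) - proj k (adv u u k)

lemma norm_adv_term_le (u v : Coeffs) (k l : Freq) :
    ‖(Complex.I * ⟪kvec l, u (k - l)⟫_ℂ) • v l‖ ≤ ‖u (k - l)‖ * (freqAbs l * ‖v l‖) := by
  rw [norm_smul, norm_mul, Complex.norm_I, one_mul, ← norm_kvec]
  have := norm_inner_le_norm (𝕜 := ℂ) (kvec l) (u (k - l))
  calc _ ≤ (‖kvec l‖ * ‖u (k - l)‖) * ‖v l‖ := by gcongr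
    _ = _ := by ring

lemma summable_mul_of_bounded {q b : Freq → ℝ} {Q : ℝ} (hq0 : ∀ k, 0 ≤ q k) (hq : ∀ k, q k ≤ Q)
    (hb0 : ∀ l, 0 ≤ b l) (hb : Summable b) (k : Freq) : Summable fun l => q (k - l) * b l :=
  Summable.of_nonneg_of_le (fun _ => mul_nonneg (hq0 _) (hb0 _))
    (fun _ => mul_le_mul_of_nonneg_right (hq _) (hb0 _)) (hb.mul_left Q)

lemma summable_adv {u v : Coeffs} {M : ℝ} (hu : ∀ k, ‖u k‖ ≤ M)
    (hv : Summable fun l => freqAbs l * ‖v l‖) (k : Freq) :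
    Summable fun l => (Complex.I * ⟪kvec l, u (k - l)⟫_ℂ) • v l :=
  Summable.of_norm_bounded
    (summable_mul_of_bounded (fun k => norm_nonneg (u k)) hu
      (fun l => mul_nonneg (freqAbs_nonneg l) (norm_nonneg _)) hv k)
    (fun l => norm_adv_term_le u v k l)

lemma norm_adv_le {u v : Coeffs} {M : ℝ} (hu : ∀ k, ‖u k‖ ≤ M)
    (hv : Summable fun l => freqAbs l * ‖v l‖) (k : Freq) :
    ‖adv u v k‖ ≤ ∑' l, ‖u (k - l)‖ * (freqAbs l * ‖v l‖) :=
  tsum_of_norm_bounded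
    (summable_mul_of_bounded (fun k => norm_nonneg (u k)) hu
      (fun l => mul_nonneg (freqAbs_nonneg l) (norm_nonneg _)) hv k).hasSum
    (fun l => norm_adv_term_le u v k l)

lemma adv_sub_left {u u' v : Coeffs} {M M' : ℝ} (hu : ∀ k, ‖u k‖ ≤ M) (hu' : ∀ k, ‖u' k‖ ≤ M')
    (hv : Summable fun l => freqAbs l * ‖v l‖) (k : Freq) :
    adv (u - u') v k = adv u v k - adv u' v k := by
  rw [adv, adv, adv, ← (summable_adv hu hv k).tsum_sub (summable_adv hu' hv k)]
  refine tsum_congr fun l => ?_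
  rw [Pi.sub_apply, inner_sub_right, mul_sub, sub_smul]

lemma adv_add_right {u v v' : Coeffs} {M : ℝ} (hu : ∀ k, ‖u k‖ ≤ M)
    (hv : Summable fun l => freqAbs l * ‖v l‖) (hv' : Summable fun l => freqAbs l * ‖v' l‖)
    (k : Freq) : adv u (v + v') k = adv u v k + adv u v' k := by
  rw [adv, adv, adv, ← (summable_adv hu hv k).tsum_add (summable_adv hu hv' k)]
  refine tsum_congr fun l => ?_
  rw [Pi.add_apply, smul_add]

lemma adv_eq_sum {u v : Coeffs} {S : Finset Freq} (hv : ∀ l ∉ S, v l = 0) (k : Freq) :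
    adv u v k = ∑ l ∈ S, (Complex.I * ⟪kvec l, u (k - l)⟫_ℂ) • v l :=
  tsum_eq_sum fun l hl => by rw [hv l hl, smul_zero]

lemma adv_real {u : Coeffs} (hu : Solenoidal u) (k : Freq) :
    adv u u k = cj (adv u u (-k)) := by
  rw [adv, adv, ← (Equiv.neg Freq).tsum_eq]
  erw [cj.toContinuousLinearEquiv.map_tsum]
  refine tsum_congr fun l => ?_
  have h1 : u (k - -l) = cj (u (-k - l)) := by
    rw [hu.real (k - -l)]; congr 2; abel
  have h2 : u (-l) = cj (u l) := by rw [hu.real (-l), neg_neg]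
  simp only [Equiv.neg_apply]
  rw [h1, h2, kvec_neg, inner_neg_left, inner_kvec_cj]
  erw [cj_smul]
  simp

lemma adv_zero {u : Coeffs} (hu : Solenoidal u) : adv u u 0 = 0 := by
  rw [adv]
  convert tsum_zero with l
  have h := hu.div (0 - l)
  rw [zero_sub, kvec_neg, inner_neg_left, neg_eq_zero] at h
  rw [zero_sub, h]; simp

lemma inner_kvec_sub_eq {u : Coeffs} (hu : Solenoidal u) (k l : Freq) :
    ⟪kvec l, u (k - l)⟫_ℂ = ⟪kvec k, u (k - l)⟫_ℂ := by
  have h := hu.div (k - l)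
  rw [kvec_sub, inner_sub_left, sub_eq_zero] at h
  exact h.symm

/-- The antisymmetry behind the conservation of energy: `(k, l) ↦ i (l · u_{k-l}) ⟪z_k, z_l⟫`
changes into minus its conjugate when `k` and `l` are exchanged. -/
lemma re_adv_antisymm {u : Coeffs} (hu : Solenoidal u) (z : Coeffs) (k l : Freq) :
    ((Complex.I * ⟪kvec k, u (l - k)⟫_ℂ) * ⟪z l, z k⟫_ℂ).re =
      -((Complex.I * ⟪kvec l, u (k - l)⟫_ℂ) * ⟪z k, z l⟫_ℂ).re := by
  have h1 : u (l - k) = cj (u (k - l)) := by rw [hu.real (l - k), neg_sub]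
  rw [h1, inner_kvec_cj, ← inner_kvec_sub_eq hu k l, ← inner_conj_symm (z l) (z k)]
  generalize ⟪kvec l, u (k - l)⟫_ℂ = x
  generalize ⟪z k, z l⟫_ℂ = y
  simp only [Complex.mul_re, Complex.mul_im, Complex.I_re, Complex.I_im, Complex.conj_re,
    Complex.conj_im]
  ring

lemma sum_re_eq_zero_of_antisymm (S : Finset Freq) (a : Freq → Freq → ℝ)
    (h : ∀ k l, a l k = -a k l) : ∑ k ∈ S, ∑ l ∈ S, a k l = 0 := by
  have h1 : ∑ k ∈ S, ∑ l ∈ S, a k l = -∑ k ∈ S, ∑ l ∈ S, a k l := by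
    conv_lhs => rw [Finset.sum_comm]
    simp only [← Finset.sum_neg_distrib]
    exact Finset.sum_congr rfl fun k _ => Finset.sum_congr rfl fun l _ => by rw [h k l]
  linarith

/-- `⟪(u · ∇) z, z⟫ = 0`. -/
lemma re_inner_adv_self {u z : Coeffs} (hu : Solenoidal u) {S : Finset Freq}
    (hz : ∀ l ∉ S, z l = 0) : ∑ k ∈ S, (⟪z k, adv u z k⟫_ℂ).re = 0 := by
  have h := sum_re_eq_zero_of_antisymm S
    (fun k l => ((Complex.I * ⟪kvec l, u (k - l)⟫_ℂ) * ⟪z k, z l⟫_ℂ).re)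
    (fun k l => re_adv_antisymm hu z k l)
  rw [← h]
  refine Finset.sum_congr rfl fun k _ => ?_
  rw [adv_eq_sum hz, inner_sum, Complex.re_sum]
  refine Finset.sum_congr rfl fun l _ => ?_
  rw [inner_smul_right]

/-! ### Young's convolution inequality -/

lemma sum_mul_sub_le {S : Finset Freq} {p q : Freq → ℝ} {P Q : ℝ} (hP : 0 ≤ P) (hQ : 0 ≤ Q)
    (hp : ∑ k ∈ S, p k ^ 2 ≤ P ^ 2) (hq : ∀ F : Finset Freq, ∑ k ∈ F, q k ^ 2 ≤ Q ^ 2) (l : Freq) :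
    ∑ k ∈ S, p k * q (k - l) ≤ P * Q := by
  have h1 := Finset.sum_mul_sq_le_sq_mul_sq S p (fun k => q (k - l))
  have h2 : ∑ k ∈ S, q (k - l) ^ 2 ≤ Q ^ 2 := by
    have := hq (S.map (Equiv.subRight l).toEmbedding)
    simpa [Finset.sum_map] using this
  have h3 : (∑ k ∈ S, p k * q (k - l)) ^ 2 ≤ (P * Q) ^ 2 := by
    rw [mul_pow]
    exact h1.trans (mul_le_mul hp h2 (Finset.sum_nonneg fun _ _ => sq_nonneg _) (sq_nonneg _))
  exact abs_le_of_sq_le_sq' h3 (by positivity) |>.2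

lemma le_of_sq_sum_le {q : Freq → ℝ} {Q : ℝ} (hQ : 0 ≤ Q)
    (hq : ∀ F : Finset Freq, ∑ k ∈ F, q k ^ 2 ≤ Q ^ 2) (k : Freq) : q k ≤ Q := by
  have := hq {k}
  rw [Finset.sum_singleton] at this
  exact abs_le_of_sq_le_sq' this hQ |>.2

/-- `ℓ² * ℓ¹ ⊆ ℓ²`, tested against a finitely supported sequence. -/
lemma young_tsum {S : Finset Freq} {p q b : Freq → ℝ} {P Q : ℝ} (hP : 0 ≤ P) (hQ : 0 ≤ Q)
    (hp : ∑ k ∈ S, p k ^ 2 ≤ P ^ 2) (hq0 : ∀ k, 0 ≤ q k)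
    (hq : ∀ F : Finset Freq, ∑ k ∈ F, q k ^ 2 ≤ Q ^ 2) (hb0 : ∀ l, 0 ≤ b l) (hb : Summable b) :
    ∑ k ∈ S, p k * ∑' l, q (k - l) * b l ≤ P * Q * ∑' l, b l := by
  have hs : ∀ k, Summable fun l => q (k - l) * b l :=
    summable_mul_of_bounded hq0 (le_of_sq_sum_le hQ hq) hb0 hb
  have h1 : ∑ k ∈ S, p k * ∑' l, q (k - l) * b l = ∑' l, (∑ k ∈ S, p k * q (k - l)) * b l := by
    simp_rw [← tsum_mul_left, Finset.sum_mul, mul_assoc]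
    rw [Summable.tsum_finsetSum fun k _ => (hs k).mul_left _]
  rw [h1, ← tsum_mul_left]
  refine Summable.tsum_le_tsum (fun l => ?_) ?_ (hb.mul_left _)
  · exact mul_le_mul_of_nonneg_right (sum_mul_sub_le hP hQ hp hq l) (hb0 l)
  · simp_rw [Finset.sum_mul, mul_assoc]
    exact summable_sum fun k _ => (hs k).mul_left _

lemma tsum_sub_comm (q b : Freq → ℝ) (k : Freq) :
    ∑' l, b (k - l) * q l = ∑' l, q (k - l) * b l := by
  rw [← (Equiv.subLeft k).tsum_eq]
  simp [mul_comm]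

/-- Young's inequality for a finite sum, the summable factor evaluated at `l`. -/
lemma young_sum_right {S : Finset Freq} {p q b : Freq → ℝ} {P Q : ℝ} (hP : 0 ≤ P) (hQ : 0 ≤ Q)
    (hp0 : ∀ k, 0 ≤ p k) (hp : ∑ k ∈ S, p k ^ 2 ≤ P ^ 2) (hq0 : ∀ k, 0 ≤ q k)
    (hq : ∀ F : Finset Freq, ∑ k ∈ F, q k ^ 2 ≤ Q ^ 2) (hb0 : ∀ l, 0 ≤ b l) (hb : Summable b) :
    ∑ k ∈ S, ∑ l ∈ S, p k * q (k - l) * b l ≤ P * Q * ∑' l, b l := by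
  refine le_trans (Finset.sum_le_sum fun k _ => ?_) (young_tsum hP hQ hp hq0 hq hb0 hb)
  simp_rw [mul_assoc, ← Finset.mul_sum]
  refine mul_le_mul_of_nonneg_left ?_ (hp0 k)
  exact (summable_mul_of_bounded hq0 (le_of_sq_sum_le hQ hq) hb0 hb k).sum_le_tsum _
    fun l _ => mul_nonneg (hq0 _) (hb0 _)

/-- Young's inequality for a finite sum, the summable factor evaluated at `k - l`. -/
lemma young_sum_sub {S : Finset Freq} {p q b : Freq → ℝ} {P Q : ℝ} (hP : 0 ≤ P) (hQ : 0 ≤ Q)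
    (hp0 : ∀ k, 0 ≤ p k) (hp : ∑ k ∈ S, p k ^ 2 ≤ P ^ 2) (hq0 : ∀ k, 0 ≤ q k)
    (hq : ∀ F : Finset Freq, ∑ k ∈ F, q k ^ 2 ≤ Q ^ 2) (hb0 : ∀ l, 0 ≤ b l) (hb : Summable b) :
    ∑ k ∈ S, ∑ l ∈ S, p k * q l * b (k - l) ≤ P * Q * ∑' l, b l := by
  refine le_trans (Finset.sum_le_sum fun k _ => ?_) (young_tsum hP hQ hp hq0 hq hb0 hb)
  rw [← tsum_sub_comm]
  simp_rw [mul_assoc, ← Finset.mul_sum]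
  refine mul_le_mul_of_nonneg_left ?_ (hp0 k)
  have hs : Summable fun l => b (k - l) * q l := by
    have := (Equiv.subLeft k).summable_iff.mpr
      (summable_mul_of_bounded hq0 (le_of_sq_sum_le hQ hq) hb0 hb k)
    refine this.congr fun l => ?_
    simp [mul_comm]
  simp_rw [mul_comm (q _)]
  exact hs.sum_le_tsum _ fun l _ => mul_nonneg (hb0 _) (hq0 _)

/-! ### Lattice sums -/

lemma summable_freqAbs_rpow {q : ℝ} (hq : q < -3) : Summable fun k : Freq => freqAbs k ^ q := by
  let b := (EuclideanSpace.basisFun (Fin 3) ℝ).toBasis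
  let L : Submodule ℤ (EuclideanSpace ℝ (Fin 3)) := Submodule.span ℤ (Set.range b)
  have hfr : Module.finrank ℤ L = 3 := by
    rw [ZLattice.rank ℝ L]; simp
  have hs := ZLattice.summable_norm_rpow L q (by rw [hfr]; exact_mod_cast hq)
  have hmem : ∀ k : Freq, (∑ i, k i • b i) ∈ L := fun k =>
    Submodule.sum_mem _ fun i _ => Submodule.smul_mem _ _ (Submodule.subset_span ⟨i, rfl⟩)
  have hco : ∀ (k : Freq) (i : Fin 3), (∑ j, k j • b j) i = (k i : ℝ) := by
    intro k i
    simp [b, Pi.single_apply]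
  let φ : Freq → L := fun k => ⟨∑ i, k i • b i, hmem k⟩
  have hφ : Function.Injective φ := by
    intro k l hkl
    have h := congrArg Subtype.val hkl
    ext i
    have h2 := congrArg (fun x : EuclideanSpace ℝ (Fin 3) => x i) h
    simp only [φ, hco] at h2
    exact_mod_cast h2
  refine (hs.comp_injective hφ).congr fun k => ?_
  have : ‖φ k‖ = freqAbs k := by
    change ‖(∑ i, k i • b i : EuclideanSpace ℝ (Fin 3))‖ = _
    rw [EuclideanSpace.norm_eq, freqAbs, freqSq]
    simp only [hco, Real.norm_eq_abs, sq_abs]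
  change ‖φ k‖ ^ q = _
  rw [this]

/-- The constant `∑ |k|^{3/2 - r}`. The series converges exactly when `r > 9/2`. -/
def latticeSum (r : ℝ) : ℝ := ∑' k : Freq, freqAbs k ^ (3 / 2 - r)

lemma summable_lattice {r : ℝ} (hr : 9 / 2 < r) :
    Summable fun k : Freq => freqAbs k ^ (3 / 2 - r) :=
  summable_freqAbs_rpow (by linarith)

lemma latticeSum_nonneg (r : ℝ) : 0 ≤ latticeSum r :=
  tsum_nonneg fun k => Real.rpow_nonneg (freqAbs_nonneg k) _

/-! ### Pointwise bounds for the Gevrey weight -/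

/-- The weight `x^r e^{τ x^p}`; the Gevrey class `s` corresponds to `p = 1 / s`. -/
def weight (r p τ x : ℝ) : ℝ := x ^ r * Real.exp (τ * x ^ p)

lemma weight_nonneg (r p τ : ℝ) {x : ℝ} (hx : 0 ≤ x) : 0 ≤ weight r p τ x := by
  unfold weight; positivity

lemma weight_mono {r p τ x y : ℝ} (hr : 0 ≤ r) (hp : 0 ≤ p) (hτ : 0 ≤ τ) (hy : 0 ≤ y)
    (hxy : y ≤ x) : weight r p τ y ≤ weight r p τ x := by
  unfold weight
  gcongr
  exact Real.rpow_nonneg (hy.trans hxy) _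

/-- The commutator bound for the Sobolev weight: one of the two frequencies `m`, `y` on the right
carries a single derivative, the other one the weight. -/
lemma rpow_sub_rpow_mul_le {r x y m : ℝ} (hr : 1 < r) (hy : 0 < y) (hyx : y ≤ x)
    (hm : x ≤ y + m) : (x ^ r - y ^ r) * y ≤ r * 2 ^ (r - 1) * (m * y ^ r + m ^ r * y) := by
  have hx : 0 < x := hy.trans_le hyx
  have hm0 : 0 ≤ x - y := sub_nonneg.mpr hyx
  rcases hm0.eq_or_lt with h0 | h0
  · have : x = y := by linarith
    have hm' : 0 ≤ m := by linarith
    rw [this]; simp; positivity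
  have hmpos : 0 < m := by linarith
  have h1 : x ^ r - y ^ r ≤ r * (x - y) * x ^ (r - 1) := by
    have hb := one_add_mul_self_le_rpow_one_add (s := y / x - 1)
      (by have : 0 ≤ y / x := by positivity
          linarith) hr.le
    rw [show 1 + (y / x - 1) = y / x by ring, Real.div_rpow hy.le hx.le,
      le_div_iff₀ (Real.rpow_pos_of_pos hx r)] at hb
    have hxr : x ^ r = x ^ (r - 1) * x := by
      rw [← Real.rpow_add_one hx.ne']; congr 1; ring
    have : (1 + r * (y / x - 1)) * x ^ r = x ^ r - r * (x - y) * x ^ (r - 1) := by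
      rw [hxr]; field_simp; ring
    linarith
  have h2 : x ^ (r - 1) ≤ 2 ^ (r - 1) * (y ^ (r - 1) + m ^ (r - 1)) := by
    have hr1 : 0 ≤ r - 1 := by linarith
    have : x ≤ 2 * max y m := by
      have := le_max_left y m
      have := le_max_right y m
      linarith
    calc x ^ (r - 1) ≤ (2 * max y m) ^ (r - 1) := Real.rpow_le_rpow hx.le this hr1
      _ = 2 ^ (r - 1) * (max y m) ^ (r - 1) :=
        Real.mul_rpow (by norm_num) (hy.le.trans (le_max_left _ _))
      _ ≤ _ := by
        gcongr
        rcases max_choice y m with h | h <;> rw [h]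
        · have := Real.rpow_nonneg hmpos.le (r - 1); linarith
        · have := Real.rpow_nonneg hy.le (r - 1); linarith
  have e1 : y ^ r = y ^ (r - 1) * y := by
    rw [← Real.rpow_add_one hy.ne']; congr 1; ring
  have e2 : m ^ r = m ^ (r - 1) * m := by
    rw [← Real.rpow_add_one hmpos.ne']; congr 1; ring
  calc (x ^ r - y ^ r) * y ≤ (r * (x - y) * x ^ (r - 1)) * y := by gcongr
    _ ≤ (r * m * (2 ^ (r - 1) * (y ^ (r - 1) + m ^ (r - 1)))) * y := by
      have : x - y ≤ m := by linarith
      gcongr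
    _ = _ := by rw [e1, e2]; ring

lemma rpow_sub_rpow_mul_le_of_le_one {p x y m : ℝ} (hp1 : p ≤ 1) (hy : 0 < y)
    (hyx : y ≤ x) (hm : x ≤ y + m) : (x ^ p - y ^ p) * y ≤ m * x ^ p := by
  have hx : 0 < x := hy.trans_le hyx
  have hxp : 0 < x ^ p := Real.rpow_pos_of_pos hx p
  have h1 : y / x ≤ (y / x) ^ p := by
    have := Real.rpow_le_rpow_of_exponent_ge (x := y / x) (by positivity)
      ((div_le_one hx).mpr hyx) hp1
    simpa using this
  rw [Real.div_rpow hy.le hx.le, le_div_iff₀ hxp] at h1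
  have h2 : (x ^ p - y ^ p) * y ≤ (x ^ p - y / x * x ^ p) * x := by
    have h3 : y / x ≤ 1 := (div_le_one hx).mpr hyx
    have h4 : 0 ≤ x ^ p - y / x * x ^ p := by nlinarith
    calc (x ^ p - y ^ p) * y ≤ (x ^ p - y / x * x ^ p) * y := by gcongr
      _ ≤ _ := by gcongr
  have h5 : (x ^ p - y / x * x ^ p) * x = (x - y) * x ^ p := by field_simp
  rw [h5] at h2
  exact h2.trans (by gcongr; linarith)

lemma exp_le_one_add_mul_exp (t : ℝ) : Real.exp t ≤ 1 + t * Real.exp t := by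
  have h := Real.add_one_le_exp (-t)
  have h2 : Real.exp (-t) * Real.exp t = 1 := by rw [← Real.exp_add]; simp
  nlinarith [Real.exp_pos t]

/-- The constant of the commutator bound for the weight. -/
def commConst (r : ℝ) : ℝ := r * 2 ^ (r - 1)

lemma commConst_nonneg {r : ℝ} (hr : 0 ≤ r) : 0 ≤ commConst r := by
  unfold commConst; positivity

/-- The difference of the weights, with one derivative gained: the part without the factor `τ`
carries no exponential. -/
lemma weight_sub_mul_le {r p τ x y m : ℝ} (hr : 1 < r) (hp1 : p ≤ 1) (hτ : 0 ≤ τ)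
    (hy : 0 < y) (hyx : y ≤ x) (hm0 : 0 ≤ m) (hm : x ≤ y + m) :
    (weight r p τ x - weight r p τ y) * y ≤ (m * y ^ r + m ^ r * y) *
      (commConst r + (commConst r + 1) * (τ * x ^ p * Real.exp (τ * x ^ p))) := by
  have hx : 0 < x := hy.trans_le hyx
  have hc := commConst_nonneg (r := r) (by linarith)
  have hD : 0 ≤ m * y ^ r + m ^ r * y := by positivity
  have hxp : 0 ≤ x ^ p := by positivity
  set E := Real.exp (τ * x ^ p) with hE
  set F := Real.exp (τ * y ^ p) with hF
  have h1 : E - F ≤ τ * (x ^ p - y ^ p) * E := by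
    have h := Real.add_one_le_exp (-(τ * (x ^ p - y ^ p)))
    have h2 : F = Real.exp (-(τ * (x ^ p - y ^ p))) * E := by
      rw [hE, hF, ← Real.exp_add]; congr 1; ring
    rw [h2]; nlinarith [Real.exp_pos (τ * x ^ p)]
  have h2 : E ≤ 1 + τ * x ^ p * E := exp_le_one_add_mul_exp _
  have h3 := rpow_sub_rpow_mul_le hr hy hyx hm
  have h4 := rpow_sub_rpow_mul_le_of_le_one hp1 hy hyx hm
  have hE0 : 0 ≤ E := (Real.exp_pos _).le
  calc (weight r p τ x - weight r p τ y) * y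
      = (x ^ r - y ^ r) * y * E + y ^ r * ((E - F) * y) := by
        unfold weight; rw [← hE, ← hF]; ring
    _ ≤ commConst r * (m * y ^ r + m ^ r * y) * E +
          y ^ r * ((τ * (x ^ p - y ^ p) * E) * y) := by
        unfold commConst; gcongr
    _ ≤ commConst r * (m * y ^ r + m ^ r * y) * (1 + τ * x ^ p * E) +
          y ^ r * (τ * (m * x ^ p) * E) := by
        gcongr ?_ * ?_ + _ * ?_
        calc _ = τ * ((x ^ p - y ^ p) * y) * E := by ring
          _ ≤ _ := by gcongr
    _ ≤ _ := by
        have : 0 ≤ m ^ r * y * (τ * x ^ p * E) := by positivity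
        nlinarith

/-- The exponent `p` at the largest frequency is shared among all three frequencies of an interaction,
`p / 2` at each. -/
lemma rpow_le_two_mul_mul {p a b c : ℝ} (hp : 0 ≤ p) (hp1 : p ≤ 1) (hb : 1 ≤ b) (hc : 1 ≤ c)
    (ha : 0 ≤ a) (h : a ≤ b + c) :
    a ^ p ≤ 2 * (a ^ (p / 2) * b ^ (p / 2) * c ^ (p / 2)) := by
  have h1 : a ^ (p / 2) ≤ b ^ (p / 2) + c ^ (p / 2) :=
    (Real.rpow_le_rpow ha h (by linarith)).trans
      (Real.rpow_add_le_add_rpow (by linarith) (by linarith) (by linarith) (by linarith))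
  have hb1 : 1 ≤ b ^ (p / 2) := Real.one_le_rpow hb (by linarith)
  have hc1 : 1 ≤ c ^ (p / 2) := Real.one_le_rpow hc (by linarith)
  have h2 : a ^ (p / 2) ≤ 2 * (b ^ (p / 2) * c ^ (p / 2)) := by nlinarith
  have h3 : a ^ p = a ^ (p / 2) * a ^ (p / 2) := by
    rw [← Real.rpow_add_of_nonneg ha (by linarith) (by linarith)]; congr 1; ring
  rw [h3]
  have := Real.rpow_nonneg ha (p / 2)
  nlinarith

/-- The weight at a frequency. -/
abbrev fweight (r p τ : ℝ) (k : Freq) : ℝ := weight r p τ (freqAbs k)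

/-- The commutator bound for the Gevrey weight at interacting frequencies. The exponential at the
larger one of `k`, `l` is split by the subadditivity of `x ↦ x^p`. -/
lemma min_mul_abs_weight_sub_le {r p τ : ℝ} (hr : 1 < r) (hp : 0 ≤ p) (hp1 : p ≤ 1) (hτ : 0 ≤ τ)
    {k l : Freq} (hk : k ≠ 0) (hl : l ≠ 0) (hkl : k - l ≠ 0) :
    min (freqAbs k) (freqAbs l) * |fweight r p τ k - fweight r p τ l| ≤
      (freqAbs (k - l) * freqAbs l ^ r + freqAbs (k - l) ^ r * freqAbs l) *
        (commConst r + (commConst r + 1) * (τ * (2 * (freqAbs k ^ (p / 2) * freqAbs l ^ (p / 2) *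
          freqAbs (k - l) ^ (p / 2))) *
          (Real.exp (τ * freqAbs l ^ p) * Real.exp (τ * freqAbs (k - l) ^ p)))) := by
  have ak := one_le_freqAbs hk
  have al := one_le_freqAbs hl
  have am := one_le_freqAbs hkl
  have h1 := freqAbs_le_add_sub k l
  have h2 : freqAbs l ≤ freqAbs k + freqAbs (k - l) := by
    rw [freqAbs_sub_comm]; exact freqAbs_le_add_sub l k
  have hc := commConst_nonneg (r := r) (by linarith)
  unfold fweight
  generalize freqAbs k = x at *
  generalize freqAbs l = y at *
  generalize freqAbs (k - l) = m at *
  rw [← Real.exp_add, ← mul_add]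
  have hexp : ∀ a b : ℝ, 0 ≤ a → 0 ≤ b → a ≤ b + m → b ≤ y → a ^ p ≤ y ^ p + m ^ p := by
    intro a b ha hb hab hby
    calc a ^ p ≤ (b + m) ^ p := Real.rpow_le_rpow ha hab hp
      _ ≤ b ^ p + m ^ p := Real.rpow_add_le_add_rpow hb (by linarith) hp hp1
      _ ≤ _ := by gcongr
  rcases le_total y x with hyx | hyx
  · rw [min_eq_right hyx, abs_of_nonneg (sub_nonneg.mpr
      (weight_mono (by linarith) hp hτ (by linarith) hyx)), mul_comm]
    refine (weight_sub_mul_le hr hp1 hτ (by linarith) hyx (by linarith) h1).trans ?_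
    gcongr
    · exact rpow_le_two_mul_mul hp hp1 al am (by linarith) h1
    · exact hexp x y (by linarith) (by linarith) h1 le_rfl
  · rw [min_eq_left hyx, abs_sub_comm, abs_of_nonneg (sub_nonneg.mpr
      (weight_mono (by linarith) hp hτ (by linarith) hyx)), mul_comm]
    refine (weight_sub_mul_le hr hp1 hτ (by linarith) hyx (by linarith) h2).trans ?_
    gcongr
    · have := rpow_le_two_mul_mul hp hp1 ak am (by linarith) h2
      rw [mul_comm (x ^ (p / 2))]
      exact this
    · exact hexp y x (by linarith) (by linarith) h2 hyx

/-! ### The trilinear estimate -/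

lemma sum_le_sum_of_eq_zero {S : Finset Freq} {f : Freq → ℝ} (hf0 : ∀ k, 0 ≤ f k)
    (hf : ∀ k ∉ S, f k = 0) (F : Finset Freq) : ∑ k ∈ F, f k ≤ ∑ k ∈ S, f k := by
  classical
  calc ∑ k ∈ F, f k ≤ ∑ k ∈ F ∪ S, f k :=
        Finset.sum_le_sum_of_subset_of_nonneg Finset.subset_union_left fun k _ _ => hf0 k
    _ = ∑ k ∈ S, f k := (Finset.sum_subset Finset.subset_union_right fun k _ hk => hf k hk).symm

/-- Symmetrised form of `⟪(u · ∇) u, w² u⟫`. -/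
lemma sum_weight_inner_adv {u : Coeffs} (hu : Solenoidal u) {S : Finset Freq}
    (hS : ∀ l ∉ S, u l = 0) (w : Freq → ℝ) :
    ∑ k ∈ S, w k ^ 2 * (⟪u k, adv u u k⟫_ℂ).re = ∑ k ∈ S, ∑ l ∈ S, w k * (w k - w l) *
      ((Complex.I * ⟪kvec l, u (k - l)⟫_ℂ) * ⟪u k, u l⟫_ℂ).re := by
  have h := sum_re_eq_zero_of_antisymm S
    (fun k l => w k * w l * ((Complex.I * ⟪kvec l, u (k - l)⟫_ℂ) * ⟪u k, u l⟫_ℂ).re)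
    (fun k l => by rw [re_adv_antisymm hu u k l]; ring)
  have h1 : ∑ k ∈ S, w k ^ 2 * (⟪u k, adv u u k⟫_ℂ).re = ∑ k ∈ S, ∑ l ∈ S, w k ^ 2 *
      ((Complex.I * ⟪kvec l, u (k - l)⟫_ℂ) * ⟪u k, u l⟫_ℂ).re := by
    refine Finset.sum_congr rfl fun k _ => ?_
    rw [adv_eq_sum hS, inner_sum, Complex.re_sum, Finset.mul_sum]
    refine Finset.sum_congr rfl fun l _ => ?_
    rw [inner_smul_right]
  rw [h1, ← sub_zero (∑ k ∈ S, ∑ l ∈ S, _), ← h, ← Finset.sum_sub_distrib]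
  refine Finset.sum_congr rfl fun k _ => ?_
  rw [← Finset.sum_sub_distrib]
  exact Finset.sum_congr rfl fun l _ => by ring

/-- The derivative falls on the lower one of the frequencies `k`, `l`, since `k · u_{k-l} = l · u_{k-l}`. -/
lemma abs_re_adv_le {u : Coeffs} (hu : Solenoidal u) (k l : Freq) :
    |((Complex.I * ⟪kvec l, u (k - l)⟫_ℂ) * ⟪u k, u l⟫_ℂ).re| ≤
      min (freqAbs k) (freqAbs l) * (‖u (k - l)‖ * ‖u k‖ * ‖u l‖) := by
  refine (Complex.abs_re_le_norm _).trans ?_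
  rw [norm_mul, norm_mul, Complex.norm_I, one_mul]
  have h1 : ‖⟪kvec l, u (k - l)⟫_ℂ‖ ≤ min (freqAbs k) (freqAbs l) * ‖u (k - l)‖ := by
    have hl := norm_inner_le_norm (𝕜 := ℂ) (kvec l) (u (k - l))
    have hk := norm_inner_le_norm (𝕜 := ℂ) (kvec k) (u (k - l))
    rw [← inner_kvec_sub_eq hu k l] at hk
    rw [norm_kvec] at hk hl
    rcases min_choice (freqAbs k) (freqAbs l) with h | h <;> rw [h] <;> assumption
  have h2 := norm_inner_le_norm (𝕜 := ℂ) (u k) (u l)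
  calc _ ≤ (min (freqAbs k) (freqAbs l) * ‖u (k - l)‖) * (‖u k‖ * ‖u l‖) :=
        mul_le_mul h1 h2 (norm_nonneg _) ((norm_nonneg _).trans h1)
    _ = _ := by ring

/-- `|k| |u_k|`. -/
def gradAbs (u : Coeffs) (k : Freq) : ℝ := freqAbs k * ‖u k‖

lemma gradAbs_nonneg (u : Coeffs) (k : Freq) : 0 ≤ gradAbs u k :=
  mul_nonneg (freqAbs_nonneg k) (norm_nonneg _)

/-- Pointwise form of the trilinear estimate. With `g = w |u|`, `h = |k|^{p/2} w |u|`,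
`n = |k|^r |u|` and `b = |k|^{1 + p/2} e^{τ |k|^p} |u|`, the derivative always falls on a factor
that is summed in `ℓ¹`. -/
lemma trilinear_pointwise {r p τ : ℝ} (hr : 1 < r) (hp : 0 ≤ p) (hp1 : p ≤ 1) (hτ : 0 ≤ τ)
    {u : Coeffs} (hu : Solenoidal u) {g h n b : Freq → ℝ}
    (hg : ∀ k, g k = fweight r p τ k * ‖u k‖)
    (hh : ∀ k, h k = freqAbs k ^ (p / 2) * g k)
    (hn : ∀ k, n k = freqAbs k ^ r * ‖u k‖)
    (hb : ∀ k, b k = freqAbs k ^ (p / 2) * Real.exp (τ * freqAbs k ^ p) * gradAbs u k)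
    (k l : Freq) :
    -(fweight r p τ k * (fweight r p τ k - fweight r p τ l) *
      ((Complex.I * ⟪kvec l, u (k - l)⟫_ℂ) * ⟪u k, u l⟫_ℂ).re) ≤
      commConst r * (g k * n l * gradAbs u (k - l) + g k * n (k - l) * gradAbs u l) +
        2 * (commConst r + 1) * τ * (h k * h l * b (k - l) + h k * h (k - l) * b l) := by
  have hc := commConst_nonneg (r := r) (by linarith)
  have hw0 : ∀ k, 0 ≤ fweight r p τ k := fun k => weight_nonneg r p τ (freqAbs_nonneg k)
  have hg0 : ∀ k, 0 ≤ g k := fun k => by rw [hg]; exact mul_nonneg (hw0 k) (norm_nonneg _)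
  have hh0 : ∀ k, 0 ≤ h k := fun k => by
    rw [hh]; exact mul_nonneg (Real.rpow_nonneg (freqAbs_nonneg k) _) (hg0 k)
  have hn0 : ∀ k, 0 ≤ n k := fun k => by
    rw [hn]; exact mul_nonneg (Real.rpow_nonneg (freqAbs_nonneg k) _) (norm_nonneg _)
  have hd0 := gradAbs_nonneg u
  have hb0 : ∀ k, 0 ≤ b k := fun k => by
    rw [hb]; exact mul_nonneg (mul_nonneg (Real.rpow_nonneg (freqAbs_nonneg k) _)
      (Real.exp_pos _).le) (hd0 k)
  have hR : 0 ≤ commConst r * (g k * n l * gradAbs u (k - l) + g k * n (k - l) * gradAbs u l) +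
        2 * (commConst r + 1) * τ * (h k * h l * b (k - l) + h k * h (k - l) * b l) := by
    have := mul_nonneg (mul_nonneg (hg0 k) (hn0 l)) (hd0 (k - l))
    have := mul_nonneg (mul_nonneg (hg0 k) (hn0 (k - l))) (hd0 l)
    have := mul_nonneg (mul_nonneg (hh0 k) (hh0 l)) (hb0 (k - l))
    have := mul_nonneg (mul_nonneg (hh0 k) (hh0 (k - l))) (hb0 l)
    positivity
  by_cases hk : k = 0
  · have : u k = 0 := by rw [hk, hu.zero]
    simpa [this] using hR
  by_cases hl : l = 0
  · have : u l = 0 := by rw [hl, hu.zero]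
    simpa [this] using hR
  by_cases hkl : k - l = 0
  · have : u (k - l) = 0 := by rw [hkl, hu.zero]
    simpa [this] using hR
  have hA := abs_re_adv_le hu k l
  have hB := min_mul_abs_weight_sub_le hr hp hp1 hτ hk hl hkl
  generalize ((Complex.I * ⟪kvec l, u (k - l)⟫_ℂ) * ⟪u k, u l⟫_ℂ).re = A at *
  calc -(fweight r p τ k * (fweight r p τ k - fweight r p τ l) * A)
      ≤ |fweight r p τ k * (fweight r p τ k - fweight r p τ l) * A| := neg_le_abs _
    _ = fweight r p τ k * |fweight r p τ k - fweight r p τ l| * |A| := by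
        rw [abs_mul, abs_mul, abs_of_nonneg (hw0 k)]
    _ ≤ fweight r p τ k * |fweight r p τ k - fweight r p τ l| *
          (min (freqAbs k) (freqAbs l) * (‖u (k - l)‖ * ‖u k‖ * ‖u l‖)) := by
        have := hw0 k
        gcongr
    _ = (min (freqAbs k) (freqAbs l) * |fweight r p τ k - fweight r p τ l|) *
          (fweight r p τ k * ‖u k‖ * (‖u (k - l)‖ * ‖u l‖)) := by ring
    _ ≤ _ := mul_le_mul_of_nonneg_right hB (by have := hw0 k; positivity)
    _ = _ := by
        rw [hh, hh, hh, hb, hb, hg l, hg (k - l), ← hg k, hn, hn]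
        unfold fweight weight gradAbs
        ring

/-- The `ℓ¹` norm of `|k| u`, for a finitely supported sequence. -/
def gradSum (S : Finset Freq) (u : Coeffs) : ℝ := ∑ k ∈ S, gradAbs u k

/-- The squared weighted norm. -/
def wEnergy (r p τ : ℝ) (S : Finset Freq) (u : Coeffs) : ℝ :=
  ∑ k ∈ S, fweight r p τ k ^ 2 * ‖u k‖ ^ 2

/-- The squared weighted norm with half of the derivative that a Gevrey class gains. -/
def wDissip (r p τ : ℝ) (S : Finset Freq) (u : Coeffs) : ℝ :=
  ∑ k ∈ S, freqAbs k ^ p * (fweight r p τ k ^ 2 * ‖u k‖ ^ 2)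

lemma wEnergy_nonneg (r p τ : ℝ) (S : Finset Freq) (u : Coeffs) : 0 ≤ wEnergy r p τ S u :=
  Finset.sum_nonneg fun _ _ => by positivity

lemma wDissip_nonneg (r p τ : ℝ) (S : Finset Freq) (u : Coeffs) : 0 ≤ wDissip r p τ S u :=
  Finset.sum_nonneg fun k _ => by
    have := Real.rpow_nonneg (freqAbs_nonneg k) p
    positivity

/-- The nonlinear term in the Gevrey energy balance. The first contribution involves no Gevrey
norm except quadratically; the second one carries a factor `τ` and can be absorbed by letting the
radius `τ` decrease. -/
theorem trilinear_le {r p τ : ℝ} (hr : 9 / 2 < r) (hp : 0 ≤ p) (hp1 : p ≤ 1) (hτ : 0 ≤ τ)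
    {u : Coeffs} (hu : Solenoidal u) {S : Finset Freq} (hS : ∀ l ∉ S, u l = 0) :
    -∑ k ∈ S, fweight r p τ k ^ 2 * (⟪u k, adv u u k⟫_ℂ).re ≤
      2 * commConst r * gradSum S u * wEnergy r p τ S u +
      4 * (commConst r + 1) * latticeSum r * τ * √(wEnergy r p τ S u) * wDissip r p τ S u := by
  have hc := commConst_nonneg (r := r) (by linarith)
  let g : Freq → ℝ := fun k => fweight r p τ k * ‖u k‖
  let h : Freq → ℝ := fun k => freqAbs k ^ (p / 2) * g k
  let n : Freq → ℝ := fun k => freqAbs k ^ r * ‖u k‖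
  let b : Freq → ℝ := fun k => freqAbs k ^ (p / 2) * Real.exp (τ * freqAbs k ^ p) * gradAbs u k
  have ha0 := freqAbs_nonneg
  have hw0 : ∀ k, 0 ≤ fweight r p τ k := fun k => weight_nonneg r p τ (ha0 k)
  have hg0 : ∀ k, 0 ≤ g k := fun k => mul_nonneg (hw0 k) (norm_nonneg _)
  have hh0 : ∀ k, 0 ≤ h k := fun k => mul_nonneg (Real.rpow_nonneg (ha0 k) _) (hg0 k)
  have hn0 : ∀ k, 0 ≤ n k := fun k => mul_nonneg (Real.rpow_nonneg (ha0 k) _) (norm_nonneg _)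
  have hd0 := gradAbs_nonneg u
  have hb0 : ∀ k, 0 ≤ b k := fun k =>
    mul_nonneg (mul_nonneg (Real.rpow_nonneg (ha0 k) _) (Real.exp_pos _).le) (hd0 k)
  have hgz : ∀ k ∉ S, g k = 0 := fun k hk => by simp [g, hS k hk]
  have hhz : ∀ k ∉ S, h k = 0 := fun k hk => by simp [h, hgz k hk]
  have hnz : ∀ k ∉ S, n k = 0 := fun k hk => by simp [n, hS k hk]
  have hdz : ∀ k ∉ S, gradAbs u k = 0 := fun k hk => by simp [gradAbs, hS k hk]
  have hbz : ∀ k ∉ S, b k = 0 := fun k hk => by simp [b, hdz k hk]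
  set G := √(wEnergy r p τ S u) with hG
  set H := √(wDissip r p τ S u) with hH
  have hG0 : 0 ≤ G := Real.sqrt_nonneg _
  have hH0 : 0 ≤ H := Real.sqrt_nonneg _
  have hG2 : G ^ 2 = wEnergy r p τ S u := Real.sq_sqrt (wEnergy_nonneg _ _ _ _ _)
  have hH2 : H ^ 2 = wDissip r p τ S u := Real.sq_sqrt (wDissip_nonneg _ _ _ _ _)
  have hgS : ∑ k ∈ S, g k ^ 2 ≤ G ^ 2 := by
    rw [hG2]; exact (Finset.sum_congr rfl fun k _ => mul_pow _ _ _).le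
  have hhS : ∑ k ∈ S, h k ^ 2 ≤ H ^ 2 := by
    rw [hH2]
    refine (Finset.sum_congr rfl fun k _ => ?_).le
    have : (freqAbs k ^ (p / 2)) ^ 2 = freqAbs k ^ p := by
      rw [← Real.rpow_mul_natCast (ha0 k)]; congr 1; push_cast; ring
    simp only [h, g]
    rw [mul_pow, mul_pow, this]
  have hnS : ∑ k ∈ S, n k ^ 2 ≤ G ^ 2 := by
    refine le_trans (Finset.sum_le_sum fun k _ => ?_) hgS
    have h1 : n k ≤ g k := by
      refine mul_le_mul_of_nonneg_right ?_ (norm_nonneg _)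
      refine le_mul_of_one_le_right (Real.rpow_nonneg (ha0 k) _) (Real.one_le_exp ?_)
      exact mul_nonneg hτ (Real.rpow_nonneg (ha0 k) _)
    exact pow_le_pow_left₀ (hn0 k) h1 2
  have hnF : ∀ F : Finset Freq, ∑ k ∈ F, n k ^ 2 ≤ G ^ 2 := fun F =>
    (sum_le_sum_of_eq_zero (fun k => sq_nonneg (n k)) (fun k hk => by simp [hnz k hk]) F).trans hnS
  have hhF : ∀ F : Finset Freq, ∑ k ∈ F, h k ^ 2 ≤ H ^ 2 := fun F =>
    (sum_le_sum_of_eq_zero (fun k => sq_nonneg (h k)) (fun k hk => by simp [hhz k hk]) F).trans hhS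
  have hds : Summable (gradAbs u) := summable_of_ne_finset_zero (s := S) fun k hk => hdz k hk
  have hbs : Summable b := summable_of_ne_finset_zero (s := S) fun k hk => hbz k hk
  have hdt : ∑' k, gradAbs u k = gradSum S u := tsum_eq_sum fun k hk => hdz k hk
  -- Here the hypothesis on `r` enters: `b_k = |k|^{1 + p/2 - r} g_k ≤ |k|^{3/2 - r} g_k`.
  have hbt : ∑' k, b k ≤ latticeSum r * G := by
    rw [latticeSum, ← tsum_mul_right]
    refine hbs.tsum_le_tsum (fun k => ?_) ((summable_lattice hr).mul_right G)
    by_cases hk : k ∈ S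
    · by_cases hk0 : k = 0
      · have : b k = 0 := by simp [b, gradAbs, hk0]
        rw [this]; exact mul_nonneg (Real.rpow_nonneg (ha0 k) _) hG0
      have h1 := one_le_freqAbs hk0
      have hgk : g k ≤ G := by
        refine abs_le_of_sq_le_sq' (le_trans ?_ hgS) hG0 |>.2
        exact Finset.single_le_sum (f := fun k => g k ^ 2) (fun _ _ => sq_nonneg _) hk
      have e : b k = freqAbs k ^ (p / 2 + 1 - r) * g k := by
        simp only [b, g, gradAbs, fweight, weight]
        rw [Real.rpow_sub (by linarith), Real.rpow_add (by linarith), Real.rpow_one]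
        have : freqAbs k ^ r ≠ 0 := (Real.rpow_pos_of_pos (by linarith) r).ne'
        field_simp
      rw [e]
      exact mul_le_mul (Real.rpow_le_rpow_of_exponent_le h1 (by linarith)) hgk (hg0 k)
        (Real.rpow_nonneg (ha0 k) _)
    · rw [hbz k hk]; exact mul_nonneg (Real.rpow_nonneg (ha0 k) _) hG0
  rw [sum_weight_inner_adv hu hS, ← Finset.sum_neg_distrib]
  simp_rw [← Finset.sum_neg_distrib]
  have key := Finset.sum_le_sum fun k (_ : k ∈ S) => Finset.sum_le_sum fun l (_ : l ∈ S) =>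
    trilinear_pointwise (by linarith : 1 < r) hp hp1 hτ hu (g := g) (h := h) (n := n) (b := b)
      (fun _ => rfl) (fun _ => rfl) (fun _ => rfl) (fun _ => rfl) k l
  refine key.trans ?_
  simp only [Finset.sum_add_distrib, ← Finset.mul_sum]
  have y1 := young_sum_sub hG0 hG0 hg0 hgS hn0 hnF hd0 hds
  have y2 := young_sum_right hG0 hG0 hg0 hgS hn0 hnF hd0 hds
  have y3 := young_sum_sub hH0 hH0 hh0 hhS hh0 hhF hb0 hbs
  have y4 := young_sum_right hH0 hH0 hh0 hhS hh0 hhF hb0 hbs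
  rw [hdt] at y1 y2
  have y5 : H * H * ∑' k, b k ≤ H * H * (latticeSum r * G) := by gcongr
  rw [← hG2, ← hH2]
  calc _ ≤ commConst r * (G * G * gradSum S u + G * G * gradSum S u) +
        2 * (commConst r + 1) * τ * (H * H * (latticeSum r * G) + H * H * (latticeSum r * G)) := by
        gcongr
        · exact y3.trans y5
        · exact y4.trans y5
    _ = _ := by ring

/-! ### Galerkin approximations -/

lemma HasDerivWithinAt.right_of_Icc {E : Type*} [NormedAddCommGroup E] [NormedSpace ℝ E]
    {f : ℝ → E} {f' : E} {T t : ℝ} (h : HasDerivWithinAt f f' (Icc 0 T) t) (ht : t ∈ Ico 0 T) :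
    HasDerivWithinAt f f' (Ici t) t :=
  h.mono_of_mem_nhdsWithin (Icc_mem_nhdsGE_of_mem ht)

/-- A barrier argument: `f` cannot cross `B` where its slope is smaller. -/
lemma le_of_deriv_lt_barrier {f f' B B' : ℝ → ℝ} {T : ℝ}
    (hf : ∀ t ∈ Icc 0 T, HasDerivWithinAt f (f' t) (Icc 0 T) t) (h0 : f 0 ≤ B 0)
    (hB : ∀ t, HasDerivAt B (B' t) t)
    (hlt : ∀ t ∈ Icc 0 T, f t = B t → f' t < B' t) {t : ℝ} (ht : t ∈ Icc 0 T) : f t ≤ B t :=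
  image_le_of_deriv_right_lt_deriv_boundary (fun t ht => (hf t ht).continuousWithinAt)
    (fun t ht => HasDerivWithinAt.right_of_Icc (hf t (Ico_subset_Icc_self ht)) ht) h0 hB
    (fun t ht => hlt t (Ico_subset_Icc_self ht)) ht

lemma le_of_deriv_nonpos {f f' : ℝ → ℝ} {T : ℝ}
    (hf : ∀ t ∈ Icc 0 T, HasDerivWithinAt f (f' t) (Icc 0 T) t)
    (hle : ∀ t ∈ Icc 0 T, f' t ≤ 0) {t : ℝ} (ht : t ∈ Icc 0 T) : f t ≤ f 0 :=
  image_le_of_deriv_right_le_deriv_boundary (B := fun _ => f 0) (B' := fun _ => 0)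
    (fun _ ht => (hf _ ht).continuousWithinAt)
    (fun _ ht => HasDerivWithinAt.right_of_Icc (hf _ (Ico_subset_Icc_self ht)) ht) le_rfl
    continuousOn_const (fun _ _ => hasDerivWithinAt_const _ _ _)
    (fun t ht => hle t (Ico_subset_Icc_self ht)) ht

lemma hasDerivWithinAt_norm_sq {f : ℝ → Vec} {f' : Vec} {s : Set ℝ} {t : ℝ}
    (h : HasDerivWithinAt f f' s t) :
    HasDerivWithinAt (fun t => ‖f t‖ ^ 2) (2 * (⟪f t, f'⟫_ℂ).re) s t := by
  have h1 := (h.inner ℂ h)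
  have h2 := (Complex.reCLM.hasFDerivAt.comp_hasDerivWithinAt t h1)
  refine (h2.congr_deriv ?_).congr_of_eventuallyEq ?_ ?_
  · have : (⟪f', f t⟫_ℂ).re = (⟪f t, f'⟫_ℂ).re := inner_re_symm (𝕜 := ℂ) f' (f t)
    simp only [Complex.reCLM_apply, Complex.add_re, this]
    ring
  · refine Filter.Eventually.of_forall fun x => ?_
    simp [inner_self_eq_norm_sq_to_K, ← Complex.ofReal_pow]
  · simp [inner_self_eq_norm_sq_to_K, ← Complex.ofReal_pow]

lemma re_inner_rhs {ν : ℝ} {u : Coeffs} {k : Freq} {z : Vec} (hz : ⟪kvec k, z⟫_ℂ = 0) :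
    (⟪z, rhs ν u k⟫_ℂ).re = -(ν * freqSq k * (⟪z, u k⟫_ℂ).re) - (⟪z, adv u u k⟫_ℂ).re := by
  have h : ((ν * freqSq k : ℝ) • u k) = ((ν * freqSq k : ℝ) : ℂ) • u k := by
    rw [Complex.coe_smul]
  rw [rhs, inner_sub_right, inner_neg_right, h, inner_smul_right, inner_proj hz]
  simp [Complex.mul_re]

lemma freqSq_nonneg (k : Freq) : 0 ≤ freqSq k := by rw [freqSq_eq]; positivity

lemma rhs_real {ν : ℝ} {u : Coeffs} (hu : Solenoidal u) (k : Freq) :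
    rhs ν u k = cj (rhs ν u (-k)) := by
  rw [rhs, rhs, map_sub, map_neg, map_smul, cj_proj, ← adv_real hu, ← hu.real, freqSq_neg]

lemma rhs_zero {ν : ℝ} {u : Coeffs} (hu : Solenoidal u) : rhs ν u 0 = 0 := by
  rw [rhs, hu.zero, adv_zero hu]; simp

lemma inner_kvec_rhs {ν : ℝ} {u : Coeffs} (hu : Solenoidal u) (k : Freq) :
    ⟪kvec k, rhs ν u k⟫_ℂ = 0 := by
  have h : ((ν * freqSq k : ℝ) • u k) = ((ν * freqSq k : ℝ) : ℂ) • u k := by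
    rw [Complex.coe_smul]
  rw [rhs, inner_sub_right, inner_neg_right, h, inner_smul_right, hu.div, inner_kvec_proj]; simp

/-- The equations at the frequencies in `S`, for solenoidal `u`. -/
structure SolvesModes (ν T : ℝ) (S : Finset Freq) (u : ℝ → Coeffs) : Prop where
  sol : ∀ t ∈ Icc 0 T, Solenoidal (u t)
  deriv : ∀ k ∈ S, ∀ t ∈ Icc 0 T,
    HasDerivWithinAt (fun t => u t k) (rhs ν (u t) k) (Icc 0 T) t

/-- The Galerkin approximation with frequencies in `S` and datum `a`. -/
structure IsGalerkin (ν T : ℝ) (S : Finset Freq) (a : Coeffs) (u : ℝ → Coeffs) : Prop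
    extends SolvesModes ν T S u where
  supp : ∀ t ∈ Icc 0 T, ∀ k ∉ S, u t k = 0
  init : ∀ k ∈ S, u 0 k = a k

/-- Extension by zero of amplitudes given at the frequencies in `S`. -/
def extend {S : Finset Freq} (x : S → Vec) : Coeffs := fun k =>
  if h : k ∈ S then x ⟨k, h⟩ else 0

lemma extend_of_mem {S : Finset Freq} (x : S → Vec) (k : S) : extend x k = x k := by
  simp [extend]

lemma extend_of_notMem {S : Finset Freq} (x : S → Vec) {k : Freq} (hk : k ∉ S) :
    extend x k = 0 := by
  simp [extend, hk]

lemma contDiff_extend {S : Finset Freq} (k : Freq) :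
    ContDiff ℝ 1 fun x : S → Vec => extend x k := by
  by_cases hk : k ∈ S
  · simp only [extend, hk, dite_true]; fun_prop
  · simp only [extend, hk, dite_false]; fun_prop

lemma contDiff_rhs_extend (ν : ℝ) {S : Finset Freq} (k : Freq) :
    ContDiff ℝ 1 fun x : S → Vec => rhs ν (extend x) k := by
  have h : ∀ x : S → Vec, rhs ν (extend x) k = -((ν * freqSq k : ℝ) • extend x k) -
      proj k (∑ l ∈ S, (Complex.I * ⟪kvec l, extend x (k - l)⟫_ℂ) • extend x l) := fun x => by
    rw [rhs, adv_eq_sum fun l hl => extend_of_notMem x hl]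
  simp_rw [h]
  have h1 := fun k => contDiff_extend (S := S) k
  refine ((h1 k).const_smul _).neg.sub ?_
  refine ((proj k).restrictScalars ℝ).contDiff.comp (ContDiff.sum fun l _ => ?_)
  have h2 : ContDiff ℝ 1 fun x : S → Vec => ⟪kvec l, extend x (k - l)⟫_ℂ :=
    ((innerSL ℂ (kvec l)).restrictScalars ℝ).contDiff.comp (h1 (k - l))
  have h3 : ContDiff ℝ 1 fun x : S → Vec => Complex.I * ⟪kvec l, extend x (k - l)⟫_ℂ :=
    contDiff_const.mul h2
  exact h3.smul (h1 l)

/-- Amplitudes at the frequencies in `S` of solenoidal fields. -/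
def solenoidalSubmodule (S : Finset Freq) : Submodule ℝ (S → Vec) where
  carrier := {x | Solenoidal (extend x)}
  add_mem' := by
    intro x y hx hy
    have h : ∀ k, extend (x + y) k = extend x k + extend y k := fun k => by
      by_cases hk : k ∈ S <;> simp [extend, hk]
    refine ⟨fun k => ?_, ?_, fun k => ?_⟩
    · rw [h, h, map_add, ← hx.real, ← hy.real]
    · rw [h, hx.zero, hy.zero, add_zero]
    · rw [h, inner_add_right, hx.div, hy.div, add_zero]
  zero_mem' := by
    have h : ∀ k, extend (0 : S → Vec) k = 0 := fun k => by
      by_cases hk : k ∈ S <;> simp [extend, hk]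
    exact ⟨fun k => by rw [h, h, map_zero], h 0, fun k => by rw [h, inner_zero_right]⟩
  smul_mem' := by
    intro c x hx
    have h : ∀ k, extend (c • x) k = c • extend x k := fun k => by
      by_cases hk : k ∈ S <;> simp [extend, hk]
    refine ⟨fun k => ?_, ?_, fun k => ?_⟩
    · rw [h, h, map_smul, ← hx.real]
    · rw [h, hx.zero, smul_zero]
    · rw [h, ← Complex.coe_smul, inner_smul_right, hx.div, mul_zero]

/-- The kinetic energy identity, as an inequality. -/
lemma sum_re_inner_rhs_nonpos {ν : ℝ} (hν : 0 ≤ ν) {u : Coeffs} (hu : Solenoidal u)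
    {S : Finset Freq} (hS : ∀ k ∉ S, u k = 0) : ∑ k ∈ S, (⟪u k, rhs ν u k⟫_ℂ).re ≤ 0 := by
  have h : ∑ k ∈ S, (⟪u k, rhs ν u k⟫_ℂ).re =
      -∑ k ∈ S, ν * freqSq k * ‖u k‖ ^ 2 - ∑ k ∈ S, (⟪u k, adv u u k⟫_ℂ).re := by
    rw [← Finset.sum_neg_distrib, ← Finset.sum_sub_distrib]
    refine Finset.sum_congr rfl fun k _ => ?_
    rw [re_inner_rhs (hu.div k), inner_self_eq_norm_sq_to_K]
    simp [← Complex.ofReal_pow]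
  rw [h, re_inner_adv_self hu hS, sub_zero, neg_nonpos]
  exact Finset.sum_nonneg fun k _ => mul_nonneg (mul_nonneg hν (freqSq_nonneg k)) (sq_nonneg _)

lemma norm_le_sqrt_sum {S : Finset Freq} (x : S → Vec) : ‖x‖ ≤ √(∑ k : S, ‖x k‖ ^ 2) := by
  refine (pi_norm_le_iff_of_nonneg (Real.sqrt_nonneg _)).mpr fun k => ?_
  refine Real.le_sqrt_of_sq_le ?_
  exact Finset.single_le_sum (f := fun k : S => ‖x k‖ ^ 2) (fun _ _ => sq_nonneg _)
    (Finset.mem_univ k)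

/-- Galerkin approximations exist for all times. The vector field is cut off outside a ball, which
makes it bounded and Lipschitz; the solution never leaves the ball because its energy does not
increase. -/
theorem exists_galerkin {ν T : ℝ} (hν : 0 ≤ ν) (hT : 0 ≤ T) {S : Finset Freq}
    (hS : ∀ k ∈ S, -k ∈ S) {a : Coeffs} (ha : Solenoidal a) : ∃ u, IsGalerkin ν T S a u := by
  let x₀ : S → Vec := fun k => a k
  let R : ℝ := √(∑ k : S, ‖x₀ k‖ ^ 2) + 1
  have hR : 0 < R := by positivity
  let φ : ContDiffBump (0 : S → Vec) := ⟨R, R + 1, hR, by linarith⟩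
  let G : (S → Vec) → (S → Vec) := fun x => φ x • fun k : S => rhs ν (extend x) k
  have hGd : ContDiff ℝ 1 G := φ.contDiff.smul (contDiff_pi.mpr fun k => contDiff_rhs_extend ν k)
  have hGc : HasCompactSupport G := φ.hasCompactSupport.smul_right
  obtain ⟨K, hK⟩ := hGd.lipschitzWith_of_hasCompactSupport hGc (by norm_num)
  obtain ⟨L, hL⟩ := hGd.continuous.bounded_above_of_compact_support hGc
  have hL0 : 0 ≤ L := (norm_nonneg _).trans (hL 0)
  let X := solenoidalSubmodule S
  have hx₀ : x₀ ∈ X := by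
    have h : ∀ k, extend x₀ k = if k ∈ S then a k else 0 := fun k => by
      by_cases hk : k ∈ S <;> simp [extend, hk, x₀]
    refine ⟨fun k => ?_, ?_, fun k => ?_⟩
    · by_cases hk : k ∈ S
      · rw [h, h, if_pos hk, if_pos (hS k hk), ← ha.real]
      · have hk' : -k ∉ S := fun hk' => hk (by simpa using hS _ hk')
        rw [h, h, if_neg hk, if_neg hk', map_zero]
    · rw [h, ha.zero]; simp
    · rw [h]
      by_cases hk : k ∈ S
      · rw [if_pos hk, ha.div]
      · rw [if_neg hk, inner_zero_right]
  have hGX : ∀ x ∈ X, G x ∈ X := by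
    intro x hx
    refine X.smul_mem _ ?_
    have h : ∀ k, extend (fun k : S => rhs ν (extend x) k) k =
        if k ∈ S then rhs ν (extend x) k else 0 := fun k => by
      by_cases hk : k ∈ S <;> simp [extend, hk]
    have hx : Solenoidal (extend x) := hx
    refine ⟨fun k => ?_, ?_, fun k => ?_⟩
    · by_cases hk : k ∈ S
      · rw [h, h, if_pos hk, if_pos (hS k hk), ← rhs_real hx]
      · have hk' : -k ∉ S := fun hk' => hk (by simpa using hS _ hk')
        rw [h, h, if_neg hk, if_neg hk', map_zero]
    · rw [h, rhs_zero hx]; simp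
    · rw [h]
      by_cases hk : k ∈ S
      · rw [if_pos hk, inner_kvec_rhs hx]
      · rw [if_neg hk, inner_zero_right]
  have : CompleteSpace X := FiniteDimensional.complete ℝ X
  let f : ℝ → X → X := fun _ x => ⟨G x, hGX x x.2⟩
  have hpl : IsPicardLindelof f (tmin := 0) (tmax := T) ⟨0, left_mem_Icc.mpr hT⟩ ⟨x₀, hx₀⟩
      (L.toNNReal * T.toNNReal) 0 L.toNNReal K := by
    refine ⟨fun t _ => ?_, fun x _ => continuousOn_const, fun t _ x _ => ?_, ?_⟩
    · refine LipschitzWith.lipschitzOnWith ?_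
      exact LipschitzWith.of_dist_le_mul fun x y => hK.dist_le_mul x y
    · rw [Real.coe_toNNReal L hL0]
      exact hL x
    · simp [hT, hL0]
  obtain ⟨α, hα0, hα⟩ := hpl.exists_eq_forall_mem_Icc_hasDerivWithinAt₀
  let β : ℝ → (S → Vec) := fun t => α t
  have hβ0 : β 0 = x₀ := congrArg Subtype.val hα0
  have hβ : ∀ t ∈ Icc 0 T, HasDerivWithinAt β (G (β t)) (Icc 0 T) t := fun t ht =>
    X.subtypeL.hasFDerivAt.comp_hasDerivWithinAt t (hα t ht)
  have hβk : ∀ k : S, ∀ t ∈ Icc 0 T,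
      HasDerivWithinAt (fun t => β t k) (φ (β t) • rhs ν (extend (β t)) k) (Icc 0 T) t :=
    fun k t ht => (hasDerivWithinAt_pi.mp (hβ t ht)) k
  have hsol : ∀ t, Solenoidal (extend (β t)) := fun t => (α t).2
  have hen : ∀ t ∈ Icc 0 T, ∑ k : S, ‖β t k‖ ^ 2 ≤ ∑ k : S, ‖β 0 k‖ ^ 2 := by
    intro t ht
    refine le_of_deriv_nonpos (f := fun t => ∑ k : S, ‖β t k‖ ^ 2)
      (fun t ht => HasDerivWithinAt.fun_sum fun k _ => hasDerivWithinAt_norm_sq (hβk k t ht))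
      (fun t _ => ?_) ht
    have h1 := sum_re_inner_rhs_nonpos hν (hsol t) (S := S)
      (fun k hk => extend_of_notMem (β t) hk)
    rw [← Finset.sum_coe_sort] at h1
    have h2 : ∑ k : S, 2 * (⟪β t k, φ (β t) • rhs ν (extend (β t)) k⟫_ℂ).re =
        2 * φ (β t) * ∑ k : S, (⟪extend (β t) k, rhs ν (extend (β t)) k⟫_ℂ).re := by
      rw [Finset.mul_sum]
      refine Finset.sum_congr rfl fun k _ => ?_
      rw [extend_of_mem, ← Complex.coe_smul, inner_smul_right, Complex.re_ofReal_mul]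
      ring
    rw [h2]
    exact mul_nonpos_of_nonneg_of_nonpos (mul_nonneg zero_le_two φ.nonneg) h1
  have hφ : ∀ t ∈ Icc 0 T, φ (β t) = 1 := by
    intro t ht
    refine φ.one_of_mem_closedBall ?_
    rw [mem_closedBall_zero_iff]
    refine (norm_le_sqrt_sum _).trans ((Real.sqrt_le_sqrt (hen t ht)).trans ?_)
    rw [hβ0]
    change _ ≤ R
    simp only [R]
    linarith
  refine ⟨fun t => extend (β t), ⟨⟨fun t _ => hsol t, fun k hk t ht => ?_⟩,
    fun t _ k hk => extend_of_notMem _ hk, fun k hk => ?_⟩⟩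
  · have h := hβk ⟨k, hk⟩ t ht
    rw [hφ t ht, one_smul] at h
    simpa [extend, hk] using h
  · simp [hβ0, extend, hk, x₀]

/-- The kinetic energy of a Galerkin approximation does not increase. -/
lemma IsGalerkin.sum_norm_sq_le {ν T : ℝ} (hν : 0 ≤ ν) {S : Finset Freq} {a : Coeffs}
    {u : ℝ → Coeffs} (hu : IsGalerkin ν T S a u) {t : ℝ} (ht : t ∈ Icc 0 T) :
    ∑ k ∈ S, ‖u t k‖ ^ 2 ≤ ∑ k ∈ S, ‖a k‖ ^ 2 := by
  have h := le_of_deriv_nonpos (f := fun t => ∑ k ∈ S, ‖u t k‖ ^ 2)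
      (fun t ht => HasDerivWithinAt.fun_sum fun k hk =>
        hasDerivWithinAt_norm_sq (hu.deriv k hk t ht))
      (fun t ht => ?_) ht
  · refine h.trans (Finset.sum_congr rfl fun k hk => ?_).le
    rw [hu.init k hk]
  · rw [← Finset.mul_sum]
    exact mul_nonpos_of_nonneg_of_nonpos zero_le_two
      (sum_re_inner_rhs_nonpos hν (hu.sol t ht) (hu.supp t ht))

/-! ### Sobolev bounds and stability in `L²` -/

/-- The homogeneous `H^r` norm of the sequence is at most `M`. The bound on all finite sums passes
to pointwise limits. -/
def SobolevBound (r M : ℝ) (u : Coeffs) : Prop :=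
  ∀ F : Finset Freq, ∑ k ∈ F, (freqAbs k ^ r * ‖u k‖) ^ 2 ≤ M ^ 2

namespace SobolevBound

variable {r M : ℝ} {u : Coeffs}

lemma le (h : SobolevBound r M u) (hM : 0 ≤ M) (k : Freq) : freqAbs k ^ r * ‖u k‖ ≤ M :=
  le_of_sq_sum_le hM h k

lemma norm_le_mul (hr : 0 ≤ r) (h0 : u 0 = 0) (k : Freq) : ‖u k‖ ≤ freqAbs k ^ r * ‖u k‖ := by
  by_cases hk : k = 0
  · simp [hk, h0]
  · exact le_mul_of_one_le_left (norm_nonneg _) (Real.one_le_rpow (one_le_freqAbs hk) hr)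

lemma sum_norm_sq_le (h : SobolevBound r M u) (hr : 0 ≤ r) (h0 : u 0 = 0) (F : Finset Freq) :
    ∑ k ∈ F, ‖u k‖ ^ 2 ≤ M ^ 2 :=
  (Finset.sum_le_sum fun k _ =>
    pow_le_pow_left₀ (norm_nonneg _) (norm_le_mul hr h0 k) 2).trans (h F)

lemma norm_le (h : SobolevBound r M u) (hM : 0 ≤ M) (hr : 0 ≤ r) (h0 : u 0 = 0) (k : Freq) :
    ‖u k‖ ≤ M :=
  (norm_le_mul hr h0 k).trans (h.le hM k)

lemma gradAbs_le (h : SobolevBound r M u) (hM : 0 ≤ M) (k : Freq) :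
    gradAbs u k ≤ M * freqAbs k ^ (3 / 2 - r) := by
  by_cases hk : k = 0
  · have : gradAbs u k = 0 := by simp [gradAbs, hk]
    rw [this]; exact mul_nonneg hM (Real.rpow_nonneg (freqAbs_nonneg _) _)
  · have h1 := one_le_freqAbs hk
    have e : gradAbs u k = freqAbs k ^ (1 - r) * (freqAbs k ^ r * ‖u k‖) := by
      rw [← mul_assoc, ← Real.rpow_add (by linarith)]
      simp [gradAbs]
    rw [e, mul_comm M]
    exact mul_le_mul (Real.rpow_le_rpow_of_exponent_le h1 (by linarith)) (h.le hM k)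
      (mul_nonneg (Real.rpow_nonneg (freqAbs_nonneg _) _) (norm_nonneg _))
      (Real.rpow_nonneg (freqAbs_nonneg _) _)

lemma norm_sq_le (h : SobolevBound r M u) (hM : 0 ≤ M) (hr : 3 / 2 ≤ r) (h0 : u 0 = 0) (k : Freq) :
    ‖u k‖ ^ 2 ≤ M ^ 2 * freqAbs k ^ (3 / 2 - r) := by
  have h1 : ‖u k‖ ≤ gradAbs u k := by
    by_cases hk : k = 0
    · simp [hk, h0, gradAbs]
    · exact le_mul_of_one_le_left (norm_nonneg _) (one_le_freqAbs hk)
  have h2 := h.norm_le hM (by linarith) h0 k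
  have h3 := h.gradAbs_le hM k
  have := norm_nonneg (u k)
  calc ‖u k‖ ^ 2 = ‖u k‖ * ‖u k‖ := sq _
    _ ≤ M * (M * freqAbs k ^ (3 / 2 - r)) := mul_le_mul h2 (h1.trans h3) this hM
    _ = _ := by ring

lemma summable_gradAbs (h : SobolevBound r M u) (hM : 0 ≤ M) (hr : 9 / 2 < r) :
    Summable (gradAbs u) :=
  Summable.of_nonneg_of_le (gradAbs_nonneg u) (h.gradAbs_le hM) ((summable_lattice hr).mul_left M)

lemma tsum_gradAbs_le (h : SobolevBound r M u) (hM : 0 ≤ M) (hr : 9 / 2 < r) :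
    ∑' k, gradAbs u k ≤ M * latticeSum r := by
  rw [latticeSum, ← tsum_mul_left]
  exact (h.summable_gradAbs hM hr).tsum_le_tsum (h.gradAbs_le hM) ((summable_lattice hr).mul_left M)

end SobolevBound

/-- The part of `latticeSum` outside `S`. -/
def latticeTail (r : ℝ) (S : Finset Freq) : ℝ := ∑' k : {k // k ∉ S}, freqAbs k ^ (3 / 2 - r)

lemma tendsto_latticeTail (r : ℝ) :
    Filter.Tendsto (latticeTail r) Filter.atTop (nhds 0) :=
  tendsto_tsum_compl_atTop_zero fun k : Freq => freqAbs k ^ (3 / 2 - r)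

lemma latticeTail_nonneg (r : ℝ) (S : Finset Freq) : 0 ≤ latticeTail r S :=
  tsum_nonneg fun _ => Real.rpow_nonneg (freqAbs_nonneg _) _

lemma latticeTail_le {r : ℝ} (hr : 9 / 2 < r) (S : Finset Freq) : latticeTail r S ≤ latticeSum r :=
  (summable_lattice hr).tsum_subtype_le (fun k : Freq => freqAbs k ^ (3 / 2 - r)) {k | k ∉ S}
    (fun _ => Real.rpow_nonneg (freqAbs_nonneg _) _)

/-- The part of `u` with frequencies outside `S`. -/
def highPart (S : Finset Freq) (u : Coeffs) : Coeffs := fun k => if k ∈ S then 0 else u k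

lemma tsum_le_latticeTail {r M : ℝ} (hr : 9 / 2 < r) {S : Finset Freq} {f : Freq → ℝ}
    (hf0 : ∀ k, 0 ≤ f k) (hfS : ∀ k ∈ S, f k = 0) (hf : ∀ k, f k ≤ M * freqAbs k ^ (3 / 2 - r)) :
    Summable f ∧ ∑' k, f k ≤ M * latticeTail r S := by
  have hg := (summable_lattice hr).mul_left M
  have hfs : Summable f := Summable.of_nonneg_of_le hf0 hf hg
  refine ⟨hfs, ?_⟩
  have h1 : ∑' k, f k = ∑' k : {k // k ∉ S}, f k := by
    refine (tsum_subtype_eq_of_support_subset (s := {k | k ∉ S}) fun k hk => ?_).symm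
    exact fun hkS => hk (hfS k hkS)
  rw [h1, latticeTail, ← tsum_mul_left]
  exact (hfs.subtype _).tsum_le_tsum (fun k => hf k) (hg.subtype _)

lemma neg_sum_re_inner_adv_le {S : Finset Freq} {z u v : Coeffs} {Y U B : ℝ}
    (hY : 0 ≤ Y) (hU : 0 ≤ U) (hz : ∑ k ∈ S, ‖z k‖ ^ 2 ≤ Y ^ 2)
    (hu : ∀ F : Finset Freq, ∑ k ∈ F, ‖u k‖ ^ 2 ≤ U ^ 2) (hv : Summable (gradAbs v))
    (hB : ∑' k, gradAbs v k ≤ B) : -∑ k ∈ S, (⟪z k, adv u v k⟫_ℂ).re ≤ Y * U * B := by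
  rw [← Finset.sum_neg_distrib]
  have h1 : ∀ k ∈ S, -(⟪z k, adv u v k⟫_ℂ).re ≤ ‖z k‖ * ∑' l, ‖u (k - l)‖ * gradAbs v l := by
    intro k _
    refine (neg_le_abs _).trans ((Complex.abs_re_le_norm _).trans ?_)
    refine (norm_inner_le_norm _ _).trans ?_
    exact mul_le_mul_of_nonneg_left (norm_adv_le (le_of_sq_sum_le hU hu) hv k) (norm_nonneg _)
  refine (Finset.sum_le_sum h1).trans ?_
  refine (young_tsum (b := gradAbs v) hY hU hz (fun k => norm_nonneg (u k)) hu
    (gradAbs_nonneg v) hv).trans ?_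
  exact mul_le_mul_of_nonneg_left hB (mul_nonneg hY hU)

/-- Stability at a fixed time. Only the `L²` norm of `u` enters, since `⟪(u · ∇) z, z⟫ = 0`. -/
lemma sum_re_inner_rhs_sub_le {r M ν : ℝ} (hr : 9 / 2 < r) (hM : 0 ≤ M) (hν : 0 ≤ ν)
    {S : Finset Freq} {u v : Coeffs} (hv : Solenoidal v) (hvM : SobolevBound r M v)
    (hu : Solenoidal u) (huS : ∀ k ∉ S, u k = 0) (huM : ∑ k ∈ S, ‖u k‖ ^ 2 ≤ M ^ 2) :
    ∑ k ∈ S, 2 * (⟪v k - u k, rhs ν v k - rhs ν u k⟫_ℂ).re ≤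
      (2 * M * latticeSum r + M ^ 2 * latticeSum r) * ∑ k ∈ S, ‖v k - u k‖ ^ 2 +
        (M ^ 3 * latticeSum r + M ^ 2) * latticeTail r S := by
  classical
  set y := ∑ k ∈ S, ‖v k - u k‖ ^ 2 with hy
  set K := latticeSum r with hK
  set δ := latticeTail r S with hδ
  have hK0 : 0 ≤ K := latticeSum_nonneg r
  have hδ0 : 0 ≤ δ := latticeTail_nonneg r S
  have hδK : δ ≤ K := latticeTail_le hr S
  have hy0 : 0 ≤ y := Finset.sum_nonneg fun _ _ => sq_nonneg _
  let q : Coeffs := highPart S v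
  let z : Coeffs := fun k => if k ∈ S then v k - u k else 0
  have hzS : ∀ k ∈ S, z k = v k - u k := fun k hk => by simp [z, hk]
  have hzS' : ∀ k ∉ S, z k = 0 := fun k hk => by simp [z, hk]
  have hqS : ∀ k ∈ S, q k = 0 := fun k hk => by simp [q, highPart, hk]
  have hqS' : ∀ k ∉ S, q k = v k := fun k hk => by simp [q, highPart, hk]
  have hvzq : v - u = z + q := by
    funext k
    by_cases hk : k ∈ S
    · simp [hzS k hk, hqS k hk]
    · simp [hzS' k hk, hqS' k hk, huS k hk]
  have huF : ∀ F : Finset Freq, ∑ k ∈ F, ‖u k‖ ^ 2 ≤ M ^ 2 := fun F =>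
    (sum_le_sum_of_eq_zero (fun k => sq_nonneg ‖u k‖) (fun k hk => by simp [huS k hk]) F).trans huM
  have hzy : ∑ k ∈ S, ‖z k‖ ^ 2 = y := Finset.sum_congr rfl fun k hk => by rw [hzS k hk]
  have hzF : ∀ F : Finset Freq, ∑ k ∈ F, ‖z k‖ ^ 2 ≤ y := fun F =>
    (sum_le_sum_of_eq_zero (fun k => sq_nonneg ‖z k‖) (fun k hk => by simp [hzS' k hk]) F).trans
      hzy.le
  have hq2 : Summable (fun k => ‖q k‖ ^ 2) ∧ ∑' k, ‖q k‖ ^ 2 ≤ M ^ 2 * δ :=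
    tsum_le_latticeTail hr (fun k => sq_nonneg _) (fun k hk => by simp [hqS k hk]) fun k => by
      by_cases hk : k ∈ S
      · rw [hqS k hk]
        simpa using mul_nonneg (sq_nonneg M) (Real.rpow_nonneg (freqAbs_nonneg k) _)
      · rw [hqS' k hk]
        exact hvM.norm_sq_le hM (by linarith) hv.zero k
  have hq1 : Summable (gradAbs q) ∧ ∑' k, gradAbs q k ≤ M * δ :=
    tsum_le_latticeTail hr (gradAbs_nonneg q) (fun k hk => by simp [gradAbs, hqS k hk]) fun k => by
      by_cases hk : k ∈ S
      · have : gradAbs q k = 0 := by simp [gradAbs, hqS k hk]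
        rw [this]
        exact mul_nonneg hM (Real.rpow_nonneg (freqAbs_nonneg k) _)
      · have : gradAbs q k = gradAbs v k := by simp [gradAbs, hqS' k hk]
        rw [this]
        exact hvM.gradAbs_le hM k
  have hz1 : Summable (gradAbs z) :=
    summable_of_ne_finset_zero (s := S) fun k hk => by simp [gradAbs, hzS' k hk]
  have hu1 : Summable (gradAbs u) :=
    summable_of_ne_finset_zero (s := S) fun k hk => by simp [gradAbs, huS k hk]
  have hv1 := hvM.summable_gradAbs hM hr
  have hDF : ∀ F : Finset Freq, ∑ k ∈ F, ‖(v - u) k‖ ^ 2 ≤ √(y + M ^ 2 * δ) ^ 2 := by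
    intro F
    rw [Real.sq_sqrt (by positivity)]
    have h1 : ∀ k ∈ F, ‖(v - u) k‖ ^ 2 = ‖z k‖ ^ 2 + ‖q k‖ ^ 2 := fun k _ => by
      rw [hvzq, Pi.add_apply]
      by_cases hk : k ∈ S
      · simp [hqS k hk]
      · simp [hzS' k hk]
    rw [Finset.sum_congr rfl h1, Finset.sum_add_distrib]
    exact add_le_add (hzF F) ((hq2.1.sum_le_tsum F fun _ _ => sq_nonneg _).trans hq2.2)
  have hub : ∀ k, ‖u k‖ ≤ M := le_of_sq_sum_le hM huF
  have hvb : ∀ k, ‖v k‖ ≤ M := hvM.norm_le hM (by linarith) hv.zero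
  have hsplit : ∀ k, adv v v k - adv u u k = adv (v - u) v k + adv u z k + adv u q k := by
    intro k
    have e1 := adv_sub_left hvb hub hv1 k
    have e2 : adv u v k = adv u u k + adv u (z + q) k := by
      have hzq : Summable (gradAbs (z + q)) := by
        rw [← hvzq]
        refine Summable.of_nonneg_of_le (gradAbs_nonneg _) (fun k => ?_) (hv1.add hu1)
        simp only [gradAbs, Pi.sub_apply, ← mul_add]
        exact mul_le_mul_of_nonneg_left (norm_sub_le _ _) (freqAbs_nonneg k)
      rw [← adv_add_right hub hu1 hzq, ← hvzq, add_sub_cancel]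
    have e3 := adv_add_right hub hz1 hq1.1 k
    rw [e1, e2, e3]; abel
  have hterm : ∀ k ∈ S, (⟪v k - u k, rhs ν v k - rhs ν u k⟫_ℂ).re ≤
      -(⟪z k, adv (v - u) v k⟫_ℂ).re - (⟪z k, adv u z k⟫_ℂ).re - (⟪z k, adv u q k⟫_ℂ).re := by
    intro k hk
    have hd : ⟪kvec k, v k - u k⟫_ℂ = 0 := by rw [inner_sub_right, hv.div, hu.div, sub_zero]
    rw [hzS k hk]
    have h1 : (⟪v k - u k, adv v v k⟫_ℂ).re - (⟪v k - u k, adv u u k⟫_ℂ).re =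
        (⟪v k - u k, adv (v - u) v k⟫_ℂ).re + (⟪v k - u k, adv u z k⟫_ℂ).re +
          (⟪v k - u k, adv u q k⟫_ℂ).re := by
      rw [← Complex.sub_re, ← inner_sub_right, hsplit, inner_add_right, inner_add_right,
        Complex.add_re, Complex.add_re]
    have h2 : 0 ≤ ν * freqSq k * ((⟪v k - u k, v k⟫_ℂ).re - (⟪v k - u k, u k⟫_ℂ).re) := by
      rw [← Complex.sub_re, ← inner_sub_right]
      exact mul_nonneg (mul_nonneg hν (freqSq_nonneg k)) (inner_self_nonneg (𝕜 := ℂ) (x := v k - u k))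
    rw [inner_sub_right, Complex.sub_re, re_inner_rhs hd, re_inner_rhs hd]
    linarith
  have hY2 : √y ^ 2 = y := Real.sq_sqrt hy0
  have b1 := neg_sum_re_inner_adv_le (S := S) (z := z) (Real.sqrt_nonneg y) (Real.sqrt_nonneg _)
    (by rw [hzy, hY2]) hDF hv1 (hvM.tsum_gradAbs_le hM hr)
  have b2 := neg_sum_re_inner_adv_le (S := S) (z := z) (Real.sqrt_nonneg y) hM
    (by rw [hzy, hY2]) huF hq1.1 hq1.2
  have b3 := re_inner_adv_self hu hzS'
  have hsum := Finset.sum_le_sum hterm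
  rw [Finset.sum_sub_distrib, Finset.sum_sub_distrib, Finset.sum_neg_distrib, b3] at hsum
  rw [← Finset.mul_sum]
  have hD2 : √(y + M ^ 2 * δ) ^ 2 = y + M ^ 2 * δ := Real.sq_sqrt (by positivity)
  generalize √(y + M ^ 2 * δ) = D at *
  generalize √y = Y at *
  have c1 : Y * D * (M * K) ≤ (y + M ^ 2 * δ / 2) * (M * K) := by
    refine mul_le_mul_of_nonneg_right ?_ (mul_nonneg hM hK0)
    nlinarith [sq_nonneg (Y - D)]
  have c2 : Y * M * (M * δ) ≤ M ^ 2 * (δ / 2 + K * y / 2) := by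
    have : Y * δ ≤ δ / 2 + K * y / 2 := by
      have e1 : Y ≤ 1 / 2 + y / 2 := by nlinarith [sq_nonneg (Y - 1)]
      have e2 : δ * y ≤ K * y := mul_le_mul_of_nonneg_right hδK hy0
      nlinarith
    calc Y * M * (M * δ) = M ^ 2 * (Y * δ) := by ring
      _ ≤ _ := mul_le_mul_of_nonneg_left this (sq_nonneg M)
  rw [← hK] at b1
  linarith

/-- Grönwall's inequality with vanishing initial value. -/
lemma le_of_deriv_le_linear {f f' : ℝ → ℝ} {T A ε : ℝ} (hA : 1 ≤ A) (hε : 0 ≤ ε)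
    (hf : ∀ t ∈ Icc 0 T, HasDerivWithinAt f (f' t) (Icc 0 T) t) (h0 : f 0 ≤ 0)
    (hle : ∀ t ∈ Icc 0 T, f' t ≤ A * f t + ε) {t : ℝ} (ht : t ∈ Icc 0 T) :
    f t ≤ ε * Real.exp (A * T) := by
  have h := le_gronwallBound_of_liminf_deriv_right_le (f := f) (f' := f') (δ := 0) (K := A)
    (ε := ε) (fun t ht => (hf t ht).continuousWithinAt)
    (fun t ht r hr => by
      have := (HasDerivWithinAt.right_of_Icc (hf t (Ico_subset_Icc_self ht)) ht
        ).liminf_right_slope_le hr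
      simpa only [slope_def_field, div_eq_inv_mul] using this) h0
    (fun t ht => hle t (Ico_subset_Icc_self ht)) t ht
  refine h.trans ?_
  have hA0 : A ≠ 0 := by positivity
  rw [gronwallBound_of_K_ne_0 hA0]
  simp only [zero_mul, zero_add, sub_zero]
  have h1 : ε / A ≤ ε := div_le_self hε hA
  have h2 : Real.exp (A * t) - 1 ≤ Real.exp (A * T) := by
    have : Real.exp (A * t) ≤ Real.exp (A * T) := by
      apply Real.exp_le_exp.mpr
      exact mul_le_mul_of_nonneg_left ht.2 (by linarith)
    linarith
  have h3 : 0 ≤ Real.exp (A * T) := (Real.exp_pos _).le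
  calc ε / A * (Real.exp (A * t) - 1) ≤ ε / A * Real.exp (A * T) := by gcongr
    _ ≤ _ := by gcongr

/-- The constant of the stability estimate. -/
def stabConst (r M T : ℝ) : ℝ :=
  (M ^ 3 * latticeSum r + M ^ 2) *
    Real.exp ((2 * M * latticeSum r + M ^ 2 * latticeSum r + 1) * T)

/-- Galerkin approximations converge in `L²`, uniformly in time, to any solution that is bounded in
`H^r`. No bound on the approximations is needed. -/
theorem sum_norm_sub_sq_le {r M ν T : ℝ} (hr : 9 / 2 < r) (hM : 0 ≤ M) (hν : 0 ≤ ν)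
    {S : Finset Freq} {u v : ℝ → Coeffs} (hv : SolvesModes ν T S v)
    (hvM : ∀ t ∈ Icc 0 T, SobolevBound r M (v t)) (hu : IsGalerkin ν T S (v 0) u)
    {t : ℝ} (ht : t ∈ Icc 0 T) :
    ∑ k ∈ S, ‖v t k - u t k‖ ^ 2 ≤ stabConst r M T * latticeTail r S := by
  have hT0 : (0 : ℝ) ∈ Icc 0 T := ⟨le_rfl, ht.1.trans ht.2⟩
  have hK := latticeSum_nonneg r
  have hδ := latticeTail_nonneg r S
  have h := le_of_deriv_le_linear (f := fun t => ∑ k ∈ S, ‖v t k - u t k‖ ^ 2)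
    (f' := fun t => ∑ k ∈ S, 2 * (⟪v t k - u t k, rhs ν (v t) k - rhs ν (u t) k⟫_ℂ).re)
    (A := 2 * M * latticeSum r + M ^ 2 * latticeSum r + 1)
    (ε := (M ^ 3 * latticeSum r + M ^ 2) * latticeTail r S) (by
      have : 0 ≤ 2 * M * latticeSum r + M ^ 2 * latticeSum r := by positivity
      linarith) (by positivity)
    (fun t ht => HasDerivWithinAt.fun_sum fun k hk =>
      hasDerivWithinAt_norm_sq ((hv.deriv k hk t ht).sub (hu.deriv k hk t ht)))
    (Finset.sum_nonpos fun k hk => by simp [hu.init k hk]) (fun t ht => ?_) ht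
  · refine h.trans (le_of_eq ?_)
    unfold stabConst; ring
  · have huM : ∑ k ∈ S, ‖u t k‖ ^ 2 ≤ M ^ 2 := (hu.sum_norm_sq_le hν ht).trans
      ((hvM 0 hT0).sum_norm_sq_le (by linarith) (hv.sol 0 hT0).zero S)
    have h1 := sum_re_inner_rhs_sub_le hr hM hν (hv.sol t ht) (hvM t ht) (hu.sol t ht)
      (hu.supp t ht) huM
    have h2 : 0 ≤ ∑ k ∈ S, ‖v t k - u t k‖ ^ 2 := Finset.sum_nonneg fun _ _ => sq_nonneg _
    refine h1.trans ?_
    linarith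

/-! ### A priori bounds for Galerkin approximations -/

lemma fweight_sq (r p τ : ℝ) (k : Freq) :
    fweight r p τ k ^ 2 = (freqAbs k ^ r) ^ 2 * Real.exp (2 * τ * freqAbs k ^ p) := by
  rw [fweight, weight, mul_pow, ← Real.exp_nat_mul]
  congr 2; push_cast; ring

/-- The energy balance of a Galerkin approximation in a weighted norm whose radius `τ` varies. -/
lemma hasDerivWithinAt_wEnergy {r p ν T t τ' : ℝ} {τ : ℝ → ℝ} {S : Finset Freq} {a : Coeffs}
    {u : ℝ → Coeffs} (hu : IsGalerkin ν T S a u) (ht : t ∈ Icc 0 T)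
    (hτ : HasDerivWithinAt τ τ' (Icc 0 T) t) :
    HasDerivWithinAt (fun t => wEnergy r p (τ t) S (u t))
      (2 * τ' * wDissip r p (τ t) S (u t) +
        2 * ∑ k ∈ S, fweight r p (τ t) k ^ 2 * (⟪u t k, rhs ν (u t) k⟫_ℂ).re) (Icc 0 T) t := by
  unfold wEnergy wDissip
  rw [Finset.mul_sum, Finset.mul_sum, ← Finset.sum_add_distrib]
  refine HasDerivWithinAt.fun_sum fun k hk => ?_
  have h1 : HasDerivWithinAt (fun t => fweight r p (τ t) k ^ 2)
      (2 * τ' * freqAbs k ^ p * fweight r p (τ t) k ^ 2) (Icc 0 T) t := by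
    simp_rw [fweight_sq]
    refine ((((hτ.const_mul 2).mul_const (freqAbs k ^ p)).exp).const_mul
      ((freqAbs k ^ r) ^ 2)).congr_deriv ?_
    ring
  refine (h1.mul (hasDerivWithinAt_norm_sq (hu.deriv k hk t ht))).congr_deriv ?_
  ring

lemma sum_weight_inner_rhs_le {r p τ ν : ℝ} (hr : 9 / 2 < r) (hp : 0 ≤ p) (hp1 : p ≤ 1)
    (hτ : 0 ≤ τ) (hν : 0 ≤ ν) {u : Coeffs} (hu : Solenoidal u) {S : Finset Freq}
    (hS : ∀ l ∉ S, u l = 0) :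
    ∑ k ∈ S, fweight r p τ k ^ 2 * (⟪u k, rhs ν u k⟫_ℂ).re ≤
      2 * commConst r * gradSum S u * wEnergy r p τ S u +
      4 * (commConst r + 1) * latticeSum r * τ * √(wEnergy r p τ S u) * wDissip r p τ S u := by
  refine le_trans ?_ (trilinear_le hr hp hp1 hτ hu hS)
  rw [← Finset.sum_neg_distrib]
  refine Finset.sum_le_sum fun k _ => ?_
  rw [re_inner_rhs (hu.div k)]
  have h1 : 0 ≤ fweight r p τ k ^ 2 * (ν * freqSq k * (⟪u k, u k⟫_ℂ).re) :=
    mul_nonneg (sq_nonneg _) (mul_nonneg (mul_nonneg hν (freqSq_nonneg k))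
      (inner_self_nonneg (𝕜 := ℂ) (x := u k)))
  linarith

/-- The Gevrey norm dominates the Sobolev norm. -/
lemma sobolevBound_of_wEnergy {r p τ M : ℝ} (hτ : 0 ≤ τ) {u : Coeffs} {S : Finset Freq}
    (hS : ∀ l ∉ S, u l = 0) (h : wEnergy r p τ S u ≤ M ^ 2) : SobolevBound r M u := by
  intro F
  refine (sum_le_sum_of_eq_zero (fun k => sq_nonneg _) (fun k hk => by simp [hS k hk]) F).trans
    (le_trans (Finset.sum_le_sum fun k _ => ?_) h)
  rw [mul_pow, fweight_sq]
  refine mul_le_mul_of_nonneg_right ?_ (sq_nonneg _)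
  refine le_mul_of_one_le_right (sq_nonneg _) (Real.one_le_exp ?_)
  have := Real.rpow_nonneg (freqAbs_nonneg k) p
  positivity

lemma gradSum_le_tsum {r M : ℝ} (hr : 9 / 2 < r) (hM : 0 ≤ M) {u : Coeffs}
    (h : SobolevBound r M u) (S : Finset Freq) : gradSum S u ≤ M * latticeSum r :=
  ((h.summable_gradAbs hM hr).sum_le_tsum S fun k _ => gradAbs_nonneg u k).trans
    (h.tsum_gradAbs_le hM hr)

/-- The constant in the lower bound for the existence time. The factor `11` makes the slope of the
energy, at most `32 commConst latticeSum y³` while the norm is below `2 y`, less than `3 y² / T`. -/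
def lifespanConst (r : ℝ) : ℝ := 11 * commConst r * latticeSum r + 1

lemma lifespanConst_pos {r : ℝ} (hr : 0 ≤ r) : 0 < lifespanConst r := by
  have := commConst_nonneg hr
  have := latticeSum_nonneg r
  unfold lifespanConst; positivity

/-- Up to a time of order `1 / ‖a‖_{H^r}`, the `H^r` norm of a Galerkin approximation at most
doubles, whatever the viscosity. -/
theorem IsGalerkin.sobolevBound {r ν T y : ℝ} (hr : 9 / 2 < r) (hν : 0 ≤ ν) (hT : 0 < T)
    (hy : 0 < y) (hTy : lifespanConst r * T * y ≤ 1) {S : Finset Freq} {a : Coeffs}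
    (ha : SobolevBound r y a) {u : ℝ → Coeffs} (hu : IsGalerkin ν T S a u) {t : ℝ}
    (ht : t ∈ Icc 0 T) : SobolevBound r (2 * y) (u t) := by
  have hc := commConst_nonneg (r := r) (by linarith)
  have hK := latticeSum_nonneg r
  have key : wEnergy r 0 0 S (u t) ≤ y ^ 2 + 3 * y ^ 2 / T * t := by
    refine le_of_deriv_lt_barrier (f := fun t => wEnergy r 0 0 S (u t))
      (B := fun t => y ^ 2 + 3 * y ^ 2 / T * t) (B' := fun _ => 3 * y ^ 2 / T)
      (fun t ht => hasDerivWithinAt_wEnergy hu ht (hasDerivWithinAt_const t _ (0 : ℝ))) ?_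
      (fun t => by simpa using ((hasDerivAt_id t).const_mul (3 * y ^ 2 / T)).const_add (y ^ 2))
      (fun t ht hE => ?_) ht
    · have h0 : wEnergy r 0 0 S (u 0) = ∑ k ∈ S, (freqAbs k ^ r * ‖a k‖) ^ 2 :=
        Finset.sum_congr rfl fun k hk => by rw [fweight_sq, hu.init k hk]; simp [mul_pow]
      simp only [mul_zero, add_zero]
      rw [h0]
      exact ha S
    · have hE4 : wEnergy r 0 0 S (u t) ≤ (2 * y) ^ 2 := by
        have : t / T ≤ 1 := (div_le_one hT).mpr ht.2
        rw [hE]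
        have e : 3 * y ^ 2 / T * t = 3 * y ^ 2 * (t / T) := by ring
        rw [e]
        nlinarith [sq_nonneg y]
      have hsb := sobolevBound_of_wEnergy le_rfl (hu.supp t ht) hE4
      have hg := gradSum_le_tsum hr (by positivity) hsb S
      have h1 := sum_weight_inner_rhs_le (p := 0) hr le_rfl zero_le_one le_rfl hν (hu.sol t ht)
        (hu.supp t ht)
      have h2 : 2 * commConst r * gradSum S (u t) * wEnergy r 0 0 S (u t) ≤
          2 * commConst r * (2 * y * latticeSum r) * (2 * y) ^ 2 := by
        have := wEnergy_nonneg r 0 0 S (u t)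
        gcongr
      have h3 : 2 * (2 * commConst r * (2 * y * latticeSum r) * (2 * y) ^ 2) < 3 * y ^ 2 / T := by
        rw [lt_div_iff₀ hT]
        have h4 : 11 * (commConst r * latticeSum r * T * y) < 1 := by
          have : 0 < T * y := by positivity
          unfold lifespanConst at hTy
          linarith
        have e : 2 * (2 * commConst r * (2 * y * latticeSum r) * (2 * y) ^ 2) * T =
          32 * (commConst r * latticeSum r * T * y) * y ^ 2 := by ring
        rw [e]
        have : 0 < y ^ 2 := by positivity
        nlinarith
      simp only [mul_zero, zero_mul, add_zero, zero_add] at h1 ⊢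
      linarith
  refine sobolevBound_of_wEnergy (p := 0) le_rfl (hu.supp t ht) (key.trans ?_)
  have : t / T ≤ 1 := (div_le_one hT).mpr ht.2
  have e : 3 * y ^ 2 / T * t = 3 * y ^ 2 * (t / T) := by ring
  rw [e]
  nlinarith [sq_nonneg y]

/-! ### The analyticity radius -/

lemma gevreyRadius_denom_pos {τ₀ C₁ C₂ t : ℝ} (hτ₀ : 0 < τ₀) (hC₁ : 0 < C₁) (hC₂ : 0 < C₂)
    (ht : 0 ≤ t) :
    0 < Real.exp (C₁ * t) * (1 / τ₀) + C₂ / C₁ * (Real.exp (C₁ * t) - 1) := by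
  have h1 : 1 ≤ Real.exp (C₁ * t) := Real.one_le_exp (by positivity)
  have h2 : 0 ≤ Real.exp (C₁ * t) - 1 := by linarith
  positivity

lemma gevreyRadius_pos {τ₀ C₁ C₂ t : ℝ} (hτ₀ : 0 < τ₀) (hC₁ : 0 < C₁) (hC₂ : 0 < C₂)
    (ht : 0 ≤ t) : 0 < gevreyRadius τ₀ C₁ C₂ t :=
  one_div_pos.mpr (gevreyRadius_denom_pos hτ₀ hC₁ hC₂ ht)

lemma gevreyRadius_zero (τ₀ C₁ C₂ : ℝ) : gevreyRadius τ₀ C₁ C₂ 0 = τ₀ := by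
  simp [gevreyRadius]

/-- The radius solves `τ' = -C₁ τ - C₂ τ²`. -/
lemma hasDerivAt_gevreyRadius {τ₀ C₁ C₂ t : ℝ} (hτ₀ : 0 < τ₀) (hC₁ : 0 < C₁) (hC₂ : 0 < C₂)
    (ht : 0 ≤ t) : HasDerivAt (gevreyRadius τ₀ C₁ C₂)
      (-C₁ * gevreyRadius τ₀ C₁ C₂ t - C₂ * gevreyRadius τ₀ C₁ C₂ t ^ 2) t := by
  have hD := gevreyRadius_denom_pos hτ₀ hC₁ hC₂ ht
  have hexp : HasDerivAt (fun t => Real.exp (C₁ * t)) (Real.exp (C₁ * t) * C₁) t := by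
    simpa using ((hasDerivAt_id t).const_mul C₁).exp
  have h := ((hexp.mul_const (1 / τ₀)).add ((hexp.sub_const 1).const_mul (C₂ / C₁))).inv hD.ne'
  refine (h.congr_of_eventuallyEq (Filter.Eventually.of_forall fun x => ?_)).congr_deriv ?_
  · simp [gevreyRadius]
  · unfold gevreyRadius
    simp only [Pi.add_apply]
    have e : Real.exp (C₁ * t) * C₁ * (1 / τ₀) + C₂ / C₁ * (Real.exp (C₁ * t) * C₁) =
        C₁ * (Real.exp (C₁ * t) * (1 / τ₀) + C₂ / C₁ * (Real.exp (C₁ * t) - 1)) + C₂ := by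
      field_simp
      ring
    rw [e]
    generalize Real.exp (C₁ * t) * (1 / τ₀) + C₂ / C₁ * (Real.exp (C₁ * t) - 1) = D at *
    field_simp
    ring

/-! ### Propagation of Gevrey regularity -/

/-- Once the low modes of `u` are close to those of `v`, the `ℓ¹` norm of `∇ u` is controlled by
the `H^r` norm of `v`, up to an error `1`. -/
lemma gradSum_le_of_close {r M G d : ℝ} (hr : 9 / 2 < r) (hM : 0 ≤ M) (hG : 0 ≤ G)
    {S R : Finset Freq} (hRS : R ⊆ S) {u v : Coeffs} (hv : SobolevBound r M v)
    (hu : SobolevBound r G u) (hd : ∀ k ∈ S, ‖v k - u k‖ ≤ d)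
    (h1 : G * latticeTail r R ≤ 1 / 2) (h2 : (∑ k ∈ R, freqAbs k) * d ≤ 1 / 2) :
    gradSum S u ≤ M * latticeSum r + 1 := by
  classical
  have e1 : gradSum S u = ∑ k ∈ R, gradAbs u k + ∑ k ∈ S \ R, gradAbs u k := by
    rw [gradSum, add_comm, Finset.sum_sdiff hRS]
  have e2 : ∑ k ∈ R, gradAbs u k ≤ M * latticeSum r + 1 / 2 := by
    calc ∑ k ∈ R, gradAbs u k ≤ ∑ k ∈ R, (gradAbs v k + freqAbs k * d) := by
          refine Finset.sum_le_sum fun k hk => ?_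
          unfold gradAbs
          rw [← mul_add]
          refine mul_le_mul_of_nonneg_left ?_ (freqAbs_nonneg k)
          have := norm_sub_norm_le (u k) (v k)
          rw [norm_sub_rev] at this
          linarith [hd k (hRS hk)]
      _ = gradSum R v + (∑ k ∈ R, freqAbs k) * d := by
          rw [Finset.sum_add_distrib, Finset.sum_mul, gradSum]
      _ ≤ _ := add_le_add (gradSum_le_tsum hr hM hv R) h2
  have e3 : ∑ k ∈ S \ R, gradAbs u k ≤ 1 / 2 := by
    refine le_trans ?_ h1
    have h := tsum_le_latticeTail (M := G) hr (S := R) (f := fun k => if k ∈ R then 0 else gradAbs u k)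
      (fun k => by
        by_cases hk : k ∈ R
        · simp [hk]
        · simpa [hk] using gradAbs_nonneg u k)
      (fun k hk => by simp [hk])
      (fun k => by
        by_cases hk : k ∈ R
        · simpa [hk] using mul_nonneg hG (Real.rpow_nonneg (freqAbs_nonneg k) _)
        · simpa [hk] using hu.gradAbs_le hG k)
    refine le_trans (le_of_eq ?_) ((h.1.sum_le_tsum (S \ R) fun k _ => ?_).trans h.2)
    · refine Finset.sum_congr rfl fun k hk => ?_
      rw [if_neg (Finset.mem_sdiff.mp hk).2]
    · by_cases hk : k ∈ R
      · simp [hk]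
      · simpa [hk] using gradAbs_nonneg u k
  linarith

/-- The growth rate of the Gevrey norm along a solution bounded by `M` in `H^r`. -/
def gevreyRate (r M : ℝ) : ℝ := 4 * commConst r * (M * latticeSum r + 1) + 1

/-- The bound for the squared Gevrey norm on `[0, T]`, for data of squared norm at most `A`. -/
def gevreyBound (r M T A : ℝ) : ℝ := (A + 1) * Real.exp (gevreyRate r M * T)

/-- The decay rate of the radius that absorbs the loss of half a Gevrey derivative. -/
def radiusRate (r M T A : ℝ) : ℝ :=
  4 * (commConst r + 1) * latticeSum r * √(gevreyBound r M T A) + 1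

lemma radiusRate_pos {r : ℝ} (hr : 0 ≤ r) (M T A : ℝ) : 0 < radiusRate r M T A := by
  have := commConst_nonneg hr
  have := latticeSum_nonneg r
  unfold radiusRate; positivity

/-- Gevrey bound for Galerkin approximations at a sufficiently high level. The barrier
`(A + 1) e^{αt}` can only be reached at a time when the approximation is bounded in `H^r`, hence
close to `v` in the Lipschitz norm; at such a time the Gevrey norm grows more slowly than the
barrier. -/
theorem wEnergy_le_gevreyBound {r p M T A ν τ₀ C₂ : ℝ} (hr : 9 / 2 < r) (hp : 0 ≤ p) (hp1 : p ≤ 1)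
    (hM : 0 ≤ M) (hA : 0 ≤ A) (hν : 0 ≤ ν) (hτ₀ : 0 < τ₀) (hC₂ : 0 < C₂)
    {v : ℝ → Coeffs} (hv : ∀ S, SolvesModes ν T S v)
    (hvM : ∀ t ∈ Icc 0 T, SobolevBound r M (v t)) (hA0 : ∀ F, wEnergy r p τ₀ F (v 0) ≤ A) :
    ∀ᶠ S in Filter.atTop, ∀ u, IsGalerkin ν T S (v 0) u → ∀ t ∈ Icc 0 T,
      wEnergy r p (gevreyRadius τ₀ (radiusRate r M T A) C₂ t) S (u t) ≤ gevreyBound r M T A := by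
  have hc := commConst_nonneg (r := r) (by linarith)
  have hK := latticeSum_nonneg r
  have hC₁ := radiusRate_pos (r := r) (by linarith) M T A
  set α := gevreyRate r M with hα
  have hα0 : 0 < α := by rw [hα]; unfold gevreyRate; positivity
  set G := √(gevreyBound r M T A) with hG
  have hGB : 0 ≤ gevreyBound r M T A := by unfold gevreyBound; positivity
  have hG0 : 0 ≤ G := Real.sqrt_nonneg _
  have hG2 : G ^ 2 = gevreyBound r M T A := Real.sq_sqrt hGB
  obtain ⟨R, hR⟩ : ∃ R : Finset Freq, G * latticeTail r R ≤ 1 / 2 := by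
    have h := (tendsto_latticeTail r).const_mul G
    rw [mul_zero] at h
    exact (h.eventually_le_const (by norm_num : (0 : ℝ) < 1 / 2)).exists
  have hclose : ∀ᶠ S in Filter.atTop,
      (∑ k ∈ R, freqAbs k) * √(stabConst r M T * latticeTail r S) ≤ 1 / 2 := by
    have h := ((tendsto_latticeTail r).const_mul (stabConst r M T)).sqrt.const_mul
      (∑ k ∈ R, freqAbs k)
    rw [mul_zero, Real.sqrt_zero, mul_zero] at h
    exact h.eventually_le_const (by norm_num : (0 : ℝ) < 1 / 2)
  filter_upwards [hclose, Filter.eventually_ge_atTop R] with S hS hRS u hu t ht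
  set τ := gevreyRadius τ₀ (radiusRate r M T A) C₂ with hτ
  have hBT : ∀ t ∈ Icc 0 T, (A + 1) * Real.exp (α * t) ≤ gevreyBound r M T A := fun t ht => by
    unfold gevreyBound
    have := ht.2
    gcongr
  refine le_trans ?_ (hBT t ht)
  refine le_of_deriv_lt_barrier (f := fun t => wEnergy r p (τ t) S (u t))
    (B := fun t => (A + 1) * Real.exp (α * t)) (B' := fun t => (A + 1) * (Real.exp (α * t) * α))
    (fun t ht => hasDerivWithinAt_wEnergy hu ht
      (hasDerivAt_gevreyRadius hτ₀ hC₁ hC₂ ht.1).hasDerivWithinAt) ?_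
    (fun t => by simpa using (((hasDerivAt_id t).const_mul α).exp).const_mul (A + 1))
    (fun t ht hE => ?_) ht
  · have h0 : wEnergy r p (τ 0) S (u 0) = wEnergy r p τ₀ S (v 0) := by
      rw [hτ, gevreyRadius_zero]
      exact Finset.sum_congr rfl fun k hk => by rw [hu.init k hk]
    simp only [mul_zero, Real.exp_zero, mul_one]
    rw [h0]
    linarith [hA0 S]
  · have hτt : 0 < τ t := gevreyRadius_pos hτ₀ hC₁ hC₂ ht.1
    have hEG : wEnergy r p (τ t) S (u t) ≤ G ^ 2 := by rw [hG2, hE]; exact hBT t ht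
    have hsE : √(wEnergy r p (τ t) S (u t)) ≤ G := Real.sqrt_le_iff.mpr ⟨hG0, hEG⟩
    have hsb := sobolevBound_of_wEnergy hτt.le (hu.supp t ht) hEG
    have hd : ∀ k ∈ S, ‖v t k - u t k‖ ≤ √(stabConst r M T * latticeTail r S) := fun k hk => by
      refine Real.le_sqrt_of_sq_le (le_trans ?_ (sum_norm_sub_sq_le hr hM hν (hv S) hvM hu ht))
      exact Finset.single_le_sum (f := fun k => ‖v t k - u t k‖ ^ 2) (fun _ _ => sq_nonneg _) hk
    have hg := gradSum_le_of_close hr hM hG0 hRS (hvM t ht) hsb hd hR hS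
    have h1 := sum_weight_inner_rhs_le hr hp hp1 hτt.le hν (hu.sol t ht) (hu.supp t ht)
    have hE0 := wEnergy_nonneg r p (τ t) S (u t)
    have hD0 := wDissip_nonneg r p (τ t) S (u t)
    have hEpos : 0 < wEnergy r p (τ t) S (u t) := by rw [hE]; positivity
    have hBα : (A + 1) * (Real.exp (α * t) * α) = α * wEnergy r p (τ t) S (u t) := by
      rw [hE]; ring
    rw [hBα]
    have h2 : 2 * commConst r * gradSum S (u t) * wEnergy r p (τ t) S (u t) ≤
        2 * commConst r * (M * latticeSum r + 1) * wEnergy r p (τ t) S (u t) := by gcongr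
    have h3 : 4 * (commConst r + 1) * latticeSum r * τ t * √(wEnergy r p (τ t) S (u t)) *
        wDissip r p (τ t) S (u t) ≤ radiusRate r M T A * τ t * wDissip r p (τ t) S (u t) := by
      refine mul_le_mul_of_nonneg_right ?_ hD0
      calc _ ≤ 4 * (commConst r + 1) * latticeSum r * τ t * G := by gcongr
        _ = (4 * (commConst r + 1) * latticeSum r * G) * τ t := by ring
        _ ≤ _ := by
          refine mul_le_mul_of_nonneg_right ?_ hτt.le
          unfold radiusRate
          linarith
    have h4 : 0 ≤ C₂ * τ t ^ 2 * wDissip r p (τ t) S (u t) := by positivity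
    have h5 : α * wEnergy r p (τ t) S (u t) =
        4 * commConst r * (M * latticeSum r + 1) * wEnergy r p (τ t) S (u t) +
          wEnergy r p (τ t) S (u t) := by
      rw [hα]; unfold gevreyRate; ring
    rw [h5]
    linarith

/-! ### Cubes of frequencies -/

/-- The frequencies with components of absolute value at most `N`. -/
def cube (N : ℕ) : Finset Freq := Fintype.piFinset fun _ => Finset.Icc (-(N : ℤ)) N

lemma mem_cube {N : ℕ} {k : Freq} : k ∈ cube N ↔ ∀ i, |k i| ≤ N := by
  simp [cube, abs_le]

lemma neg_mem_cube {N : ℕ} {k : Freq} (hk : k ∈ cube N) : -k ∈ cube N := by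
  rw [mem_cube] at hk ⊢
  simpa using hk

lemma cube_mono : Monotone cube := fun N N' h k hk => by
  rw [mem_cube] at hk ⊢
  exact fun i => (hk i).trans (by exact_mod_cast h)

lemma tendsto_cube : Filter.Tendsto cube Filter.atTop Filter.atTop :=
  Filter.tendsto_atTop_finset_of_monotone cube_mono fun k =>
    ⟨∑ i, (k i).natAbs, mem_cube.mpr fun i => by
      rw [Int.abs_eq_natAbs]
      exact_mod_cast Finset.single_le_sum (f := fun i => (k i).natAbs) (fun _ _ => Nat.zero_le _)
        (Finset.mem_univ i)⟩

/-- Galerkin approximations on cubes converge, frequency by frequency. -/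
lemma tendsto_galerkin {r M ν T : ℝ} (hr : 9 / 2 < r) (hM : 0 ≤ M) (hν : 0 ≤ ν)
    {v : ℝ → Coeffs} (hv : ∀ S, SolvesModes ν T S v)
    (hvM : ∀ t ∈ Icc 0 T, SobolevBound r M (v t)) {u : ℕ → ℝ → Coeffs}
    (hu : ∀ N, IsGalerkin ν T (cube N) (v 0) (u N)) {t : ℝ} (ht : t ∈ Icc 0 T) (k : Freq) :
    Filter.Tendsto (fun N => u N t k) Filter.atTop (nhds (v t k)) := by
  have h := (((tendsto_latticeTail r).comp tendsto_cube).const_mul (stabConst r M T)).sqrt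
  rw [mul_zero, Real.sqrt_zero] at h
  rw [tendsto_iff_norm_sub_tendsto_zero]
  refine squeeze_zero' (Filter.Eventually.of_forall fun _ => norm_nonneg _) ?_ h
  filter_upwards [tendsto_cube.eventually_ge_atTop {k}] with N hN
  have hk : k ∈ cube N := by simpa using hN
  rw [norm_sub_rev]
  refine Real.le_sqrt_of_sq_le (le_trans ?_ (sum_norm_sub_sq_le hr hM hν (hv _) hvM (hu N) ht))
  exact Finset.single_le_sum (f := fun k => ‖v t k - u N t k‖ ^ 2) (fun _ _ => sq_nonneg _) hk

/-- Solutions bounded in `H^r` are determined by their data: both are limits of the same Galerkin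
approximations. -/
theorem eq_of_solvesModes {r M ν T : ℝ} (hr : 9 / 2 < r) (hM : 0 ≤ M) (hν : 0 ≤ ν)
    {v w : ℝ → Coeffs} (hv : ∀ S, SolvesModes ν T S v) (hw : ∀ S, SolvesModes ν T S w)
    (hvM : ∀ t ∈ Icc 0 T, SobolevBound r M (v t)) (hwM : ∀ t ∈ Icc 0 T, SobolevBound r M (w t))
    (h0 : v 0 = w 0) {t : ℝ} (ht : t ∈ Icc 0 T) : v t = w t := by
  have hT : 0 ≤ T := ht.1.trans ht.2
  choose u hu using fun N => exists_galerkin hν hT (S := cube N) (fun _ => neg_mem_cube)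
    ((hv ∅).sol 0 ⟨le_rfl, hT⟩)
  funext k
  exact tendsto_nhds_unique (tendsto_galerkin hr hM hν hv hvM hu ht k)
    (tendsto_galerkin hr hM hν hw hwM (fun N => h0 ▸ hu N) ht k)

/-- Propagation of Gevrey regularity along a solution that is bounded in `H^r`. -/
theorem wEnergy_le_of_solvesModes {r p M T A ν τ₀ C₂ : ℝ} (hr : 9 / 2 < r) (hp : 0 ≤ p)
    (hp1 : p ≤ 1) (hM : 0 ≤ M) (hA : 0 ≤ A) (hν : 0 ≤ ν) (hτ₀ : 0 < τ₀) (hC₂ : 0 < C₂)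
    {v : ℝ → Coeffs} (hv : ∀ S, SolvesModes ν T S v)
    (hvM : ∀ t ∈ Icc 0 T, SobolevBound r M (v t)) (hA0 : ∀ F, wEnergy r p τ₀ F (v 0) ≤ A)
    {t : ℝ} (ht : t ∈ Icc 0 T) (F : Finset Freq) :
    wEnergy r p (gevreyRadius τ₀ (radiusRate r M T A) C₂ t) F (v t) ≤ gevreyBound r M T A := by
  have hT : 0 ≤ T := ht.1.trans ht.2
  choose u hu using fun N => exists_galerkin hν hT (S := cube N) (fun _ => neg_mem_cube)
    ((hv ∅).sol 0 ⟨le_rfl, hT⟩)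
  have hlim : Filter.Tendsto
      (fun N => wEnergy r p (gevreyRadius τ₀ (radiusRate r M T A) C₂ t) F (u N t)) Filter.atTop
      (nhds (wEnergy r p (gevreyRadius τ₀ (radiusRate r M T A) C₂ t) F (v t))) :=
    tendsto_finsetSum _ fun k _ =>
      (((tendsto_galerkin hr hM hν hv hvM hu ht k).norm).pow 2).const_mul _
  refine le_of_tendsto hlim ?_
  filter_upwards [tendsto_cube.eventually
    (wEnergy_le_gevreyBound hr hp hp1 hM hA hν hτ₀ hC₂ hv hvM hA0),
    tendsto_cube.eventually_ge_atTop F] with N hN hFN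
  refine le_trans ?_ (hN (u N) (hu N) t ht)
  exact Finset.sum_le_sum_of_subset_of_nonneg hFN fun k _ _ => by positivity

/-! ### Passage to the limit in the equations -/

lemma norm_adv_le_of_sobolevBound {r M : ℝ} (hr : 9 / 2 < r) (hM : 0 ≤ M) {u : Coeffs}
    (h : SobolevBound r M u) (h0 : u 0 = 0) (k : Freq) :
    ‖adv u u k‖ ≤ M * (M * latticeSum r) := by
  have hb := h.norm_le hM (by linarith) h0
  have hs := h.summable_gradAbs hM hr
  refine (norm_adv_le hb hs k).trans ?_
  refine le_trans ?_ (mul_le_mul_of_nonneg_left (h.tsum_gradAbs_le hM hr) hM)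
  rw [← tsum_mul_left]
  exact (summable_mul_of_bounded (fun k => norm_nonneg (u k)) hb (gradAbs_nonneg u) hs k).tsum_le_tsum
    (fun l => mul_le_mul_of_nonneg_right (hb _) (gradAbs_nonneg u l)) (hs.mul_left M)

lemma norm_rhs_le {r M ν : ℝ} (hr : 9 / 2 < r) (hM : 0 ≤ M) (hν : 0 ≤ ν) {u : Coeffs}
    (h : SobolevBound r M u) (h0 : u 0 = 0) (k : Freq) :
    ‖rhs ν u k‖ ≤ ν * freqSq k * M + M * (M * latticeSum r) := by
  refine (norm_sub_le _ _).trans (add_le_add ?_ ?_)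
  · rw [norm_neg, norm_smul, Real.norm_of_nonneg (mul_nonneg hν (freqSq_nonneg k))]
    exact mul_le_mul_of_nonneg_left (h.norm_le hM (by linarith) h0 k)
      (mul_nonneg hν (freqSq_nonneg k))
  · exact (norm_proj_le _ _).trans (norm_adv_le_of_sobolevBound hr hM h h0 k)

/-- The right-hand side is continuous for frequency-wise convergence under an `H^r` bound. -/
lemma tendsto_rhs {ι : Type*} {l : Filter ι} {r M ν : ℝ} (hr : 9 / 2 < r) (hM : 0 ≤ M)
    {U : ι → Coeffs} {u : Coeffs} (hU : ∀ᶠ x in l, SobolevBound r M (U x) ∧ U x 0 = 0)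
    (hlim : ∀ k, Filter.Tendsto (fun x => U x k) l (nhds (u k))) (k : Freq) :
    Filter.Tendsto (fun x => rhs ν (U x) k) l (nhds (rhs ν u k)) := by
  refine ((hlim k).const_smul _).neg.sub ?_
  refine ((proj k).continuous.tendsto _).comp ?_
  refine tendsto_tsum_of_dominated_convergence
    (bound := fun l => M * (M * freqAbs l ^ (3 / 2 - r)))
    (((summable_lattice hr).mul_left M).mul_left M) (fun l => ?_) ?_
  · exact (((innerSL ℂ (kvec l)).continuous.tendsto _).comp (hlim (k - l))).const_mul _ |>.smul
      (hlim l)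
  · filter_upwards [hU] with x hx l
    exact (norm_adv_term_le _ _ k l).trans (mul_le_mul (hx.1.norm_le hM (by linarith) hx.2 _)
      (hx.1.gradAbs_le hM l) (gradAbs_nonneg _ l) hM)

lemma continuousOn_rhs {r M ν T : ℝ} (hr : 9 / 2 < r) (hM : 0 ≤ M) {c : ℝ → Coeffs}
    (hc : ∀ t ∈ Icc 0 T, SobolevBound r M (c t) ∧ c t 0 = 0)
    (hcont : ∀ k, ContinuousOn (fun t => c t k) (Icc 0 T)) (k : Freq) :
    ContinuousOn (fun t => rhs ν (c t) k) (Icc 0 T) := fun t ht =>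
  tendsto_rhs hr hM (eventually_nhdsWithin_of_forall hc) (fun k => hcont k t ht) k

lemma solvesModes_of_integral {r M ν T : ℝ} (hr : 9 / 2 < r) (hM : 0 ≤ M) {c : ℝ → Coeffs}
    {a : Coeffs} (hsol : ∀ t ∈ Icc 0 T, Solenoidal (c t))
    (hb : ∀ t ∈ Icc 0 T, SobolevBound r M (c t))
    (hcont : ∀ k, ContinuousOn (fun t => c t k) (Icc 0 T))
    (hint : ∀ k, ∀ t ∈ Icc 0 T, c t k = a k + ∫ s in (0 : ℝ)..t, rhs ν (c s) k)
    (S : Finset Freq) : SolvesModes ν T S c := by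
  refine ⟨hsol, fun k _ t ht => ?_⟩
  have hrc := continuousOn_rhs (ν := ν) hr hM (fun t ht => ⟨hb t ht, (hsol t ht).zero⟩) hcont k
  have : Fact (t ∈ Icc 0 T) := ⟨ht⟩
  have h0 : (0 : ℝ) ∈ Icc 0 T := ⟨le_rfl, ht.1.trans ht.2⟩
  have h1 : HasDerivWithinAt (fun t => ∫ s in (0 : ℝ)..t, rhs ν (c s) k) (rhs ν (c t) k)
      (Icc 0 T) t :=
    intervalIntegral.integral_hasDerivWithinAt_right
      ((hrc.mono (uIcc_subset_Icc h0 ht)).intervalIntegrable)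
      (hrc.stronglyMeasurableAtFilter_nhdsWithin measurableSet_Icc t) (hrc t ht)
  exact (h1.const_add (a k)).congr (fun s hs => hint k s hs) (hint k t ht)

lemma IsGalerkin.eq_integral {r M ν T : ℝ} (hr : 9 / 2 < r) (hM : 0 ≤ M) {S : Finset Freq}
    {a : Coeffs} {u : ℝ → Coeffs} (hu : IsGalerkin ν T S a u)
    (hb : ∀ t ∈ Icc 0 T, SobolevBound r M (u t)) {k : Freq} (hk : k ∈ S) {t : ℝ}
    (ht : t ∈ Icc 0 T) :
    ContinuousOn (fun s => rhs ν (u s) k) (Icc 0 t) ∧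
      u t k = a k + ∫ s in (0 : ℝ)..t, rhs ν (u s) k := by
  have hsub : Icc 0 t ⊆ Icc 0 T := Icc_subset_Icc_right ht.2
  have hcont : ∀ l, ContinuousOn (fun t => u t l) (Icc 0 T) := fun l => by
    by_cases hl : l ∈ S
    · exact fun s hs => (hu.deriv l hl s hs).continuousWithinAt
    · exact continuousOn_const.congr fun s hs => hu.supp s hs l hl
  have hrc := (continuousOn_rhs (ν := ν) hr hM
    (fun t ht => ⟨hb t ht, (hu.sol t ht).zero⟩) hcont k).mono hsub
  refine ⟨hrc, ?_⟩
  have h := intervalIntegral.integral_eq_sub_of_hasDerivAt_of_le ht.1 ((hcont k).mono hsub)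
    (fun s hs => (hu.deriv k hk s (hsub (Ioo_subset_Icc_self hs))).hasDerivAt
      (Icc_mem_nhds hs.1 (hs.2.trans_le ht.2)))
    ((hrc.mono (uIcc_of_le ht.1).le).intervalIntegrable)
  rw [h, hu.init k hk]
  abel

/-- Local existence in `H^r`, uniformly in the viscosity. -/
theorem exists_local_solution {r ν T y : ℝ} (hr : 9 / 2 < r) (hν : 0 ≤ ν) (hT : 0 < T)
    (hy : 0 < y) (hTy : lifespanConst r * T * y ≤ 1) {a : Coeffs} (ha : Solenoidal a)
    (hay : SobolevBound r y a) : ∃ c : ℝ → Coeffs,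
      (∀ t ∈ Icc 0 T, Solenoidal (c t)) ∧ (∀ t ∈ Icc 0 T, SobolevBound r (2 * y) (c t)) ∧
      (∀ k, ContinuousOn (fun t => c t k) (Icc 0 T)) ∧
      ∀ k, ∀ t ∈ Icc 0 T, c t k = a k + ∫ s in (0 : ℝ)..t, rhs ν (c s) k := by
  have hy2 : 0 ≤ 2 * y := by positivity
  choose u hu using fun N => exists_galerkin hν hT.le (S := cube N) (fun _ => neg_mem_cube) ha
  have hub : ∀ N, ∀ t ∈ Icc 0 T, SobolevBound r (2 * y) (u N t) := fun N t ht =>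
    (hu N).sobolevBound hr hν hT hy hTy hay ht
  let d : ℕ → ℝ := fun N => √(stabConst r (2 * y) T * latticeTail r (cube N))
  have hd : Filter.Tendsto d Filter.atTop (nhds 0) := by
    have h := (((tendsto_latticeTail r).comp tendsto_cube).const_mul
      (stabConst r (2 * y) T)).sqrt
    rw [mul_zero, Real.sqrt_zero] at h
    exact h
  have hdist : ∀ N N', N ≤ N' → ∀ t ∈ Icc 0 T, ∀ k ∈ cube N, ‖u N' t k - u N t k‖ ≤ d N := by
    intro N N' hN t ht k hk
    have hsub := cube_mono hN
    have h1 : SolvesModes ν T (cube N) (u N') :=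
      ⟨(hu N').sol, fun k hk => (hu N').deriv k (hsub hk)⟩
    have h2 : IsGalerkin ν T (cube N) (u N' 0) (u N) :=
      ⟨(hu N).toSolvesModes, (hu N).supp, fun k hk => by
        rw [(hu N).init k hk, (hu N').init k (hsub hk)]⟩
    refine Real.le_sqrt_of_sq_le
      (le_trans ?_ (sum_norm_sub_sq_le hr hy2 hν h1 (hub N') h2 ht))
    exact Finset.single_le_sum (f := fun k => ‖u N' t k - u N t k‖ ^ 2) (fun _ _ => sq_nonneg _) hk
  have hmem : ∀ k : Freq, ∃ N₀, ∀ N ≥ N₀, k ∈ cube N := fun k => by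
    obtain ⟨N₀, hN₀⟩ := Filter.eventually_atTop.mp (tendsto_cube.eventually_ge_atTop {k})
    exact ⟨N₀, fun N hN => by simpa using hN₀ N hN⟩
  have hlim : ∀ t ∈ Icc 0 T, ∀ k, ∃ x, Filter.Tendsto (fun N => u N t k) Filter.atTop (nhds x) := by
    intro t ht k
    refine cauchySeq_tendsto_of_complete ?_
    obtain ⟨N₀, hN₀⟩ := hmem k
    rw [Metric.cauchySeq_iff']
    intro ε hε
    obtain ⟨N₁, hN₁⟩ := Filter.eventually_atTop.mp (hd.eventually_lt_const hε)
    refine ⟨max N₀ N₁, fun N hN => ?_⟩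
    rw [dist_eq_norm]
    exact (hdist _ N hN t ht k (hN₀ _ (le_max_left _ _))).trans_lt (hN₁ _ (le_max_right _ _))
  choose! c hc using hlim
  have hunif : ∀ N, ∀ t ∈ Icc 0 T, ∀ k ∈ cube N, ‖c t k - u N t k‖ ≤ d N := by
    intro N t ht k hk
    refine le_of_tendsto ((hc t ht k).sub_const (u N t k)).norm ?_
    filter_upwards [Filter.eventually_ge_atTop N] with N' hN'
    exact hdist N N' hN' t ht k hk
  have hsol : ∀ t ∈ Icc 0 T, Solenoidal (c t) := by
    intro t ht
    refine ⟨fun k => ?_, ?_, fun k => ?_⟩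
    · refine tendsto_nhds_unique (hc t ht k) ?_
      refine (((cj.continuous.tendsto _).comp (hc t ht (-k)))).congr fun N => ?_
      exact (((hu N).sol t ht).real k).symm
    · refine tendsto_nhds_unique (hc t ht 0) ?_
      refine tendsto_const_nhds.congr fun N => (((hu N).sol t ht).zero).symm
    · refine tendsto_nhds_unique
        (((innerSL ℂ (kvec k)).continuous.tendsto _).comp (hc t ht k)) ?_
      exact tendsto_const_nhds.congr fun N => (((hu N).sol t ht).div k).symm
  have hcb : ∀ t ∈ Icc 0 T, SobolevBound r (2 * y) (c t) := by
    intro t ht F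
    refine le_of_tendsto' (tendsto_finsetSum F fun k _ =>
      ((hc t ht k).norm.const_mul (freqAbs k ^ r)).pow 2) fun N => hub N t ht F
  refine ⟨c, hsol, hcb, fun k => ?_, fun k t ht => ?_⟩
  · have hU : TendstoUniformlyOn (fun N t => u N t k) (fun t => c t k) Filter.atTop (Icc 0 T) := by
      rw [Metric.tendstoUniformlyOn_iff]
      intro ε hε
      obtain ⟨N₀, hN₀⟩ := hmem k
      filter_upwards [hd.eventually_lt_const hε, Filter.eventually_ge_atTop N₀] with N hN hN' t ht
      rw [dist_eq_norm]
      exact (hunif N t ht k (hN₀ N hN')).trans_lt hN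
    refine hU.continuousOn (Filter.Eventually.frequently ?_)
    obtain ⟨N₀, hN₀⟩ := hmem k
    filter_upwards [Filter.eventually_ge_atTop N₀] with N hN t ht
    exact ((hu N).deriv k (hN₀ N hN) t ht).continuousWithinAt
  · obtain ⟨N₀, hN₀⟩ := hmem k
    have hI : ∀ s ∈ uIoc 0 t, s ∈ Icc 0 T := fun s hs => by
      rw [uIoc_of_le ht.1] at hs
      exact ⟨hs.1.le, hs.2.trans ht.2⟩
    have hint : Filter.Tendsto (fun N => ∫ s in (0 : ℝ)..t, rhs ν (u N s) k) Filter.atTop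
        (nhds (∫ s in (0 : ℝ)..t, rhs ν (c s) k)) := by
      refine intervalIntegral.tendsto_integral_filter_of_dominated_convergence
        (fun _ => ν * freqSq k * (2 * y) + 2 * y * (2 * y * latticeSum r)) ?_ ?_ ?_ ?_
      · filter_upwards [Filter.eventually_ge_atTop N₀] with N hN
        have h := ((hu N).eq_integral hr hy2 (hub N) (hN₀ N hN) ht).1
        rw [uIoc_of_le ht.1]
        exact (h.mono Ioc_subset_Icc_self).aestronglyMeasurable measurableSet_Ioc
      · exact Filter.Eventually.of_forall fun N => Filter.Eventually.of_forall fun s hs =>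
          norm_rhs_le hr hy2 hν (hub N s (hI s hs)) ((hu N).sol s (hI s hs)).zero k
      · exact intervalIntegrable_const
      · exact Filter.Eventually.of_forall fun s hs => tendsto_rhs hr hy2
          (Filter.Eventually.of_forall fun N => ⟨hub N s (hI s hs), ((hu N).sol s (hI s hs)).zero⟩)
          (hc s (hI s hs)) k
    refine tendsto_nhds_unique (hc t ht k) ((hint.const_add (a k)).congr' ?_)
    filter_upwards [Filter.eventually_ge_atTop N₀] with N hN
    exact ((hu N).eq_integral hr hy2 (hub N) (hN₀ N hN) ht).2.symm

/-! ### Square integrable fields and their coefficients -/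

/-- The Fourier coefficients of a field, as vectors of the Hermitian space `ℂ³`. -/
def toCoeffs (u : FieldL2) : Coeffs := fun k => WithLp.toLp 2 (hat u k)

lemma toCoeffs_apply (u : FieldL2) (k : Freq) (i : Fin 3) : toCoeffs u k i = coeff (u i) k := rfl

/-- The field with given Fourier coefficients. -/
def ofCoeffs (c : Coeffs) : FieldL2 := fun i => ofCoeff fun k => c k i

lemma norm_apply_sq_le (x : Vec) (i : Fin 3) : ‖x i‖ ^ 2 ≤ ‖x‖ ^ 2 := by
  rw [EuclideanSpace.norm_sq_eq]
  exact Finset.single_le_sum (f := fun i => ‖x i‖ ^ 2) (fun _ _ => sq_nonneg _) (Finset.mem_univ i)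

lemma memℓp_apply {c : Coeffs} {B : ℝ} (h : ∀ F : Finset Freq, ∑ k ∈ F, ‖c k‖ ^ 2 ≤ B ^ 2)
    (i : Fin 3) : Memℓp (fun k => c k i) 2 := by
  refine memℓp_gen' (C := B ^ 2) fun F => ?_
  simp only [ENNReal.toReal_ofNat, Real.rpow_ofNat]
  exact (Finset.sum_le_sum fun k _ => norm_apply_sq_le (c k) i).trans (h F)

lemma toCoeffs_ofCoeffs {c : Coeffs} {B : ℝ}
    (h : ∀ F : Finset Freq, ∑ k ∈ F, ‖c k‖ ^ 2 ≤ B ^ 2) : toCoeffs (ofCoeffs c) = c := by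
  funext k
  ext i
  exact coeff_ofCoeff (memℓp_apply h i) k

lemma norm_ofCoeffs_le {c : Coeffs} {B : ℝ} (hB : 0 ≤ B)
    (h : ∀ F : Finset Freq, ∑ k ∈ F, ‖c k‖ ^ 2 ≤ B ^ 2) : ‖ofCoeffs c‖ ≤ B := by
  refine (pi_norm_le_iff_of_nonneg hB).mpr fun i => ?_
  unfold ofCoeffs ofCoeff
  rw [dif_pos (memℓp_apply h i), LinearIsometryEquiv.norm_map]
  refine lp.norm_le_of_forall_sum_le (by simp) hB fun F => ?_
  simp only [ENNReal.toReal_ofNat, Real.rpow_ofNat]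
  exact (Finset.sum_le_sum fun k _ => norm_apply_sq_le (c k) i).trans (h F)

lemma scalar_ext {f g : ScalarL2} (h : ∀ k, coeff f k = coeff g k) : f = g := by
  refine (UnitAddTorus.mFourierBasis (d := Fin 3)).repr.injective ?_
  ext k
  rw [UnitAddTorus.mFourierBasis_repr, UnitAddTorus.mFourierBasis_repr]
  exact h k

lemma field_ext {u v : FieldL2} (h : toCoeffs u = toCoeffs v) : u = v := by
  funext i
  refine scalar_ext fun k => ?_
  exact congrArg (fun x : Vec => x i) (congrFun h k)

/-- A Fourier coefficient as a continuous functional. -/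
def scalarCoeffL (k : Freq) : ScalarL2 →L[ℂ] ℂ :=
  innerSL ℂ (UnitAddTorus.mFourierBasis (d := Fin 3) k)

lemma scalarCoeffL_apply (k : Freq) (f : ScalarL2) : scalarCoeffL k f = coeff f k := by
  rw [scalarCoeffL, innerSL_apply_apply, ← HilbertBasis.repr_apply_apply]
  exact UnitAddTorus.mFourierBasis_repr f k

/-- The vector Fourier coefficient as a continuous linear map. -/
def coeffL (k : Freq) : FieldL2 →L[ℂ] Vec :=
  (EuclideanSpace.equiv (Fin 3) ℂ).symm.toContinuousLinearMap.comp
    (ContinuousLinearMap.pi fun i => (scalarCoeffL k).comp (ContinuousLinearMap.proj i))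

lemma coeffL_apply (k : Freq) (u : FieldL2) : coeffL k u = toCoeffs u k := by
  ext i
  rw [toCoeffs_apply, ← scalarCoeffL_apply]
  rfl

lemma isSolenoidal_iff (u : FieldL2) : IsSolenoidal u ↔ Solenoidal (toCoeffs u) := by
  constructor
  · rintro ⟨h1, h2, h3⟩
    refine ⟨fun k => ?_, ?_, fun k => ?_⟩
    · ext i
      rw [cj_apply]
      exact h1 k i
    · ext i
      exact congrFun h2 i
    · rw [inner_kvec]; exact h3 k
  · rintro ⟨h1, h2, h3⟩
    refine ⟨fun k i => ?_, ?_, fun k => ?_⟩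
    · have := congrArg (fun x : Vec => x i) (h1 k)
      simp only [cj_apply] at this
      exact this
    · funext i
      exact congrArg (fun x : Vec => x i) h2
    · have := h3 k
      rwa [inner_kvec] at this

/-! ### Sobolev and Gevrey norms in terms of the coefficients -/

lemma vecSq_hat (u : FieldL2) (k : Freq) : vecSq (hat u k) = ‖toCoeffs u k‖ ^ 2 :=
  (norm_sq_eq_vecSq (toCoeffs u k)).symm

lemma rpow_two_mul_freqAbs (r : ℝ) (k : Freq) : freqAbs k ^ (2 * r) = (freqAbs k ^ r) ^ 2 := by
  rw [← Real.rpow_mul_natCast (freqAbs_nonneg k)]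
  congr 1; push_cast; ring

lemma sobolevNorm_nonneg (r : ℝ) (u : FieldL2) : 0 ≤ sobolevNorm r u := Real.sqrt_nonneg _

lemma sobolev_term_nonneg (r : ℝ) (u : FieldL2) (k : Freq) :
    0 ≤ (1 + freqSq k) ^ r * vecSq (hat u k) := by
  have := freqSq_nonneg k
  rw [vecSq_hat]; positivity

lemma sobolevBound_of_inSobolev {r M : ℝ} (hr : 0 ≤ r) {u : FieldL2} (h : InSobolev r u)
    (hM : sobolevNorm r u ≤ M) : SobolevBound r M (toCoeffs u) := by
  intro F
  have h0 := sobolevNorm_nonneg r u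
  refine le_trans ?_ (pow_le_pow_left₀ h0 hM 2)
  rw [sobolevNorm, Real.sq_sqrt (tsum_nonneg (sobolev_term_nonneg r u))]
  refine le_trans (Finset.sum_le_sum fun k _ => ?_)
    (h.2.sum_le_tsum F fun k _ => sobolev_term_nonneg r u k)
  rw [vecSq_hat, mul_pow, ← rpow_two_mul_freqAbs, Real.rpow_mul (freqAbs_nonneg k)]
  refine mul_le_mul_of_nonneg_right (Real.rpow_le_rpow ?_ ?_ hr) (sq_nonneg _)
  · exact Real.rpow_nonneg (freqAbs_nonneg k) _
  · rw [freqSq_eq]; simp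

lemma inSobolev_of_sobolevBound {r M : ℝ} (hr : 0 ≤ r) (hM : 0 ≤ M) {u : FieldL2}
    (hs : IsSolenoidal u) (h : SobolevBound r M (toCoeffs u)) :
    InSobolev r u ∧ sobolevNorm r u ≤ √(2 ^ r) * M := by
  have hb : ∀ F : Finset Freq, ∑ k ∈ F, (1 + freqSq k) ^ r * vecSq (hat u k) ≤ 2 ^ r * M ^ 2 := by
    intro F
    refine le_trans ?_ (mul_le_mul_of_nonneg_left (h F) (by positivity))
    rw [Finset.mul_sum]
    refine Finset.sum_le_sum fun k _ => ?_
    rw [vecSq_hat, mul_pow, ← mul_assoc]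
    by_cases hk : k = 0
    · rw [hk, ((isSolenoidal_iff u).mp hs).zero]; simp
    · refine mul_le_mul_of_nonneg_right ?_ (sq_nonneg _)
      have h1 := one_le_freqAbs hk
      rw [← rpow_two_mul_freqAbs, Real.rpow_mul (freqAbs_nonneg k), freqSq_eq,
        ← Real.mul_rpow (by norm_num) (by positivity)]
      refine Real.rpow_le_rpow (by positivity) ?_ hr
      rw [Real.rpow_two]
      nlinarith
  have hsum : Summable fun k => (1 + freqSq k) ^ r * vecSq (hat u k) :=
    summable_of_sum_le (sobolev_term_nonneg r u) hb
  refine ⟨⟨hs, hsum⟩, ?_⟩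
  have h2 := hsum.tsum_le_of_sum_le hb
  rw [sobolevNorm]
  refine (Real.sqrt_le_sqrt h2).trans (le_of_eq ?_)
  rw [Real.sqrt_mul (by positivity), Real.sqrt_sq hM]

lemma sum_gevreyTerm (s r τ : ℝ) (u : FieldL2) (F : Finset Freq) :
    ∑ k ∈ F, gevreyTerm s r τ u k = wEnergy r (1 / s) τ F (toCoeffs u) := by
  refine Finset.sum_congr rfl fun k _ => ?_
  rw [gevreyTerm, fweight_sq, vecSq_hat, rpow_two_mul_freqAbs]

lemma gevreyTerm_nonneg (s r τ : ℝ) (u : FieldL2) (k : Freq) : 0 ≤ gevreyTerm s r τ u k := by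
  have := Real.rpow_nonneg (freqAbs_nonneg k) (2 * r)
  rw [gevreyTerm, vecSq_hat]; positivity

lemma wEnergy_le_gevreyNorm_sq {s r τ : ℝ} {u : FieldL2} (h : InGevrey s r τ u) (F : Finset Freq) :
    wEnergy r (1 / s) τ F (toCoeffs u) ≤ gevreyNorm s r τ u ^ 2 := by
  rw [← sum_gevreyTerm, gevreyNorm, Real.sq_sqrt (tsum_nonneg (gevreyTerm_nonneg s r τ u))]
  exact h.2.sum_le_tsum F fun k _ => gevreyTerm_nonneg s r τ u k

lemma gevrey_of_wEnergy_le {s r τ B : ℝ} {u : FieldL2} (hs : InSobolev r u)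
    (h : ∀ F, wEnergy r (1 / s) τ F (toCoeffs u) ≤ B) :
    InGevrey s r τ u ∧ gevreyNorm s r τ u ≤ √B := by
  have hb : ∀ F : Finset Freq, ∑ k ∈ F, gevreyTerm s r τ u k ≤ B := fun F => by
    rw [sum_gevreyTerm]; exact h F
  have hsum : Summable (gevreyTerm s r τ u) := summable_of_sum_le (gevreyTerm_nonneg s r τ u) hb
  exact ⟨⟨hs, hsum⟩, Real.sqrt_le_sqrt (hsum.tsum_le_of_sum_le hb)⟩

lemma sobolevBound_of_inGevrey {s r τ M : ℝ} (hτ : 0 ≤ τ) {u : FieldL2} (h : InGevrey s r τ u)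
    (hM : gevreyNorm s r τ u ≤ M) : SobolevBound r M (toCoeffs u) := by
  intro F
  have h0 : 0 ≤ gevreyNorm s r τ u := Real.sqrt_nonneg _
  refine le_trans (Finset.sum_le_sum fun k _ => ?_)
    ((wEnergy_le_gevreyNorm_sq h F).trans (pow_le_pow_left₀ h0 hM 2))
  rw [mul_pow, fweight_sq]
  refine mul_le_mul_of_nonneg_right ?_ (sq_nonneg _)
  refine le_mul_of_one_le_right (sq_nonneg _) (Real.one_le_exp ?_)
  have := Real.rpow_nonneg (freqAbs_nonneg k) (1 / s)
  positivity

/-! ### Products and convolutions -/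

/-- The Fourier coefficients of a product of square integrable functions are a convolution. -/
lemma hasSum_coeff_mul (f g : ScalarL2) (k : Freq) :
    Integrable (fun x => UnitAddTorus.mFourier (-k) x * (f x * g x)) torusMeasure ∧
      HasSum (fun l => coeff f (k - l) * coeff g l) (coeff (fun x => f x * g x) k) := by
  have hmem : MemLp (fun x => starRingEnd ℂ (f x) * UnitAddTorus.mFourier k x) 2 torusMeasure := by
    have h1 : MemLp (fun x => starRingEnd ℂ (f x)) 2 torusMeasure := (Lp.memLp f).star
    have h2 : MemLp (fun x => UnitAddTorus.mFourier k x) ⊤ torusMeasure :=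
      memLp_top_of_bound (UnitAddTorus.mFourier k).continuous.aestronglyMeasurable
        ‖UnitAddTorus.mFourier k‖
        (Filter.Eventually.of_forall (UnitAddTorus.mFourier k).norm_coe_le_norm)
    exact h2.mul h1
  have hco := hmem.coeFn_toLp
  set h := hmem.toLp with hh
  have hint := L2.integrable_inner (𝕜 := ℂ) h g
  have e1 : (fun x => ⟪h x, g x⟫_ℂ) =ᵐ[torusMeasure]
      fun x => UnitAddTorus.mFourier (-k) x * (f x * g x) := by
    filter_upwards [hco] with x hx
    rw [hx, UnitAddTorus.mFourier_neg, RCLike.inner_apply]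
    simp only [map_mul, RCLike.conj_conj]
    ring
  refine ⟨hint.congr e1, ?_⟩
  have hs := UnitAddTorus.hasSum_prod_mFourierCoeff (d := Fin 3) h g
  have e2 : ∀ l, starRingEnd ℂ (UnitAddTorus.mFourierCoeff h l) = coeff f (k - l) := by
    intro l
    unfold coeff UnitAddTorus.mFourierCoeff
    rw [← integral_conj]
    refine integral_congr_ae ?_
    filter_upwards [hco] with x hx
    rw [hx]
    simp only [smul_eq_mul, map_mul, RCLike.conj_conj]
    rw [← UnitAddTorus.mFourier_neg, ← UnitAddTorus.mFourier_neg, neg_neg, neg_sub, sub_eq_add_neg,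
      UnitAddTorus.mFourier_add]
    ring
  have e3 : ∫ x, starRingEnd ℂ (h x) * g x ∂torusMeasure = coeff (fun x => f x * g x) k := by
    unfold coeff UnitAddTorus.mFourierCoeff
    refine integral_congr_ae ?_
    filter_upwards [e1] with x hx
    rw [smul_eq_mul, ← hx, RCLike.inner_apply, mul_comm]
  simp_rw [e2] at hs
  rw [← e3]
  exact hs

/-! ### The drift in terms of the coefficients -/

lemma sum_freqSq_smul_sq_le {r M : ℝ} (hr : 2 ≤ r) {c : Coeffs} (h : SobolevBound r M c)
    (h0 : c 0 = 0) (F : Finset Freq) : ∑ k ∈ F, ‖(freqSq k : ℂ) • c k‖ ^ 2 ≤ M ^ 2 := by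
  refine le_trans (Finset.sum_le_sum fun k _ => ?_) (h F)
  by_cases hk : k = 0
  · rw [hk, h0]; simp
  · have h1 := one_le_freqAbs hk
    refine pow_le_pow_left₀ (norm_nonneg _) ?_ 2
    rw [norm_smul, Complex.norm_real, Real.norm_of_nonneg (freqSq_nonneg k), freqSq_eq]
    refine mul_le_mul_of_nonneg_right ?_ (norm_nonneg _)
    rw [← Real.rpow_two]
    exact Real.rpow_le_rpow_of_exponent_le h1 hr

/-- `(u · ∇) u` is square integrable. -/
lemma sum_norm_adv_sq_le {r M : ℝ} (hr : 9 / 2 < r) (hM : 0 ≤ M) {c : Coeffs}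
    (h : SobolevBound r M c) (h0 : c 0 = 0) (F : Finset Freq) :
    ∑ k ∈ F, ‖adv c c k‖ ^ 2 ≤ (M * (M * latticeSum r)) ^ 2 := by
  have hb := h.norm_le hM (by linarith) h0
  have hs := h.summable_gradAbs hM hr
  have hA0 : 0 ≤ ∑ k ∈ F, ‖adv c c k‖ ^ 2 := Finset.sum_nonneg fun _ _ => sq_nonneg _
  have hP2 : √(∑ k ∈ F, ‖adv c c k‖ ^ 2) ^ 2 = ∑ k ∈ F, ‖adv c c k‖ ^ 2 := Real.sq_sqrt hA0
  have hP0 := Real.sqrt_nonneg (∑ k ∈ F, ‖adv c c k‖ ^ 2)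
  have hC0 : 0 ≤ M * (M * latticeSum r) := mul_nonneg hM (mul_nonneg hM (latticeSum_nonneg r))
  have h1 := young_tsum (S := F) (p := fun k => ‖adv c c k‖) (q := fun k => ‖c k‖)
    (b := gradAbs c) hP0 hM hP2.ge (fun k => norm_nonneg _) (h.sum_norm_sq_le (by linarith) h0)
    (gradAbs_nonneg c) hs
  have h2 : ∑ k ∈ F, ‖adv c c k‖ ^ 2 ≤ √(∑ k ∈ F, ‖adv c c k‖ ^ 2) * (M * (M * latticeSum r)) := by
    calc ∑ k ∈ F, ‖adv c c k‖ ^ 2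
        ≤ ∑ k ∈ F, ‖adv c c k‖ * ∑' l, ‖c (k - l)‖ * gradAbs c l :=
          Finset.sum_le_sum fun k _ => by
            rw [sq]
            exact mul_le_mul_of_nonneg_left (norm_adv_le hb hs k) (norm_nonneg _)
      _ ≤ _ := h1
      _ ≤ _ := by
          rw [mul_assoc]
          exact mul_le_mul_of_nonneg_left
            (mul_le_mul_of_nonneg_left (h.tsum_gradAbs_le hM hr) hM) hP0
  rw [← hP2] at h2 ⊢
  generalize √(∑ k ∈ F, ‖adv c c k‖ ^ 2) = P at *
  rw [Real.sqrt_sq hP0] at h2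
  refine pow_le_pow_left₀ hP0 ?_ 2
  rcases hP0.eq_or_lt with h3 | h3
  · rw [← h3]; exact hC0
  · nlinarith

lemma coeff_pderiv {r M : ℝ} (hr : 9 / 2 < r) {u : FieldL2} (hs : Solenoidal (toCoeffs u))
    (h : SobolevBound r M (toCoeffs u)) (i j : Fin 3) (l : Freq) :
    coeff (pderiv j (u i)) l = Complex.I * (l j : ℂ) * coeff (u i) l := by
  refine coeff_ofCoeff (memℓp_gen' (C := M ^ 2) fun F => ?_) l
  simp only [ENNReal.toReal_ofNat, Real.rpow_ofNat]
  refine le_trans (Finset.sum_le_sum fun k _ => ?_)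
    (sum_freqSq_smul_sq_le (by linarith) h hs.zero F)
  have h1 := norm_apply_sq_le ((freqSq k : ℂ) • toCoeffs u k) i
  refine le_trans ?_ h1
  rw [PiLp.smul_apply, smul_eq_mul, toCoeffs_apply, norm_mul, norm_mul, norm_mul,
    Complex.norm_I, one_mul, Complex.norm_real, Real.norm_of_nonneg (freqSq_nonneg k)]
  refine pow_le_pow_left₀ (by positivity) (mul_le_mul_of_nonneg_right ?_ (norm_nonneg _)) 2
  have h2 : ((k j : ℝ)) ^ 2 ≤ freqSq k :=
    Finset.single_le_sum (f := fun i => (k i : ℝ) ^ 2) (fun _ _ => sq_nonneg _) (Finset.mem_univ j)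
  have h3 : |(k j : ℝ)| ≤ (k j : ℝ) ^ 2 := by
    rw [← sq_abs]
    have h4 : |(k j : ℝ)| = ((|k j| : ℤ) : ℝ) := by push_cast; rfl
    rw [h4]
    have h5 : |k j| ≤ |k j| ^ 2 := by
      have := abs_nonneg (k j)
      nlinarith [Int.le_self_sq |k j|]
    exact_mod_cast h5
  rw [Complex.norm_intCast]
  exact h3.trans h2

/-- The Fourier coefficients of the convection term. -/
lemma fieldCoeff_convection {r M : ℝ} (hr : 9 / 2 < r) (hM : 0 ≤ M) {u : FieldL2}
    (hs : Solenoidal (toCoeffs u)) (h : SobolevBound r M (toCoeffs u)) (k : Freq) :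
    WithLp.toLp 2 (fieldCoeff (convection u) k) = adv (toCoeffs u) (toCoeffs u) k := by
  ext i
  have h1 := fun j => hasSum_coeff_mul (u j) (pderiv j (u i)) k
  have e1 : fieldCoeff (convection u) k i =
      ∑ j, coeff (fun x => u j x * pderiv j (u i) x) k := by
    unfold fieldCoeff convection coeff UnitAddTorus.mFourierCoeff
    simp_rw [Finset.smul_sum, smul_eq_mul]
    exact integral_finsetSum _ fun j _ => (h1 j).1
  have h2 := hasSum_sum fun j (_ : j ∈ Finset.univ) => (h1 j).2
  have h3 := (summable_adv (h.norm_le hM (by linarith) hs.zero)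
    (h.summable_gradAbs hM hr) k).hasSum.mapL (EuclideanSpace.proj (𝕜 := ℂ) i)
  change fieldCoeff (convection u) k i = (adv (toCoeffs u) (toCoeffs u) k) i
  rw [e1]
  refine h2.unique (h3.congr_fun fun l => ?_)
  change _ = ((Complex.I * ⟪kvec l, toCoeffs u (k - l)⟫_ℂ) • toCoeffs u l) i
  simp only [PiLp.smul_apply, smul_eq_mul, inner_kvec, freqDot,
    Finset.mul_sum, Finset.sum_mul, toCoeffs_apply]
  refine Finset.sum_congr rfl fun j _ => ?_
  rw [coeff_pderiv hr hs h]
  change _ = Complex.I * (l j * coeff (u j) (k - l)) * coeff (u i) l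
  ring

lemma leray_eq (v : Fin 3 → Torus → ℂ) :
    leray v = ofCoeffs fun k => proj k (WithLp.toLp 2 (fieldCoeff v k)) := by
  funext i
  unfold leray ofCoeffs
  congr 1
  funext k
  change _ = proj k (WithLp.toLp 2 (fieldCoeff v k)) i
  rw [proj_apply, inner_kvec]
  simp only [PiLp.sub_apply, PiLp.smul_apply, kvec, smul_eq_mul]
  ring

lemma leray_convection_eq {r M : ℝ} (hr : 9 / 2 < r) (hM : 0 ≤ M) {u : FieldL2}
    (hs : Solenoidal (toCoeffs u)) (h : SobolevBound r M (toCoeffs u)) :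
    leray (convection u) = ofCoeffs fun k => proj k (adv (toCoeffs u) (toCoeffs u) k) := by
  rw [leray_eq]
  simp_rw [fieldCoeff_convection hr hM hs h]

lemma sum_norm_proj_adv_sq_le {r M : ℝ} (hr : 9 / 2 < r) (hM : 0 ≤ M) {c : Coeffs}
    (h : SobolevBound r M c) (h0 : c 0 = 0) (F : Finset Freq) :
    ∑ k ∈ F, ‖proj k (adv c c k)‖ ^ 2 ≤ (M * (M * latticeSum r)) ^ 2 :=
  (Finset.sum_le_sum fun k _ => pow_le_pow_left₀ (norm_nonneg _) (norm_proj_le k _) 2).trans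
    (sum_norm_adv_sq_le hr hM h h0 F)

lemma leray_self {a : FieldL2} (ha : Solenoidal (toCoeffs a)) :
    leray (fun i => (a i : Torus → ℂ)) = a := by
  rw [leray_eq]
  funext i
  refine scalar_ext fun k => ?_
  have h : (fun k => proj k (WithLp.toLp 2 (fieldCoeff (fun i => (a i : Torus → ℂ)) k))) =
      toCoeffs a := by
    funext k
    exact proj_eq_self (ha.div k)
  rw [h]
  refine coeff_ofCoeff ?_ k
  have hm := (UnitAddTorus.mFourierBasis (d := Fin 3)).repr (a i) |>.2
  refine (congrArg (fun f => Memℓp f 2) ?_).mp hm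
  funext k
  exact UnitAddTorus.mFourierBasis_repr (a i) k

lemma stokes_eq {r M : ℝ} (hr : 9 / 2 < r) {u : FieldL2} (hs : Solenoidal (toCoeffs u))
    (h : SobolevBound r M (toCoeffs u)) :
    stokes u = -ofCoeffs fun k => -((freqSq k : ℂ) • toCoeffs u k) := by
  have hb : ∀ F : Finset Freq, ∑ k ∈ F, ‖-((freqSq k : ℂ) • toCoeffs u k)‖ ^ 2 ≤ M ^ 2 := fun F => by
    simp_rw [norm_neg]; exact sum_freqSq_smul_sq_le (by linarith) h hs.zero F
  unfold stokes
  rw [leray_eq]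
  congr 2
  funext k
  have e : WithLp.toLp 2 (fieldCoeff (fun i => (laplacian (u i) : Torus → ℂ)) k) =
      -((freqSq k : ℂ) • toCoeffs u k) := by
    ext i
    refine (coeff_ofCoeff ?_ k).trans ?_
    · refine (congrArg (fun f => Memℓp f 2) ?_).mp (memℓp_apply hb i)
      funext k
      simp [toCoeffs_apply]
    · simp [toCoeffs_apply]
  rw [e]
  refine proj_eq_self ?_
  rw [inner_neg_right, inner_smul_right, hs.div]; simp

lemma toCoeffs_add (u v : FieldL2) : toCoeffs (u + v) = toCoeffs u + toCoeffs v := by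
  funext k; simp only [Pi.add_apply, ← coeffL_apply, map_add]

lemma toCoeffs_neg (u : FieldL2) : toCoeffs (-u) = -toCoeffs u := by
  funext k; simp only [Pi.neg_apply, ← coeffL_apply, map_neg]

lemma toCoeffs_smul (c : ℂ) (u : FieldL2) : toCoeffs (c • u) = c • toCoeffs u := by
  funext k; simp only [Pi.smul_apply, ← coeffL_apply, map_smul]

/-- The drift at a field of class `H^r`: its coefficients and its norm. -/
lemma drift_spec {r M ν : ℝ} (hr : 9 / 2 < r) (hM : 0 ≤ M) (hν : 0 ≤ ν) {u : FieldL2}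
    (hs : Solenoidal (toCoeffs u)) (h : SobolevBound r M (toCoeffs u)) :
    (∀ k, toCoeffs (drift ν u) k = -rhs ν (toCoeffs u) k) ∧
      ‖drift ν u‖ ≤ ν * M + M * (M * latticeSum r) := by
  have hb : ∀ F : Finset Freq, ∑ k ∈ F, ‖-((freqSq k : ℂ) • toCoeffs u k)‖ ^ 2 ≤ M ^ 2 := fun F => by
    simp_rw [norm_neg]; exact sum_freqSq_smul_sq_le (by linarith) h hs.zero F
  have hb2 := sum_norm_proj_adv_sq_le hr hM h hs.zero
  refine ⟨fun k => ?_, ?_⟩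
  · rw [drift, toCoeffs_add, toCoeffs_smul, stokes_eq hr hs h, toCoeffs_neg, toCoeffs_ofCoeffs hb,
      leray_convection_eq hr hM hs h, toCoeffs_ofCoeffs hb2, rhs]
    simp only [Pi.add_apply, Pi.smul_apply, Pi.neg_apply, neg_neg, smul_smul]
    rw [← Complex.coe_smul]
    push_cast
    abel
  · rw [drift]
    have hC : 0 ≤ M * (M * latticeSum r) := mul_nonneg hM (mul_nonneg hM (latticeSum_nonneg r))
    refine (norm_add_le _ _).trans (add_le_add ?_ ?_)
    · rw [norm_smul, Complex.norm_real, Real.norm_of_nonneg hν, stokes_eq hr hs h, norm_neg]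
      exact mul_le_mul_of_nonneg_left (norm_ofCoeffs_le hM hb) hν
    · rw [leray_convection_eq hr hM hs h]
      exact norm_ofCoeffs_le hC hb2

/-! ### Measurability of fields given by coefficients -/

/-- The field `x e^{i k·}`. -/
def monomialL (k : Freq) : Vec →L[ℂ] FieldL2 :=
  ContinuousLinearMap.pi fun i =>
    (EuclideanSpace.proj i).smulRight (UnitAddTorus.mFourierLp (d := Fin 3) 2 k)

lemma tendsto_sum_monomialL (u : FieldL2) :
    Filter.Tendsto (fun N => ∑ k ∈ cube N, monomialL k (toCoeffs u k)) Filter.atTop (nhds u) := by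
  refine tendsto_pi_nhds.mpr fun i => ?_
  refine ((UnitAddTorus.hasSum_mFourier_series_L2 (d := Fin 3) (u i)).comp tendsto_cube).congr
    fun _ => ?_
  rw [Function.comp_apply, Finset.sum_apply]
  rfl

lemma aestronglyMeasurable_of_toCoeffs {μ : Measure ℝ} {u : ℝ → FieldL2}
    (h : ∀ k, AEStronglyMeasurable (fun t => toCoeffs (u t) k) μ) : AEStronglyMeasurable u μ :=
  aestronglyMeasurable_of_tendsto_ae Filter.atTop
    (f := fun N t => ∑ k ∈ cube N, monomialL k (toCoeffs (u t) k))
    (fun _ => Finset.aestronglyMeasurable_fun_sum _ fun k _ =>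
      (monomialL k).continuous.comp_aestronglyMeasurable (h k))
    (Filter.Eventually.of_forall fun t => tendsto_sum_monomialL (u t))

/-! ### Solutions as fields and as coefficient sequences -/

/-- The times at which an almost sure property holds are dense. -/
lemma mem_closure_of_ae {T : ℝ} (hT : 0 < T) {P : ℝ → Prop}
    (h : ∀ᵐ t ∂volume.restrict (Icc 0 T), P t) {t : ℝ} (ht : t ∈ Icc 0 T) :
    t ∈ closure {s | s ∈ Icc 0 T ∧ P s} := by
  have hD : Dense {s | s ∈ Icc 0 T → P s} :=
    Measure.dense_of_ae ((ae_restrict_iff' measurableSet_Icc).mp h)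
  have h1 : Ioo 0 T ⊆ closure {s | s ∈ Icc 0 T ∧ P s} := by
    refine (hD.open_subset_closure_inter isOpen_Ioo).trans (closure_mono ?_)
    exact fun s hs => ⟨Ioo_subset_Icc_self hs.1, hs.2 (Ioo_subset_Icc_self hs.1)⟩
  have h2 : t ∈ closure (Ioo 0 T) := by rwa [closure_Ioo hT.ne]
  exact closure_minimal h1 isClosed_closure h2

/-- A solution in `L^∞ H^r` satisfies the equations frequency by frequency, classically, and its
`H^r` bound holds at every time. -/
lemma solvesModes_of_isSolution {r M ν T : ℝ} (hr : 9 / 2 < r) (hM : 0 ≤ M) (hν : 0 ≤ ν)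
    (hT : 0 < T) {a : FieldL2} {u : ℝ → FieldL2} (ha : Solenoidal (toCoeffs a))
    (hu : IsSolution ν T a u)
    (hb : ∀ᵐ t ∂volume.restrict (Icc (0 : ℝ) T),
      Solenoidal (toCoeffs (u t)) ∧ SobolevBound r M (toCoeffs (u t))) :
    (∀ S, SolvesModes ν T S fun t => toCoeffs (u t)) ∧
      (∀ t ∈ Icc 0 T, SobolevBound r M (toCoeffs (u t))) ∧ toCoeffs (u 0) = toCoeffs a := by
  have hint : ∀ t ∈ Icc 0 T, IntervalIntegrable (fun s => drift ν (u s)) volume 0 t :=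
    fun t ht => hu.1.mono_set (by
      rw [uIcc_of_le ht.1, uIcc_of_le hT.le]; exact Icc_subset_Icc_right ht.2)
  have heq : ∀ k, ∀ t ∈ Icc 0 T, toCoeffs (u t) k =
      toCoeffs a k - ∫ s in (0 : ℝ)..t, toCoeffs (drift ν (u s)) k := by
    intro k t ht
    have h1 := (coeffL k).intervalIntegral_comp_comm (hint t ht)
    have h2 := congrArg (coeffL k) (hu.2 t ht)
    rw [leray_self ha, map_sub, ← h1] at h2
    simpa only [coeffL_apply] using h2
  have hcont : ∀ k, ContinuousOn (fun t => toCoeffs (u t) k) (Icc 0 T) := by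
    intro k
    have h1 : IntervalIntegrable (fun s => toCoeffs (drift ν (u s)) k) volume 0 T := by
      have := hu.1
      rw [intervalIntegrable_iff] at this ⊢
      have h := (coeffL k).integrable_comp this
      simp only [coeffL_apply] at h
      exact h
    have h2 := intervalIntegral.continuousOn_primitive_interval' h1 left_mem_uIcc
    rw [uIcc_of_le hT.le] at h2
    exact (continuousOn_const.sub h2).congr fun t ht => heq k t ht
  have hall : ∀ t ∈ Icc 0 T, Solenoidal (toCoeffs (u t)) ∧ SobolevBound r M (toCoeffs (u t)) := by
    intro t ht
    have hcl := mem_closure_of_ae hT hb ht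
    set D := {s | s ∈ Icc 0 T ∧ Solenoidal (toCoeffs (u s)) ∧ SobolevBound r M (toCoeffs (u s))}
    have : (nhdsWithin t D).NeBot := mem_closure_iff_nhdsWithin_neBot.mp hcl
    have hlim : ∀ k, Filter.Tendsto (fun s => toCoeffs (u s) k) (nhdsWithin t D)
        (nhds (toCoeffs (u t) k)) := fun k =>
      (hcont k t ht).mono_left (nhdsWithin_mono t fun s hs => hs.1)
    have hev : ∀ᶠ s in nhdsWithin t D, Solenoidal (toCoeffs (u s)) ∧
        SobolevBound r M (toCoeffs (u s)) := eventually_nhdsWithin_of_forall fun s hs => hs.2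
    refine ⟨⟨fun k => ?_, ?_, fun k => ?_⟩, fun F => ?_⟩
    · refine tendsto_nhds_unique_of_eventuallyEq (hlim k)
        ((cj.continuous.tendsto _).comp (hlim (-k))) ?_
      filter_upwards [hev] with s hs
      exact hs.1.real k
    · refine tendsto_nhds_unique_of_eventuallyEq (hlim 0) tendsto_const_nhds ?_
      filter_upwards [hev] with s hs
      exact hs.1.zero
    · refine tendsto_nhds_unique_of_eventuallyEq
        (((innerSL ℂ (kvec k)).continuous.tendsto _).comp (hlim k)) tendsto_const_nhds ?_
      filter_upwards [hev] with s hs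
      exact hs.1.div k
    · refine le_of_tendsto (tendsto_finsetSum F fun k _ =>
        ((hlim k).norm.const_mul (freqAbs k ^ r)).pow 2) ?_
      filter_upwards [hev] with s hs
      exact hs.2 F
  refine ⟨fun S => ?_, fun t ht => (hall t ht).2, ?_⟩
  · refine solvesModes_of_integral (a := toCoeffs a) hr hM (fun t ht => (hall t ht).1)
      (fun t ht => (hall t ht).2) hcont (fun k t ht => ?_) S
    rw [heq k t ht, sub_eq_add_neg, ← intervalIntegral.integral_neg]
    congr 1
    refine intervalIntegral.integral_congr fun s hs => ?_
    rw [uIcc_of_le ht.1] at hs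
    have hs' := hall s ⟨hs.1, hs.2.trans ht.2⟩
    simp only [(drift_spec hr hM hν hs'.1 hs'.2).1 k, neg_neg]
  · funext k
    rw [heq k 0 ⟨le_rfl, hT.le⟩]
    simp

/-- Local existence for fields. -/
lemma exists_isSolution {r ν T y : ℝ} (hr : 9 / 2 < r) (hν : 0 ≤ ν) (hT : 0 < T) (hy : 0 < y)
    (hTy : lifespanConst r * T * y ≤ 1) {a : FieldL2} (ha : Solenoidal (toCoeffs a))
    (hay : SobolevBound r y (toCoeffs a)) :
    ∃ u : ℝ → FieldL2, LinftySobolevLe r T (√(2 ^ r) * (2 * y)) u ∧ IsSolution ν T a u := by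
  have hr0 : 0 ≤ r := by linarith
  have hy2 : 0 ≤ 2 * y := by positivity
  obtain ⟨c, hsol, hcb, hcont, hceq⟩ := exists_local_solution hr hν hT hy hTy ha hay
  let u : ℝ → FieldL2 := fun t => ofCoeffs (c t)
  have huc : ∀ t ∈ Icc 0 T, toCoeffs (u t) = c t := fun t ht =>
    toCoeffs_ofCoeffs ((hcb t ht).sum_norm_sq_le hr0 (hsol t ht).zero)
  have hs : ∀ t ∈ Icc 0 T, Solenoidal (toCoeffs (u t)) := fun t ht => by
    rw [huc t ht]; exact hsol t ht
  have hb : ∀ t ∈ Icc 0 T, SobolevBound r (2 * y) (toCoeffs (u t)) := fun t ht => by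
    rw [huc t ht]; exact hcb t ht
  have hdr : ∀ t ∈ Icc 0 T, ∀ k, toCoeffs (drift ν (u t)) k = -rhs ν (c t) k := fun t ht k => by
    rw [(drift_spec hr hy2 hν (hs t ht) (hb t ht)).1 k, huc t ht]
  have hrc := continuousOn_rhs (ν := ν) hr hy2 (fun t ht => ⟨hcb t ht, (hsol t ht).zero⟩) hcont
  have hint : IntervalIntegrable (fun t => drift ν (u t)) volume 0 T := by
    rw [intervalIntegrable_iff_integrableOn_Icc_of_le hT.le]
    refine Integrable.of_bound ?_ (ν * (2 * y) + 2 * y * (2 * y * latticeSum r)) ?_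
    · refine aestronglyMeasurable_of_toCoeffs fun k => ?_
      exact ((hrc k).neg.congr fun t ht => hdr t ht k).aestronglyMeasurable measurableSet_Icc
    · refine (ae_restrict_iff' measurableSet_Icc).mpr (Filter.Eventually.of_forall fun t ht => ?_)
      exact (drift_spec hr hy2 hν (hs t ht) (hb t ht)).2
  refine ⟨u, ⟨?_, ?_⟩, hint, fun t ht => ?_⟩
  · refine aestronglyMeasurable_of_toCoeffs fun k => ?_
    refine ((hcont k).congr fun t ht => ?_).aestronglyMeasurable measurableSet_Icc
    rw [huc t ht]
  · refine (ae_restrict_iff' measurableSet_Icc).mpr (Filter.Eventually.of_forall fun t ht => ?_)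
    exact inSobolev_of_sobolevBound hr0 hy2 ((isSolenoidal_iff _).mpr (hs t ht)) (hb t ht)
  · refine field_ext (funext fun k => ?_)
    have hint' : IntervalIntegrable (fun s => drift ν (u s)) volume 0 t :=
      hint.mono_set (by
        rw [uIcc_of_le ht.1, uIcc_of_le hT.le]; exact Icc_subset_Icc_right ht.2)
    have h1 := (coeffL k).intervalIntegral_comp_comm hint'
    rw [leray_self ha, huc t ht, hceq k t ht, ← coeffL_apply k (a - _), map_sub, ← h1,
      sub_eq_add_neg, ← intervalIntegral.integral_neg, coeffL_apply]
    congr 1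
    refine intervalIntegral.integral_congr fun s hs => ?_
    rw [uIcc_of_le ht.1] at hs
    simp only [coeffL_apply, hdr s ⟨hs.1, hs.2.trans ht.2⟩ k, neg_neg]

/-! ### The existence time and the Gevrey solutions -/

/-- Every time `T` with `C T ‖a‖ < 1` is a time of existence; for `a = 0` these are all times. -/
lemma ofReal_le_maximalTime {r T : ℝ} (hr : 9 / 2 < r) (hT : 0 < T) {a : FieldL2}
    (ha : InSobolev r a) (hTa : lifespanConst r * sobolevNorm r a * T < 1) :
    ENNReal.ofReal T ≤ maximalTime r a := by
  have hC := lifespanConst_pos (r := r) (by linarith)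
  have hy : 0 < 1 / (lifespanConst r * T) := by positivity
  have hle : sobolevNorm r a ≤ 1 / (lifespanConst r * T) := by
    rw [le_div_iff₀ (by positivity)]
    linarith
  refine le_sSup ⟨T, hT, rfl, √(2 ^ r) * (2 * (1 / (lifespanConst r * T))), fun ν hν => ?_⟩
  refine exists_isSolution hr hν hT hy (le_of_eq ?_) ((isSolenoidal_iff a).mp ha.1)
    (sobolevBound_of_inSobolev (by linarith) ha hle)
  field_simp

/-- The lower bound for the maximal time; it is `∞` for `a = 0`. -/
lemma inv_le_maximalTime {r : ℝ} (hr : 9 / 2 < r) {a : FieldL2} (ha : InSobolev r a) :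
    (ENNReal.ofReal (lifespanConst r * sobolevNorm r a))⁻¹ ≤ maximalTime r a := by
  have hC := lifespanConst_pos (r := r) (by linarith)
  have hN := mul_nonneg hC.le (sobolevNorm_nonneg r a)
  refine le_of_forall_lt fun b hb => ?_
  have hbt : b ≠ ⊤ := hb.ne_top
  suffices h : ∃ T : ℝ, b.toReal < T ∧ lifespanConst r * sobolevNorm r a * T < 1 by
    obtain ⟨T, hT1, hT2⟩ := h
    refine lt_of_lt_of_le ?_
      (ofReal_le_maximalTime hr (ENNReal.toReal_nonneg.trans_lt hT1) ha hT2)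
    exact (ENNReal.lt_ofReal_iff_toReal_lt hbt).mpr hT1
  rcases hN.eq_or_lt with h0 | h0
  · exact ⟨b.toReal + 1, by linarith, by rw [← h0]; simp⟩
  · rw [← ENNReal.ofReal_inv_of_pos h0, ENNReal.lt_ofReal_iff_toReal_lt hbt] at hb
    obtain ⟨T, hT1, hT2⟩ := exists_between hb
    refine ⟨T, hT1, ?_⟩
    calc _ < _ := mul_lt_mul_of_pos_left hT2 h0
      _ = 1 := mul_inv_cancel₀ h0.ne'

/-- An `H^r` solution with Gevrey datum is the unique Gevrey solution. The radius only has to decrease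
at the rate `C₁`, and `C₂ = 1` is an arbitrary choice. -/
lemma existsUnique_gevrey {s r M ν T τ₀ : ℝ} (hr : 9 / 2 < r) (hs : 1 ≤ s) (hν : 0 ≤ ν)
    (hT : 0 < T) (hM : 0 ≤ M) (hτ₀ : 0 < τ₀) {a : FieldL2} (ha : InGevrey s r τ₀ a) {u : ℝ → FieldL2}
    (huM : LinftySobolevLe r T M u) (hu : IsSolution ν T a u) :
    ExistsUniqueGevreySolution ν s r
      (gevreyRadius τ₀ (radiusRate r M T (gevreyNorm s r τ₀ a ^ 2)) 1) T a := by
  have hr0 : 0 ≤ r := by linarith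
  have hp : 0 ≤ 1 / s := by positivity
  have hp1 : 1 / s ≤ 1 := (div_le_one (by linarith)).mpr hs
  have hsa := (isSolenoidal_iff a).mp ha.1.1
  set A := gevreyNorm s r τ₀ a ^ 2 with hA
  have hC₁ := radiusRate_pos hr0 M T A
  have hτ : ∀ t ∈ Icc 0 T, 0 ≤ gevreyRadius τ₀ (radiusRate r M T A) 1 t := fun t ht =>
    (gevreyRadius_pos hτ₀ hC₁ one_pos ht.1).le
  have hub : ∀ᵐ t ∂volume.restrict (Icc (0 : ℝ) T),
      Solenoidal (toCoeffs (u t)) ∧ SobolevBound r M (toCoeffs (u t)) := by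
    filter_upwards [huM.2] with t ht
    exact ⟨(isSolenoidal_iff _).mp ht.1.1, sobolevBound_of_inSobolev hr0 ht.1 ht.2⟩
  obtain ⟨hum, hubd, hu0⟩ := solvesModes_of_isSolution hr hM hν hT hsa hu hub
  refine ⟨u, ⟨⟨huM.1, √(gevreyBound r M T A), ?_⟩, hu⟩, fun w hw hws t ht => ?_⟩
  · refine (ae_restrict_iff' measurableSet_Icc).mpr (Filter.Eventually.of_forall fun t ht => ?_)
    have hin := inSobolev_of_sobolevBound hr0 hM
      ((isSolenoidal_iff _).mpr ((hum ∅).sol t ht)) (hubd t ht)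
    refine gevrey_of_wEnergy_le hin.1 fun F => ?_
    refine wEnergy_le_of_solvesModes hr hp hp1 hM (sq_nonneg _) hν hτ₀ one_pos hum hubd
      (fun F => ?_) ht F
    rw [hu0]
    exact wEnergy_le_gevreyNorm_sq ha F
  · obtain ⟨-, M', hM'⟩ := hw
    set M₂ := max M M' with hM₂
    have hM₂0 : 0 ≤ M₂ := hM.trans (le_max_left _ _)
    have hmono : ∀ {c : Coeffs}, SobolevBound r M c → SobolevBound r M₂ c := fun h F =>
      (h F).trans (pow_le_pow_left₀ hM (le_max_left _ _) 2)
    have hwb : ∀ᵐ t ∂volume.restrict (Icc (0 : ℝ) T),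
        Solenoidal (toCoeffs (w t)) ∧ SobolevBound r M₂ (toCoeffs (w t)) := by
      filter_upwards [hM', ae_restrict_mem measurableSet_Icc] with t ht htI
      exact ⟨(isSolenoidal_iff _).mp ht.1.1.1,
        sobolevBound_of_inGevrey (hτ t htI) ht.1 (ht.2.trans (le_max_right _ _))⟩
    obtain ⟨hwm, hwbd, hw0⟩ := solvesModes_of_isSolution hr hM₂0 hν hT hsa hws hwb
    exact field_ext (eq_of_solvesModes hr hM₂0 hν hwm hum hwbd
      (fun t ht => hmono (hubd t ht)) (by rw [hw0, hu0]) ht)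

end GevreyNS

end


theorem theorem3p3 (r : ℝ) (hr : 9 / 2 < r) :
    ∃ C : ℝ, 0 < C ∧
      ∀ (s τ₀ : ℝ), 1 ≤ s → 0 < τ₀ →
      ∀ a : GevreyNS.FieldL2, GevreyNS.InGevrey s r τ₀ a →
        (ENNReal.ofReal (C * GevreyNS.sobolevNorm r a))⁻¹ ≤ GevreyNS.maximalTime r a ∧
        ∀ T : ℝ, 0 < T → ENNReal.ofReal T < GevreyNS.maximalTime r a →
          ∃ C₁ C₂ : ℝ, 0 < C₁ ∧ 0 < C₂ ∧
            (∀ ν : ℝ, 0 < ν →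
              GevreyNS.ExistsUniqueGevreySolution ν s r
                (GevreyNS.gevreyRadius τ₀ C₁ C₂) T a) ∧
            GevreyNS.ExistsUniqueGevreySolution 0 s r
              (GevreyNS.gevreyRadius τ₀ C₁ C₂) T a := by
  refine ⟨GevreyNS.lifespanConst r, GevreyNS.lifespanConst_pos (by linarith),
    fun s τ₀ hs hτ₀ a ha => ⟨GevreyNS.inv_le_maximalTime hr ha.1, fun T hT hTm => ?_⟩⟩
  -- The bound `M` is common to all viscosities, and so the radius does not depend on `ν`.
  obtain ⟨S, ⟨T', hT', rfl, M, hM⟩, hTS⟩ := lt_sSup_iff.mp hTm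
  have hTT' : T ≤ T' := ((ENNReal.ofReal_lt_ofReal_iff hT').mp hTS).le
  have hsub : Icc 0 T ⊆ Icc 0 T' := Icc_subset_Icc_right hTT'
  have key : ∀ ν : ℝ, 0 ≤ ν → GevreyNS.ExistsUniqueGevreySolution ν s r
      (GevreyNS.gevreyRadius τ₀
        (GevreyNS.radiusRate r |M| T (GevreyNS.gevreyNorm s r τ₀ a ^ 2)) 1) T a := by
    intro ν hν
    obtain ⟨u, huM, hu⟩ := hM ν hν
    refine GevreyNS.existsUnique_gevrey hr hs hν hT (abs_nonneg M) hτ₀ ha (u := u) ⟨?_, ?_⟩ ⟨?_, ?_⟩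
    · exact huM.1.mono_measure (Measure.restrict_mono hsub le_rfl)
    · filter_upwards [ae_restrict_of_ae_restrict_of_subset hsub huM.2] with t ht
      exact ⟨ht.1, ht.2.trans (le_abs_self M)⟩
    · refine hu.1.mono_set ?_
      rwa [uIcc_of_le hT.le, uIcc_of_le hT'.le]
    · exact fun t ht => hu.2 t (hsub ht)
  exact ⟨_, 1, GevreyNS.radiusRate_pos (by linarith) _ _ _, one_pos, fun ν hν => key ν hν.le,
    key 0 le_rfl⟩
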